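/- Let $E$ be a unital commutative C*-algebra. Let $T$ be a group that is the union of an increasing sequence $(T_n)_{n\ge 0}$ of finite subgroups with $T_0=\{1\}$, and let $f:T\times T\to \mathrm{Un}\,E$ (unitaries of $E$) be a Schur function: $f(1,1)=1$ and $f(r,s)f(rs,t)=f(r,st)f(s,t)$ for all $r,s,t\in T$. *The algebras $A_n$.* A full $E$-C*-algebra is a unital C*-algebra $A$ containing $E$ as a central unital C*-subalgebra. For such an $A$ let $A_n=\{\sum_{t\in T_n}(X_t\otimes \mathrm{id})V_t : X_t\in A\}$, a unital C*-algebra of operators on $A^{T_n}$, where $((x\otimes\mathrm{id})V_t\xi)(s)=f(t,t^{-1}s)\,x\,\xi(t^{-1}s)$; the same formula identifies $A_{n-1}$ with a subalgebra of $A_n$, and a unital $E$-linear *-homomorphism $\varphi:A\to B$ induces $\varphi_n:A_n\to B_n$ coefficientwise. Let $C_n\in E_n$ $(n\ge1)$ be fixed elements such that $P_n:=C_n^*C_n$ and $Q_n:=C_nC_n^*$ are projections, $P_n+Q_n=1$, and $C_n$ commutes with every element of $E_{n-1}$. *$K$-groups.* An $E$-C*-algebra is a C*-algebra $F$ (not necessarily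 unital) with a bilinear multiplication $E\times F\to F$ that makes $F$ a unital $E$-module and satisfies $(\alpha x)^*=\alpha^*x^*$, $\|\alpha x\|\le\|\alpha\|\,\|x\|$ and $\alpha(xy)=(\alpha x)y=x(\alpha y)$. Let $\check F=E\times F$ with product $(\alpha,x)(\beta,y)=(\alpha\beta,\alpha y+\beta x+xy)$, involution $(\alpha,x)^*=(\alpha^*,x^*)$ and its unique C*-norm, a full $E$-C*-algebra; let $\pi^F(\alpha,x)=\alpha\in E$, $\sigma^F(\alpha,x)=(\alpha,0)$, and $\check\varphi(\alpha,x)=(\alpha,\varphi x)$ for an $E$-linear *-homomorphism $\varphi$. For a full $E$-C*-algebra $A$, let $A_\to$ be the algebraic inductive limit of the maps $A_{n-1}\to A_n$, $X\mapsto P_nX$. Projections $p,q\in A_\to$ are equivalent if $p=x^*x$ and $q=xx^*$ for some $x\in A_\to$. Every pair of classes has orthogonal representatives $p,q$; the sum of the classes is the class of $p+q$, and $K_0^{\mathrm{full}}(A)$ is the Grothendieck group of this commutative monoid. For an $E$-C*-algebra $F$ let $K_0(F)=\ker\big(K_0^{\mathrm{full}}(\pi^F):K_0^{\mathrm{full}}(\check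 F)\to K_0^{\mathrm{full}}(E)\big)$. Let $\mathrm{un}\,\check F$ be the algebraic inductive limit of the groups $\mathrm{Un}\,\check F_n$ under $\mathrm{Un}\,\check F_{n-1}\to\mathrm{Un}\,\check F_n$, $U\mapsto P_nU+Q_n$, and let $\mathrm{un}_h\check F$ be the union of the images of the sets of those $U\in\mathrm{Un}\,\check F_n$ that are homotopic in $\mathrm{Un}\,\check F_n$ to a unitary of $E_n$. This is a normal subgroup with commutative quotient, and $K_1(F)=\mathrm{un}\,\check F/\mathrm{un}_h\check F$. *Cone, suspension, index map.* For an $E$-C*-algebra $F$ let $CF$ be the $E$-C*-algebra of continuous $x:[0,1]\to F$ with $x(0)=0$, let $SF=\{x\in CF: x(1)=0\}$, let $i_F:SF\to CF$ be the inclusion and $j_F:CF\to F$, $x\mapsto x(1)$. **Theorem.** For every $E$-C*-algebra $F$ there is exactly one group homomorphism $\theta_F:K_1(F)\to K_0(SF)$ (the index map of $0\to SF\xrightarrow{i_F}CF\xrightarrow{j_F}F\to0$) such that $$\theta_F[U]=[P]-[\sigma^{SF}_nP]$$ for all $n\ge1$, all unitaries $U\in\check F_{n-1}$, all unitaries $V\in(\check{CF})_n$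 and all projections $P\in(\check{SF})_n$ with $(\check j_F)_nV=P_nU+Q_nU^*$ and $(\check i_F)_nP=VP_nV^*$; and $\theta_F$ is a group isomorphism. -/

import Mathlib

set_option linter.unusedSectionVars false

open scoped unitInterval

noncomputable section

namespace ProjectiveKTheory

/-! ### `E`-C*-algebras -/

/-- An `E`-C*-algebra: a C*-algebra `F` (not necessarily unital) with a bilinear exterior
multiplication by the elements of the commutative unital C*-algebra `E`. -/
class ECStarAlgebra (E F : Type*) [CommCStarAlgebra E] [NonUnitalCStarAlgebra F] extends
    Module E F where
  complex_smul_smul : ∀ (c : ℂ) (a : E) (x : F), (c • a) • x = c • (a • x)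
  smul_complex_smul : ∀ (c : ℂ) (a : E) (x : F), a • (c • x) = c • (a • x)
  star_smul_eq : ∀ (a : E) (x : F), star (a • x) = star a • star x
  norm_smul_le_mul : ∀ (a : E) (x : F), ‖a • x‖ ≤ ‖a‖ * ‖x‖
  smul_mul_left : ∀ (a : E) (x y : F), a • (x * y) = (a • x) * y
  smul_mul_right : ∀ (a : E) (x y : F), a • (x * y) = x * (a • y)

/-- A full `E`-C*-algebra: a unital C*-algebra containing `E` as a canonical central unital
C*-subalgebra (the image of the injective map `algebraMap E A`). -/
class FullECStarAlgebra (E A : Type*) [CommCStarAlgebra E] [CStarAlgebra A] [Algebra E A] :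
    Prop where
  algebraMap_complex_smul : ∀ (c : ℂ) (a : E), algebraMap E A (c • a) = c • algebraMap E A a
  algebraMap_star : ∀ a : E, algebraMap E A (star a) = star (algebraMap E A a)
  algebraMap_injective : Function.Injective (algebraMap E A)

section EAlg

variable {E F : Type*} [CommCStarAlgebra E] [NonUnitalCStarAlgebra F] [ECStarAlgebra E F]

instance : IsScalarTower ℂ E F := ⟨ECStarAlgebra.complex_smul_smul⟩
instance : StarModule E F := ⟨ECStarAlgebra.star_smul_eq⟩
instance : IsScalarTower E F F := ⟨fun a x y => (ECStarAlgebra.smul_mul_left a x y).symm⟩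
instance : SMulCommClass E F F := ⟨fun a x y => ECStarAlgebra.smul_mul_right a x y⟩

variable (F) in
/-- Multiplication by `a` as a bounded linear map. -/
def smulCLM (a : E) : F →L[ℂ] F :=
  LinearMap.mkContinuous
    { toFun := fun x => a • x
      map_add' := smul_add a
      map_smul' := fun c x => ECStarAlgebra.smul_complex_smul c a x } ‖a‖
    (ECStarAlgebra.norm_smul_le_mul a)

theorem smulCLM_apply (a : E) (x : F) : smulCLM F a x = a • x := rfl

theorem continuous_const_smul_of_E (a : E) : Continuous fun x : F => a • x :=
  (smulCLM F a).continuous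

end EAlg

section FullAlg

variable {E A : Type*} [CommCStarAlgebra E] [CStarAlgebra A] [Algebra E A]
  [FullECStarAlgebra E A]

instance : StarModule E A where
  star_smul a x := by
    rw [Algebra.smul_def, Algebra.smul_def, star_mul, ← FullECStarAlgebra.algebraMap_star]
    exact (Algebra.commutes _ _).symm

end FullAlg

instance fullSelf (E : Type*) [CommCStarAlgebra E] : FullECStarAlgebra E E where
  algebraMap_complex_smul _ _ := rfl
  algebraMap_star _ := rfl
  algebraMap_injective := fun _ _ h => h

/-! ### The unitization over `E` -/

/-- The algebra `E × F` with `(a, x) (b, y) = (a b, a y + b x + x y)` and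
`(a, x)^* = (a^*, x^*)`. It is a full `E`-C*-algebra with its unique C*-norm, constructed below. -/
def EUnit (E F : Type*) : Type _ := Unitization E F

section EUnit

variable {E F G : Type*} [CommCStarAlgebra E] [NonUnitalCStarAlgebra F] [ECStarAlgebra E F]
  [NonUnitalCStarAlgebra G] [ECStarAlgebra E G]

instance : Ring (EUnit E F) := inferInstanceAs (Ring (Unitization E F))
instance : StarRing (EUnit E F) := inferInstanceAs (StarRing (Unitization E F))
instance : Algebra E (EUnit E F) := inferInstanceAs (Algebra E (Unitization E F))
instance : Algebra ℂ (EUnit E F) := inferInstanceAs (Algebra ℂ (Unitization E F))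
instance : StarModule E (EUnit E F) := inferInstanceAs (StarModule E (Unitization E F))

namespace EUnit

def mk (a : E) (x : F) : EUnit E F := Unitization.mk (a, x)
def scalar (z : EUnit E F) : E := (Unitization.toProd (R := E) (A := F) z).1
def vec (z : EUnit E F) : F := (Unitization.toProd (R := E) (A := F) z).2

theorem ext {z w : EUnit E F} (h1 : z.scalar = w.scalar) (h2 : z.vec = w.vec) : z = w :=
  Unitization.ext h1 h2

theorem scalar_mk (a : E) (x : F) : (mk a x).scalar = a := rfl
theorem vec_mk (a : E) (x : F) : (mk a x).vec = x := rfl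
theorem scalar_zero : (0 : EUnit E F).scalar = 0 := rfl
theorem vec_zero : (0 : EUnit E F).vec = 0 := rfl
theorem scalar_one : (1 : EUnit E F).scalar = 1 := rfl
theorem vec_one : (1 : EUnit E F).vec = 0 := rfl
theorem scalar_add (z w : EUnit E F) : (z + w).scalar = z.scalar + w.scalar := rfl
theorem vec_add (z w : EUnit E F) : (z + w).vec = z.vec + w.vec := rfl
theorem scalar_mul (z w : EUnit E F) : (z * w).scalar = z.scalar * w.scalar := rfl
theorem vec_mul (z w : EUnit E F) :
    (z * w).vec = z.scalar • w.vec + w.scalar • z.vec + z.vec * w.vec := rfl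
theorem scalar_star (z : EUnit E F) : (star z).scalar = star z.scalar := rfl
theorem vec_star (z : EUnit E F) : (star z).vec = star z.vec := rfl
theorem scalar_smul (c : ℂ) (z : EUnit E F) : (c • z).scalar = c • z.scalar := rfl
theorem vec_smul (c : ℂ) (z : EUnit E F) : (c • z).vec = c • z.vec := rfl

/-- `z = (a, x)` acts on `F` from the left by `y ↦ a y + x y` and from the right by
`y ↦ a y + y x`. -/
def toMultiplier (z : EUnit E F) : DoubleCentralizer ℂ F where
  fst := smulCLM F z.scalar + ContinuousLinearMap.mul ℂ F z.vec
  snd := smulCLM F z.scalar + (ContinuousLinearMap.mul ℂ F).flip z.vec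
  central x y := by
    simp [smulCLM_apply, add_mul, mul_add, mul_assoc, smul_mul_assoc, mul_smul_comm]

/-- The injective *-homomorphism `E × F → E × M(F)`, `M(F)` the multiplier algebra, that induces
the C*-norm. -/
def toProdMultiplier : EUnit E F →+* E × DoubleCentralizer ℂ F where
  toFun z := (z.scalar, z.toMultiplier)
  map_one' := by
    refine Prod.ext rfl (DoubleCentralizer.ext _ _ _ _ (Prod.ext ?_ ?_)) <;>
    · ext y
      simp [toMultiplier, smulCLM_apply, scalar_one, vec_one]
  map_mul' z w := by
    refine Prod.ext rfl (DoubleCentralizer.ext _ _ _ _ (Prod.ext ?_ ?_)) <;>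
    · ext y
      simp [toMultiplier, smulCLM_apply, scalar_mul, vec_mul, add_mul, mul_add, mul_assoc,
        smul_mul_assoc, mul_smul_comm, smul_smul, mul_comm]
      abel
  map_zero' := by
    refine Prod.ext rfl (DoubleCentralizer.ext _ _ _ _ (Prod.ext ?_ ?_)) <;>
    · ext y
      simp [toMultiplier, smulCLM_apply, scalar_zero, vec_zero]
  map_add' z w := by
    refine Prod.ext rfl (DoubleCentralizer.ext _ _ _ _ (Prod.ext ?_ ?_)) <;>
    · ext y
      simp [toMultiplier, smulCLM_apply, scalar_add, vec_add, add_smul]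
      abel

theorem toProdMultiplier_star (z : EUnit E F) :
    toProdMultiplier (star z) = star (toProdMultiplier z) := by
  refine Prod.ext rfl (DoubleCentralizer.ext _ _ _ _ (Prod.ext ?_ ?_)) <;>
  · ext y
    simp [toProdMultiplier, toMultiplier, smulCLM_apply, scalar_star, vec_star, star_smul]

theorem toProdMultiplier_smul (c : ℂ) (z : EUnit E F) :
    toProdMultiplier (c • z) = c • toProdMultiplier z := by
  refine Prod.ext rfl (DoubleCentralizer.ext _ _ _ _ (Prod.ext ?_ ?_)) <;>
  · ext y
    simp [toProdMultiplier, toMultiplier, smulCLM_apply, scalar_smul, vec_smul, smul_assoc]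

theorem norm_vec_le (z : EUnit E F) : ‖z.vec‖ ≤ 2 * ‖toProdMultiplier z‖ := by
  have h1 : ‖z.scalar‖ ≤ ‖toProdMultiplier z‖ := norm_fst_le (toProdMultiplier z)
  have h2 : ‖(z.toMultiplier).fst‖ ≤ ‖toProdMultiplier z‖ := by
    rw [DoubleCentralizer.norm_fst]
    exact norm_snd_le (toProdMultiplier z)
  have h3 : ‖smulCLM F z.scalar‖ ≤ ‖z.scalar‖ :=
    LinearMap.mkContinuous_norm_le _ (norm_nonneg _) _
  have h4 : ContinuousLinearMap.mul ℂ F z.vec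
      = (z.toMultiplier).fst - smulCLM F z.scalar := by
    simp [toMultiplier]
  have h5 : ‖ContinuousLinearMap.mul ℂ F z.vec‖ = ‖z.vec‖ :=
    ContinuousLinearMap.opNorm_mul_apply ℂ F z.vec
  calc ‖z.vec‖ = ‖(z.toMultiplier).fst - smulCLM F z.scalar‖ := by rw [← h5, h4]
    _ ≤ ‖(z.toMultiplier).fst‖ + ‖smulCLM F z.scalar‖ := norm_sub_le _ _
    _ ≤ 2 * ‖toProdMultiplier z‖ := by linarith

theorem norm_le_add (z : EUnit E F) : ‖toProdMultiplier z‖ ≤ ‖z.scalar‖ + ‖z.vec‖ := by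
  have h3 : ‖smulCLM F z.scalar‖ ≤ ‖z.scalar‖ :=
    LinearMap.mkContinuous_norm_le _ (norm_nonneg _) _
  have h5 : ‖ContinuousLinearMap.mul ℂ F z.vec‖ = ‖z.vec‖ :=
    ContinuousLinearMap.opNorm_mul_apply ℂ F z.vec
  refine max_le (by simp [toProdMultiplier]) ?_
  change ‖z.toMultiplier‖ ≤ _
  rw [← DoubleCentralizer.norm_fst]
  refine (norm_add_le _ _).trans ?_
  linarith

theorem toProdMultiplier_injective :
    Function.Injective (toProdMultiplier : EUnit E F →+* E × DoubleCentralizer ℂ F) := by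
  rw [injective_iff_map_eq_zero]
  intro z hz
  have h := norm_vec_le z
  rw [hz, norm_zero, mul_zero] at h
  have h0 : (toProdMultiplier z).1 = 0 := by rw [hz]; rfl
  exact ext h0 (norm_le_zero_iff.1 h)

/-- The C*-norm: `‖(a, x)‖` is the maximum of `‖a‖` and of the norm of `y ↦ a y + x y` on `F`. -/
instance : NormedRing (EUnit E F) :=
  NormedRing.induced _ _ toProdMultiplier toProdMultiplier_injective

theorem norm_def (z : EUnit E F) : ‖z‖ = ‖toProdMultiplier z‖ := rfl

instance : NormedAlgebra ℂ (EUnit E F) where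
  norm_smul_le c z := by
    rw [norm_def, norm_def, toProdMultiplier_smul]
    exact norm_smul_le _ _

instance : StarModule ℂ (EUnit E F) :=
  ⟨fun c z => ext (star_smul c z.scalar) (star_smul c z.vec)⟩

instance : CStarRing (EUnit E F) where
  norm_mul_self_le z := by
    rw [norm_def, norm_def, map_mul, toProdMultiplier_star]
    exact (CStarRing.norm_star_mul_self).ge

/-- The identification of `EUnit E F` with `E × F`. -/
def toProdHom : EUnit E F →+ E × F where
  toFun z := (z.scalar, z.vec)
  map_zero' := rfl
  map_add' _ _ := rfl

instance : CompleteSpace (EUnit E F) := by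
  have h1 : LipschitzWith 2 (toProdHom : EUnit E F →+ E × F) := by
    refine AddMonoidHomClass.lipschitz_of_bound_nnnorm _ 2 fun z => ?_
    change ‖toProdHom z‖ ≤ 2 * ‖z‖
    refine max_le ?_ (norm_vec_le z)
    have h1 : ‖z.scalar‖ ≤ ‖toProdMultiplier z‖ := norm_fst_le (toProdMultiplier z)
    have h2 := norm_nonneg (toProdMultiplier z)
    change ‖z.scalar‖ ≤ 2 * ‖toProdMultiplier z‖
    linarith
  have h2 : AntilipschitzWith 2 (toProdHom : EUnit E F →+ E × F) := by
    refine AddMonoidHomClass.antilipschitz_of_bound _ fun z => ?_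
    have h3 : ‖z.scalar‖ ≤ ‖toProdHom z‖ := norm_fst_le (toProdHom z)
    have h4 : ‖z.vec‖ ≤ ‖toProdHom z‖ := norm_snd_le (toProdHom z)
    refine (norm_le_add z).trans ?_
    push_cast
    linarith
  rw [completeSpace_iff_isComplete_range (h2.isUniformInducing h1.uniformContinuous)]
  have h3 : Set.range (toProdHom : EUnit E F →+ E × F) = Set.univ :=
    Set.range_eq_univ.2 fun p => ⟨mk p.1 p.2, rfl⟩
  rw [h3]
  exact isComplete_univ

instance : CStarAlgebra (EUnit E F) where

instance : FullECStarAlgebra E (EUnit E F) where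
  algebraMap_complex_smul c _ := ext rfl (smul_zero c).symm
  algebraMap_star _ := ext rfl (star_zero F).symm
  algebraMap_injective := fun _ _ h => congrArg scalar h

/-- The unital `E`-linear homomorphism `(a, x) ↦ (a, φ x)`. -/
def map (φ : F →⋆ₙₐ[E] G) : EUnit E F →⋆ₐ[E] EUnit E G := Unitization.starMap (R := E) φ

theorem map_mk (φ : F →⋆ₙₐ[E] G) (a : E) (x : F) : map φ (mk a x) = mk a (φ x) := by
  refine ext ?_ ?_
  · exact add_zero a
  · exact zero_add (φ x)

variable (E F) in
/-- `(a, x) ↦ a`. -/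
def proj : EUnit E F →⋆ₐ[E] E where
  toFun := scalar
  map_one' := rfl
  map_mul' _ _ := rfl
  map_zero' := rfl
  map_add' _ _ := rfl
  commutes' _ := rfl
  map_star' _ := rfl

variable (E F) in
/-- `(a, x) ↦ (a, 0)`. -/
def scalarPart : EUnit E F →⋆ₐ[E] EUnit E F where
  toFun z := mk z.scalar 0
  map_one' := rfl
  map_mul' z w := ext rfl (by simp [vec_mul, vec_mk])
  map_zero' := rfl
  map_add' z w := ext rfl (by simp [vec_add, vec_mk])
  commutes' _ := rfl
  map_star' z := ext rfl (by simp [vec_star, vec_mk])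

end EUnit

end EUnit

/-! ### The algebras `F_n` of projective representations -/

/-- A group `T` that is the union of an increasing sequence of finite subgroups `T_n`, `T_0 = {1}`,
together with a Schur `E`-function `f` for `T`. -/
structure SchurSystem (E T : Type*) [CommCStarAlgebra E] [Group T] where
  sub : ℕ → Subgroup T
  finite_sub : ∀ n, Finite (sub n)
  monotone_sub : Monotone sub
  sub_zero : sub 0 = ⊥
  exists_mem_sub : ∀ t : T, ∃ n, t ∈ sub n
  f : T → T → unitary E
  f_one_one : f 1 1 = 1
  f_cocycle : ∀ r s t : T, f r s * f (r * s) t = f r (s * t) * f s t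

section Projective

variable {E T : Type*} [CommCStarAlgebra E] [Group T] (S : SchurSystem E T)

instance (n : ℕ) : Fintype (S.sub n) := @Fintype.ofFinite _ (S.finite_sub n)
instance (n : ℕ) : DecidableEq (S.sub n) := Classical.decEq _

namespace SchurSystem

theorem f_one_right (t : T) : S.f t 1 = 1 := by
  have h := S.f_cocycle t 1 1
  simp only [mul_one, S.f_one_one] at h
  simpa using h

theorem f_one_left (t : T) : S.f 1 t = 1 := by
  have h := S.f_cocycle 1 1 t
  simp only [one_mul, mul_one, S.f_one_one] at h
  simpa using h.symm

end SchurSystem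

variable {A : Type*} [CStarAlgebra A] [Algebra E A] [FullECStarAlgebra E A]
variable {B : Type*} [CStarAlgebra B] [Algebra E B] [FullECStarAlgebra E B]

/-- The operator `∑ t ∈ T_n, (X_t ⊗ id) V_t` on `A^{T_n}`, where
`(V_t ξ)(s) = f(t, t⁻¹ s) ξ(t⁻¹ s)`, written as a `T_n × T_n` matrix over `A`: it maps `ξ` to
`s ↦ ∑ r, f(s r⁻¹, r) X_{s r⁻¹} ξ(r)`. Only the values of `X` on `T_n` matter. -/
def projOp (n : ℕ) (X : T → A) : CStarMatrix (S.sub n) (S.sub n) A :=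
  CStarMatrix.ofMatrix fun s r =>
    (S.f ((s : T) * (r : T)⁻¹) r : E) • X ((s : T) * (r : T)⁻¹)

theorem projOp_apply (n : ℕ) (X : T → A) (s r : S.sub n) :
    projOp S n X s r = (S.f ((s : T) * (r : T)⁻¹) r : E) • X ((s : T) * (r : T)⁻¹) := rfl

/-- The description of `projOp` as an operator on columns `ξ ∈ A^{T_n}`. -/
theorem sum_projOp_mul (n : ℕ) (X : T → A) (ξ : S.sub n → A) (s : S.sub n) :
    ∑ r, projOp S n X s r * ξ r
      = ∑ t : S.sub n, (S.f t ((t : T)⁻¹ * s) : E) • (X t * ξ (t⁻¹ * s)) := by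
  refine Fintype.sum_equiv ((Equiv.inv _).trans (Equiv.mulLeft s)) _ _ fun r => ?_
  simp [projOp_apply]

/-- Twisted convolution over `T_n`. -/
def conv (n : ℕ) (X Y : T → A) : T → A := fun t =>
  ∑ v : S.sub n, (S.f v ((v : T)⁻¹ * t) : E) • (X v * Y ((v : T)⁻¹ * t))

theorem projOp_mul (n : ℕ) (X Y : T → A) :
    projOp S n X * projOp S n Y = projOp S n (conv S n X Y) := by
  ext s r
  rw [CStarMatrix.mul_apply, projOp_apply, conv, Finset.smul_sum]
  refine Fintype.sum_equiv ((Equiv.inv _).trans (Equiv.mulLeft s)) _ _ fun u => ?_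
  have h := S.f_cocycle ((s : T) * (u : T)⁻¹) ((u : T) * (r : T)⁻¹) r
  have h' := congrArg (Subtype.val) h
  simp only [mul_assoc, inv_mul_cancel_left, inv_mul_cancel, mul_one, Submonoid.coe_mul] at h'
  simp only [projOp_apply, smul_mul_assoc, mul_smul_comm, smul_smul, Equiv.trans_apply,
    Equiv.inv_apply, Equiv.coe_mulLeft, Subgroup.coe_mul, Subgroup.coe_inv, mul_inv_rev, inv_inv,
    mul_assoc, inv_mul_cancel_left]
  rw [mul_comm, ← h', mul_comm]

/-- The coefficients of the adjoint operator. -/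
def convStar (X : T → A) : T → A := fun t => star (S.f t t⁻¹ : E) • star (X t⁻¹)

theorem projOp_star (n : ℕ) (X : T → A) :
    star (projOp S n X) = projOp S n (convStar S X) := by
  ext s r
  have h := S.f_cocycle ((s : T) * (r : T)⁻¹) ((r : T) * (s : T)⁻¹) s
  have h1 : (s : T) * (r : T)⁻¹ * ((r : T) * (s : T)⁻¹) = 1 := by group
  have h2 : (r : T) * (s : T)⁻¹ * (s : T) = r := by group
  have h3 : ((s : T) * (r : T)⁻¹)⁻¹ = (r : T) * (s : T)⁻¹ := by group
  rw [h1, h2, S.f_one_left, mul_one] at h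
  have h4 : star (S.f ((r : T) * (s : T)⁻¹) s)
      = S.f ((s : T) * (r : T)⁻¹) r * star (S.f ((s : T) * (r : T)⁻¹) ((r : T) * (s : T)⁻¹)) := by
    rw [h, Unitary.star_eq_inv, Unitary.star_eq_inv]
    simp
  have h5 := congrArg Subtype.val h4
  simp only [Submonoid.coe_mul, Unitary.coe_star] at h5
  change star (projOp S n X r s) = _
  rw [projOp_apply, projOp_apply, convStar, star_smul, smul_smul, h3, h5]

theorem projOp_add (n : ℕ) (X Y : T → A) :
    projOp S n (X + Y) = projOp S n X + projOp S n Y := by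
  ext s r
  simp [projOp_apply]

variable (T A) in
/-- The coefficients of the scalar operator `c`. -/
def scalarCoeff (c : ℂ) : T → A := fun t => open Classical in
  if t = 1 then algebraMap ℂ A c else 0

theorem projOp_algebraMap (n : ℕ) (c : ℂ) :
    projOp S n (scalarCoeff T A c)
      = algebraMap ℂ (CStarMatrix (S.sub n) (S.sub n) A) c := by
  classical
  ext s r
  rw [projOp_apply, Algebra.algebraMap_eq_smul_one (A := CStarMatrix (S.sub n) (S.sub n) A),
    CStarMatrix.smul_apply, CStarMatrix.one_apply]
  by_cases h : s = r
  · subst h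
    simp [scalarCoeff, S.f_one_left, Algebra.algebraMap_eq_smul_one]
  · have h' : (s : T) * (r : T)⁻¹ ≠ 1 := fun h1 => h (Subtype.ext (mul_inv_eq_one.1 h1))
    simp [scalarCoeff, h, h']

variable (A) in
/-- The algebra `A_n = {∑ t ∈ T_n, (X_t ⊗ id) V_t}`, as a *-subalgebra of the matrices. -/
def projSubalg (n : ℕ) : StarSubalgebra ℂ (CStarMatrix (S.sub n) (S.sub n) A) where
  carrier := Set.range (projOp S n)
  mul_mem' := by
    rintro _ _ ⟨X, rfl⟩ ⟨Y, rfl⟩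
    exact ⟨_, (projOp_mul S n X Y).symm⟩
  add_mem' := by
    rintro _ _ ⟨X, rfl⟩ ⟨Y, rfl⟩
    exact ⟨_, projOp_add S n X Y⟩
  algebraMap_mem' c := ⟨_, projOp_algebraMap S n c⟩
  star_mem' := by
    rintro _ ⟨X, rfl⟩
    exact ⟨_, (projOp_star S n X).symm⟩

variable (A) in
/-- The *-algebra `A_n = {∑ t ∈ T_n, (X_t ⊗ id) V_t}`. -/
def projAlg (n : ℕ) : Type _ := projSubalg S A n

instance (n : ℕ) : Ring (projAlg S A n) := inferInstanceAs (Ring (projSubalg S A n))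
instance (n : ℕ) : StarRing (projAlg S A n) := inferInstanceAs (StarRing (projSubalg S A n))
instance (n : ℕ) : Algebra ℂ (projAlg S A n) := inferInstanceAs (Algebra ℂ (projSubalg S A n))
instance (n : ℕ) : StarModule ℂ (projAlg S A n) :=
  inferInstanceAs (StarModule ℂ (projSubalg S A n))
/-- The norm topology, which is the topology of entrywise convergence. -/
instance (n : ℕ) : TopologicalSpace (projAlg S A n) :=
  inferInstanceAs (TopologicalSpace (projSubalg S A n))

/-- The element of `A_n` with coefficients `X`. -/
def projElt (n : ℕ) (X : T → A) : projAlg S A n := ⟨projOp S n X, X, rfl⟩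

/-- The coefficient function of an element of `A_n`, extended by `0` to `T`. -/
def coeff (n : ℕ) (x : projAlg S A n) : T → A := fun t => open Classical in
  if h : t ∈ S.sub n then x.1 ⟨t, h⟩ 1 else 0

theorem coeff_of_notMem (n : ℕ) (x : projAlg S A n) {t : T} (h : t ∉ S.sub n) :
    coeff S n x t = 0 := by
  simp [coeff, h]

theorem coeff_projElt (n : ℕ) (X : T → A) {t : T} (h : t ∈ S.sub n) :
    coeff S n (projElt S n X) t = X t := by
  simp [coeff, h, projElt, projOp_apply, S.f_one_right]

theorem projOp_congr (n : ℕ) {X Y : T → A} (h : ∀ t ∈ S.sub n, X t = Y t) :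
    projOp S n X = projOp S n Y := by
  ext s r
  rw [projOp_apply, projOp_apply, h _ (mul_mem s.2 (inv_mem r.2))]

theorem projElt_coeff (n : ℕ) (x : projAlg S A n) : projElt S n (coeff S n x) = x := by
  obtain ⟨_, X, rfl⟩ := x
  exact Subtype.ext (projOp_congr S n fun t ht => coeff_projElt S n X ht)

theorem coeff_projElt_of_support (n : ℕ) {X : T → A} (h : ∀ t ∉ S.sub n, X t = 0) :
    coeff S n (projElt S n X) = X := by
  funext t
  by_cases ht : t ∈ S.sub n
  · exact coeff_projElt S n X ht
  · rw [coeff_of_notMem S n _ ht, h t ht]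

theorem projElt_mul (n : ℕ) (X Y : T → A) :
    projElt S n X * projElt S n Y = projElt S n (conv S n X Y) :=
  Subtype.ext (projOp_mul S n X Y)

theorem projElt_star (n : ℕ) (X : T → A) :
    star (projElt S n X) = projElt S n (convStar S X) :=
  Subtype.ext (projOp_star S n X)

theorem projElt_add (n : ℕ) (X Y : T → A) :
    projElt S n (X + Y) = projElt S n X + projElt S n Y :=
  Subtype.ext (projOp_add S n X Y)

theorem projElt_algebraMap (n : ℕ) (c : ℂ) :
    projElt S n (scalarCoeff T A c)
      = algebraMap ℂ (projAlg S A n) c :=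
  Subtype.ext (projOp_algebraMap S n c)

theorem coeff_mul (n : ℕ) (x y : projAlg S A n) :
    coeff S n (x * y) = conv S n (coeff S n x) (coeff S n y) := by
  rw [← coeff_projElt_of_support S n (X := conv S n (coeff S n x) (coeff S n y)), ← projElt_mul,
    projElt_coeff, projElt_coeff]
  intro t ht
  refine Finset.sum_eq_zero fun v _ => ?_
  have h : (v : T)⁻¹ * t ∉ S.sub n := fun h => ht (by simpa using mul_mem v.2 h)
  rw [coeff_of_notMem S n y h, mul_zero, smul_zero]

theorem coeff_add (n : ℕ) (x y : projAlg S A n) :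
    coeff S n (x + y) = coeff S n x + coeff S n y := by
  rw [← coeff_projElt_of_support S n (X := coeff S n x + coeff S n y), projElt_add,
    projElt_coeff, projElt_coeff]
  intro t ht
  simp [coeff_of_notMem S n _ ht]

theorem coeff_star (n : ℕ) (x : projAlg S A n) :
    coeff S n (star x) = convStar S (coeff S n x) := by
  rw [← coeff_projElt_of_support S n (X := convStar S (coeff S n x)), ← projElt_star,
    projElt_coeff]
  intro t ht
  have h : t⁻¹ ∉ S.sub n := fun h => ht (by simpa using inv_mem h)
  simp [convStar, coeff_of_notMem S n _ h]

theorem coeff_algebraMap (n : ℕ) (c : ℂ) :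
    coeff S n (algebraMap ℂ (projAlg S A n) c)
      = scalarCoeff T A c := by
  rw [← projElt_algebraMap, coeff_projElt_of_support]
  intro t ht
  have h : t ≠ 1 := fun h => ht (h ▸ one_mem _)
  simp [scalarCoeff, h]

theorem conv_of_le {m n : ℕ} (h : m ≤ n) {X : T → A} (Y : T → A)
    (hX : ∀ t ∉ S.sub m, X t = 0) : conv S n X Y = conv S m X Y := by
  classical
  funext t
  let g : T → A := fun v => (S.f v (v⁻¹ * t) : E) • (X v * Y (v⁻¹ * t))
  let ι : S.sub m → S.sub n := Subgroup.inclusion (S.monotone_sub h)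
  have hι : Function.Injective ι := Subgroup.inclusion_injective _
  change ∑ v : S.sub n, g v = ∑ v : S.sub m, g v
  symm
  refine Finset.sum_of_injOn ι (fun x _ y _ hxy => hι hxy) (fun _ _ => Finset.mem_univ _) ?_ ?_
  · intro v _ hv
    have hv' : (v : T) ∉ S.sub m := fun hm => hv ⟨⟨v, hm⟩, Finset.mem_coe.2 (Finset.mem_univ _), rfl⟩
    simp [g, hX _ hv']
  · intro v _
    rfl

/-- The canonical inclusion `A_m ⊆ A_n` for `m ≤ n`, `∑ (X_t ⊗ id) V_t ↦ ∑ (X_t ⊗ id) V_t`. -/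
def incl {m n : ℕ} (h : m ≤ n) : projAlg S A m →⋆ₐ[ℂ] projAlg S A n where
  toFun x := projElt S n (coeff S m x)
  map_one' := by
    rw [← map_one (algebraMap ℂ (projAlg S A m)), coeff_algebraMap, projElt_algebraMap, map_one]
  map_mul' x y := by
    rw [coeff_mul, projElt_mul, conv_of_le S h]
    exact fun t ht => coeff_of_notMem S m x ht
  map_zero' := by
    rw [← map_zero (algebraMap ℂ (projAlg S A m)), coeff_algebraMap, projElt_algebraMap, map_zero]
  map_add' x y := by
    rw [coeff_add, projElt_add]
  commutes' c := by
    rw [coeff_algebraMap, projElt_algebraMap]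
  map_star' x := by
    rw [coeff_star, projElt_star]

theorem projOp_map (φ : A →⋆ₐ[E] B) (n : ℕ) (X : T → A) :
    (projOp S n X).map φ = projOp S n (φ ∘ X) := by
  ext s r
  simp [projOp_apply]

theorem comp_conv (φ : A →⋆ₐ[E] B) (n : ℕ) (X Y : T → A) :
    φ ∘ conv S n X Y = conv S n (φ ∘ X) (φ ∘ Y) := by
  funext t
  simp [conv]

theorem comp_convStar (φ : A →⋆ₐ[E] B) (X : T → A) :
    φ ∘ convStar S X = convStar S (φ ∘ X) := by
  funext t
  simp [convStar, map_star]

theorem comp_scalarCoeff (φ : A →⋆ₐ[E] B) (c : ℂ) :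
    φ ∘ scalarCoeff T A c = scalarCoeff T B c := by
  have h : φ (algebraMap ℂ A c) = algebraMap ℂ B c := by
    have hA := FullECStarAlgebra.algebraMap_complex_smul (A := A) c (1 : E)
    have hB := FullECStarAlgebra.algebraMap_complex_smul (A := B) c (1 : E)
    rw [map_one] at hA hB
    rw [Algebra.algebraMap_eq_smul_one, Algebra.algebraMap_eq_smul_one, ← hA, ← hB]
    exact AlgHomClass.commutes φ _
  funext t
  by_cases ht : t = 1
  · simp [scalarCoeff, ht, h]
  · simp [scalarCoeff, ht]

/-- The homomorphism `φ_n : A_n → B_n`, `∑ (X_t ⊗ id) V_t ↦ ∑ (φ X_t ⊗ id) V_t`. -/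
def mapAlg (φ : A →⋆ₐ[E] B) (n : ℕ) : projAlg S A n →⋆ₐ[ℂ] projAlg S B n where
  toFun x := projElt S n (φ ∘ coeff S n x)
  map_one' := by
    rw [← map_one (algebraMap ℂ (projAlg S A n)), coeff_algebraMap, comp_scalarCoeff,
      projElt_algebraMap, map_one]
  map_mul' x y := by
    rw [coeff_mul, comp_conv, projElt_mul]
  map_zero' := by
    rw [← map_zero (algebraMap ℂ (projAlg S A n)), coeff_algebraMap, comp_scalarCoeff,
      projElt_algebraMap, map_zero]
  map_add' x y := by
    rw [coeff_add, ← projElt_add]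
    congr 1
    funext t
    simp
  commutes' c := by
    rw [coeff_algebraMap, comp_scalarCoeff, projElt_algebraMap]
  map_star' x := by
    rw [coeff_star, comp_convStar, projElt_star]

theorem mapAlg_apply (φ : A →⋆ₐ[E] B) (n : ℕ) (x : projAlg S A n) :
    mapAlg S φ n x = projElt S n (φ ∘ coeff S n x) := rfl

theorem coeff_mapAlg (φ : A →⋆ₐ[E] B) (n : ℕ) (x : projAlg S A n) :
    coeff S n (mapAlg S φ n x) = φ ∘ coeff S n x := by
  rw [mapAlg_apply, coeff_projElt_of_support]
  intro t ht
  simp [coeff_of_notMem S n x ht]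

theorem coeff_incl {m n : ℕ} (h : m ≤ n) (x : projAlg S A m) :
    coeff S n (incl S h x) = coeff S m x :=
  coeff_projElt_of_support S n fun _ ht =>
    coeff_of_notMem S m x fun hm => ht (S.monotone_sub h hm)

theorem coeff_injective (n : ℕ) : Function.Injective (coeff S n : projAlg S A n → T → A) :=
  fun x y h => by rw [← projElt_coeff S n x, h, projElt_coeff]

theorem mapAlg_incl (φ : A →⋆ₐ[E] B) {m n : ℕ} (h : m ≤ n) (x : projAlg S A m) :
    mapAlg S φ n (incl S h x) = incl S h (mapAlg S φ m x) := by
  apply coeff_injective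
  rw [coeff_mapAlg, coeff_incl, coeff_incl, coeff_mapAlg]

theorem mapAlg_comp {C : Type*} [CStarAlgebra C] [Algebra E C] [FullECStarAlgebra E C]
    (ψ : B →⋆ₐ[E] C) (φ : A →⋆ₐ[E] B) (n : ℕ) (x : projAlg S A n) :
    mapAlg S ψ n (mapAlg S φ n x) = mapAlg S (ψ.comp φ) n x := by
  apply coeff_injective
  rw [coeff_mapAlg, coeff_mapAlg, coeff_mapAlg]
  rfl

variable (E A) in
/-- The inclusion `E → A`. -/
def baseHom : E →⋆ₐ[E] A where
  toAlgHom := Algebra.ofId E A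
  map_star' := FullECStarAlgebra.algebraMap_star

theorem comp_baseHom (φ : A →⋆ₐ[E] B) : φ.comp (baseHom E A) = baseHom E B :=
  StarAlgHom.ext fun a => AlgHomClass.commutes φ a

theorem mapAlg_val (φ : A →⋆ₐ[E] B) (n : ℕ) (x : projAlg S A n) (s r : S.sub n) :
    (mapAlg S φ n x).1 s r
      = φ (x.1 s r) := by
  have hx : x.1 s r
      = (S.f ((s : T) * (r : T)⁻¹) r : E) • coeff S n x ((s : T) * (r : T)⁻¹) := by
    conv_lhs => rw [← projElt_coeff S n x]
    rfl
  rw [hx, map_smul]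
  rfl

/-- Elements of `E_n` commuting with `E_m` commute with `A_m`. -/
theorem commute_of_base {m n : ℕ} (h : m ≤ n) (c : projAlg S E n)
    (hc : ∀ e : projAlg S E m, c * incl S h e = incl S h e * c) (x : projAlg S A m) :
    mapAlg S (baseHom E A) n c * incl S h x = incl S h x * mapAlg S (baseHom E A) n c := by
  classical
  set c' := mapAlg S (baseHom E A) n c with hc'
  have key : ∀ t : T, c' * projElt S n (Pi.single t 1 : T → A)
      = projElt S n (Pi.single t 1 : T → A) * c' ∨ t ∉ S.sub m := by
    intro t
    by_cases ht : t ∈ S.sub m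
    · left
      have h1 := congrArg (mapAlg S (baseHom E A) n)
        (hc (projElt S m (Pi.single t 1 : T → E)))
      have h2 : mapAlg S (baseHom E A) n (incl S h (projElt S m (Pi.single t 1 : T → E)))
          = projElt S n (Pi.single t 1 : T → A) := by
        have h3 : coeff S m (projElt S m (Pi.single t 1 : T → E)) = Pi.single t 1 := by
          refine coeff_projElt_of_support S m fun u hu => ?_
          have : u ≠ t := fun h => hu (h ▸ ht)
          simp [this]
        rw [mapAlg_apply, coeff_incl, h3]
        congr 1
        funext u
        by_cases hu : u = t
        · subst hu
          simp
        · simp [hu]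
      rwa [map_mul, map_mul, h2] at h1
    · exact Or.inr ht
  have dec : ∀ s r : S.sub n, (incl S h x).1 s r
      = ∑ t : S.sub m, coeff S m x t
          * (projElt S n (Pi.single (t : T) 1 : T → A)).1 s r := by
    intro s r
    change (S.f ((s : T) * (r : T)⁻¹) r : E) • coeff S m x ((s : T) * (r : T)⁻¹)
      = ∑ t : S.sub m, coeff S m x t
        * ((S.f ((s : T) * (r : T)⁻¹) r : E) • (Pi.single (t : T) 1 : T → A) ((s : T) * (r : T)⁻¹))
    by_cases hsr : (s : T) * (r : T)⁻¹ ∈ S.sub m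
    · rw [Finset.sum_eq_single ⟨_, hsr⟩]
      · simp
      · intro t _ ht
        have : (s : T) * (r : T)⁻¹ ≠ t := fun h => ht (Subtype.ext h.symm)
        simp [this]
      · simp
    · rw [coeff_of_notMem S m x hsr, smul_zero]
      refine (Finset.sum_eq_zero fun t _ => ?_).symm
      have : (s : T) * (r : T)⁻¹ ≠ t := fun h => hsr (h ▸ t.2)
      simp [this]
  have cen : ∀ (s r : S.sub n) (a : A), c'.1 s r * a
      = a * c'.1 s r := by
    intro s r a
    rw [hc', mapAlg_val]
    exact Algebra.commutes _ _
  refine Subtype.ext (CStarMatrix.ext fun s r => ?_)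
  change (c'.1
      * (incl S h x).1) s r
    = ((incl S h x).1
      * c'.1) s r
  simp only [CStarMatrix.mul_apply, dec, Finset.mul_sum, Finset.sum_mul]
  rw [Finset.sum_comm]
  conv_rhs => rw [Finset.sum_comm]
  refine Finset.sum_congr rfl fun t _ => ?_
  have h4 := (key t).resolve_right (not_not.2 t.2)
  have h5 := congrFun (congrFun (congrArg Subtype.val h4) s) r
  have h6 : ∑ u, c'.1 s u
        * (projElt S n (Pi.single (t : T) 1 : T → A)).1 u r
      = ∑ u, (projElt S n (Pi.single (t : T) 1 : T → A)).1 s u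
        * c'.1 u r := by
    rw [← CStarMatrix.mul_apply, ← CStarMatrix.mul_apply]
    exact h5
  simp only [← mul_assoc, cen _ _ (coeff S m x t)]
  simp only [mul_assoc, ← Finset.mul_sum]
  rw [h6]

end Projective

/-! ### The inductive limit of the algebras `F_n` -/

/-- The data on which projective K-theory depends: a group `T` with an increasing sequence of finite
subgroups and a Schur `E`-function, and elements `C_{n+1}` of `E_{n+1}`, indexed here by `n`, such
that `A_{n+1} = C_{n+1}^* C_{n+1}` and `B_{n+1} = C_{n+1} C_{n+1}^*` are projections with
`A_{n+1} + B_{n+1} = 1` and `C_{n+1}` commutes with the elements of `E_n`. -/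
structure KSystem (E T : Type*) [CommCStarAlgebra E] [Group T] where
  toSchurSystem : SchurSystem E T
  C : ∀ n, projAlg toSchurSystem E (n + 1)
  isStarProjection_A : ∀ n, IsStarProjection (star (C n) * C n)
  isStarProjection_B : ∀ n, IsStarProjection (C n * star (C n))
  A_add_B : ∀ n, star (C n) * C n + C n * star (C n) = 1
  C_commute : ∀ n (e : projAlg toSchurSystem E n),
    C n * incl toSchurSystem n.le_succ e = incl toSchurSystem n.le_succ e * C n

section Limit

variable {E T : Type*} [CommCStarAlgebra E] [Group T] (K : KSystem E T)
variable {A : Type*} [CStarAlgebra A] [Algebra E A] [FullECStarAlgebra E A]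
variable {B : Type*} [CStarAlgebra B] [Algebra E B] [FullECStarAlgebra E B]

namespace KSystem

variable (A) in
/-- The algebra `A_n`. -/
abbrev Alg (n : ℕ) : Type _ :=
  projAlg K.toSchurSystem A n

/-- The inclusion `A_n ⊆ A_{n+1}`. -/
abbrev up (n : ℕ) : K.Alg A n →⋆ₐ[ℂ] K.Alg A (n + 1) := incl K.toSchurSystem n.le_succ

/-- The homomorphism `φ_n : A_n → B_n`. -/
abbrev mapN (φ : A →⋆ₐ[E] B) (n : ℕ) : K.Alg A n →⋆ₐ[ℂ] K.Alg B n :=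
  mapAlg K.toSchurSystem φ n

variable (A) in
/-- `C_{n+1}` as an element of `A_{n+1}`. -/
def elC (n : ℕ) : K.Alg A (n + 1) := K.mapN (baseHom E A) (n + 1) (K.C n)

variable (A) in
/-- `A_{n+1} = C_{n+1}^* C_{n+1}`. -/
def elA (n : ℕ) : K.Alg A (n + 1) := star (K.elC A n) * K.elC A n

variable (A) in
/-- `B_{n+1} = C_{n+1} C_{n+1}^*`. -/
def elB (n : ℕ) : K.Alg A (n + 1) := K.elC A n * star (K.elC A n)

theorem mapN_elC (φ : A →⋆ₐ[E] B) (n : ℕ) : K.mapN φ (n + 1) (K.elC A n) = K.elC B n := by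
  rw [elC, mapAlg_comp, comp_baseHom]
  rfl

theorem mapN_elA (φ : A →⋆ₐ[E] B) (n : ℕ) : K.mapN φ (n + 1) (K.elA A n) = K.elA B n := by
  rw [elA, map_mul, map_star, mapN_elC]
  rfl

theorem mapN_elB (φ : A →⋆ₐ[E] B) (n : ℕ) : K.mapN φ (n + 1) (K.elB A n) = K.elB B n := by
  rw [elB, map_mul, map_star, mapN_elC]
  rfl

open CStarAlgebra in
theorem eq_zero_of_star_mul_self {n : ℕ} (x : K.Alg E n) (h : star x * x = 0) : x = 0 := by
  let := spectralOrder E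
  let := spectralOrderedRing E
  have h1 : star x.1 * x.1 = 0 := congrArg Subtype.val h
  exact Subtype.ext ((CStarRing.star_mul_self_eq_zero_iff _).1 h1)

variable (A) in
theorem elA_add_elB (n : ℕ) : K.elA A n + K.elB A n = 1 := by
  have h := congrArg (K.mapN (baseHom E A) (n + 1)) (K.A_add_B n)
  simp only [map_add, map_mul, map_star, map_one] at h
  exact h

variable (A) in
theorem elA_mul_self (n : ℕ) : K.elA A n * K.elA A n = K.elA A n := by
  have h := congrArg (K.mapN (baseHom E A) (n + 1)) (K.isStarProjection_A n).isIdempotentElem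
  simp only [map_mul, map_star] at h
  exact h

variable (A) in
theorem star_elA (n : ℕ) : star (K.elA A n) = K.elA A n := by
  simp [elA]

variable (A) in
theorem star_elB (n : ℕ) : star (K.elB A n) = K.elB A n := by
  simp [elB]

variable (A) in
theorem elB_eq (n : ℕ) : K.elB A n = 1 - K.elA A n := eq_sub_of_add_eq' (K.elA_add_elB A n)

variable (A) in
theorem elB_mul_self (n : ℕ) : K.elB A n * K.elB A n = K.elB A n := by
  rw [elB_eq, sub_mul, mul_sub, mul_sub, elA_mul_self]
  simp

variable (A) in
theorem elA_mul_elB (n : ℕ) : K.elA A n * K.elB A n = 0 := by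
  rw [elB_eq, mul_sub, elA_mul_self]
  simp

variable (A) in
theorem elB_mul_elA (n : ℕ) : K.elB A n * K.elA A n = 0 := by
  rw [elB_eq, sub_mul, elA_mul_self]
  simp

variable (A) in
theorem elC_mul_elA (n : ℕ) : K.elC A n * K.elA A n = K.elC A n := by
  have h1 : K.C n * (star (K.C n) * K.C n) = K.C n := by
    refine (sub_eq_zero.1 (K.eq_zero_of_star_mul_self _ ?_)).symm
    have h := (K.isStarProjection_A n).isIdempotentElem.eq
    set c := K.C n
    have h2 : star (c - c * (star c * c)) * (c - c * (star c * c))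
        = star c * c - star c * c * (star c * c) - star c * c * (star c * c)
          + star c * c * (star c * c) * (star c * c) := by
      simp only [star_sub, star_mul, star_star, sub_mul, mul_sub, mul_assoc]
      abel
    rw [h2, h, h]
    simp
  have h := congrArg (K.mapN (baseHom E A) (n + 1)) h1
  simp only [map_mul, map_star] at h
  exact h

variable (A) in
theorem elC_mul_elB (n : ℕ) : K.elC A n * K.elB A n = 0 := by
  rw [← elC_mul_elA, mul_assoc, elA_mul_elB, mul_zero]

variable (A) in
theorem elB_mul_elC (n : ℕ) : K.elB A n * K.elC A n = K.elC A n := by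
  rw [elB, mul_assoc]
  exact K.elC_mul_elA A n

variable (A) in
theorem elA_mul_elC (n : ℕ) : K.elA A n * K.elC A n = 0 := by
  rw [← elB_mul_elC, ← mul_assoc, elA_mul_elB, zero_mul]

variable (A) in
theorem elC_mul_elC (n : ℕ) : K.elC A n * K.elC A n = 0 := by
  nth_rewrite 2 [← elB_mul_elC]
  rw [← mul_assoc, elC_mul_elB, zero_mul]

theorem elC_mul_up (n : ℕ) (x : K.Alg A n) :
    K.elC A n * K.up n x = K.up n x * K.elC A n :=
  commute_of_base K.toSchurSystem n.le_succ (K.C n) (K.C_commute n) x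

theorem star_elC_mul_up (n : ℕ) (x : K.Alg A n) :
    star (K.elC A n) * K.up n x = K.up n x * star (K.elC A n) := by
  have h := congrArg star (K.elC_mul_up n (star x))
  simpa only [star_mul, map_star, star_star] using h.symm

theorem elA_mul_up (n : ℕ) (x : K.Alg A n) :
    K.elA A n * K.up n x = K.up n x * K.elA A n := by
  rw [elA, mul_assoc, elC_mul_up, ← mul_assoc, star_elC_mul_up, mul_assoc]

theorem elB_mul_up (n : ℕ) (x : K.Alg A n) :
    K.elB A n * K.up n x = K.up n x * K.elB A n := by
  rw [elB, mul_assoc, star_elC_mul_up, ← mul_assoc, elC_mul_up, mul_assoc]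

theorem mapN_up (φ : A →⋆ₐ[E] B) (n : ℕ) (x : K.Alg A n) :
    K.mapN φ (n + 1) (K.up n x) = K.up n (K.mapN φ n x) := mapAlg_incl K.toSchurSystem φ _ x

variable (A) in
/-- The homomorphism `A_n → A_{n+1}`, `X ↦ A_{n+1} X`. -/
def rhoBar (n : ℕ) : K.Alg A n →⋆ₙₐ[ℂ] K.Alg A (n + 1) where
  toFun x := K.elA A n * K.up n x
  map_smul' c x := by simp
  map_zero' := by simp
  map_add' x y := by simp [mul_add]
  map_mul' x y := by
    calc K.elA A n * K.up n (x * y)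
        = K.elA A n * K.elA A n * (K.up n x * K.up n y) := by rw [elA_mul_self, map_mul]
      _ = K.elA A n * (K.elA A n * K.up n x) * K.up n y := by simp only [mul_assoc]
      _ = K.elA A n * (K.up n x * K.elA A n) * K.up n y := by rw [elA_mul_up]
      _ = _ := by simp only [mul_assoc]
  map_star' x := by
    rw [star_mul, star_elA, elA_mul_up, map_star]

theorem rhoBar_apply (n : ℕ) (x : K.Alg A n) : K.rhoBar A n x = K.elA A n * K.up n x := rfl

theorem mapN_rhoBar (φ : A →⋆ₐ[E] B) (n : ℕ) (x : K.Alg A n) :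
    K.mapN φ (n + 1) (K.rhoBar A n x) = K.rhoBar B n (K.mapN φ n x) := by
  rw [rhoBar_apply, map_mul, mapN_elA, mapN_up, rhoBar_apply]

variable (A) in
/-- The composition `A_m → A_{m+1} → ⋯ → A_n` of the maps `rhoBar`. -/
def rho (m n : ℕ) (h : m ≤ n) : K.Alg A m →⋆ₙₐ[ℂ] K.Alg A n :=
  Nat.leRecOn h (fun {k} g => (K.rhoBar A k).comp g) (NonUnitalStarAlgHom.id ℂ (K.Alg A m))

theorem rho_self (n : ℕ) (x : K.Alg A n) : K.rho A n n le_rfl x = x := by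
  rw [rho, Nat.leRecOn_self]
  rfl

theorem rho_succ {m n : ℕ} (h : m ≤ n) (h' : m ≤ n + 1) (x : K.Alg A m) :
    K.rho A m (n + 1) h' x = K.rhoBar A n (K.rho A m n h x) := by
  rw [rho, Nat.leRecOn_succ h]
  rfl

instance : DirectedSystem (fun n => K.Alg A n) (K.rho A · · ·) where
  map_self n x := K.rho_self n x
  map_map k j i hij hjk x := by
    induction hjk with
    | refl => exact K.rho_self j (K.rho A i j hij x)
    | step hjk ih =>
      exact (K.rho_succ hjk _ _).trans (ih ▸ (K.rho_succ (hij.trans hjk) _ _).symm)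

theorem mapN_rho (φ : A →⋆ₐ[E] B) {m n : ℕ} (h : m ≤ n) (x : K.Alg A m) :
    K.rho B m n h (K.mapN φ m x) = K.mapN φ n (K.rho A m n h x) := by
  induction h with
  | refl => rw [rho_self, rho_self]
  | @step n h ih =>
    change K.rho B m (n + 1) _ _ = K.mapN φ (n + 1) (K.rho A m (n + 1) _ _)
    rw [K.rho_succ h, K.rho_succ h, ih, mapN_rhoBar]

variable (A) in
/-- The algebraic inductive limit of the sequence `A_0 → A_1 → A_2 → ⋯`. -/
abbrev Lim : Type _ := DirectLimit (fun n => K.Alg A n) (K.rho A)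

instance : StarRing (K.Lim A) where
  star_add := star_add

instance : NonUnitalRing (K.Lim A) := inferInstance
instance : Mul (K.Lim A) := inferInstance
instance : Add (K.Lim A) := inferInstance
instance : Zero (K.Lim A) := inferInstance
instance : Star (K.Lim A) := inferInstance

variable (A) in
/-- The canonical map of `A_n` into the inductive limit. -/
def toLim (n : ℕ) (x : K.Alg A n) : K.Lim A := ⟦⟨n, x⟩⟧

theorem toLim_mul (n : ℕ) (x y : K.Alg A n) :
    K.toLim A n (x * y) = K.toLim A n x * K.toLim A n y := (DirectLimit.mul_def (G := fun n => K.Alg A n) (f := K.rho A) n x y).symm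

theorem toLim_add (n : ℕ) (x y : K.Alg A n) :
    K.toLim A n (x + y) = K.toLim A n x + K.toLim A n y := (DirectLimit.add_def (G := fun n => K.Alg A n) (f := K.rho A) n x y).symm

theorem toLim_star (n : ℕ) (x : K.Alg A n) :
    K.toLim A n (star x) = star (K.toLim A n x) := rfl

theorem toLim_zero (n : ℕ) : K.toLim A n 0 = 0 := (DirectLimit.zero_def (G := fun n => K.Alg A n) (f := K.rho A) n).symm

theorem toLim_rhoBar (n : ℕ) (x : K.Alg A n) :
    K.toLim A (n + 1) (K.rhoBar A n x) = K.toLim A n x := by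
  have h : K.rho A n (n + 1) n.le_succ x = K.rhoBar A n x := by
    rw [K.rho_succ le_rfl, rho_self]
  rw [← h]
  exact DirectLimit.mk_apply (f := K.rho A) n (n + 1) x n.le_succ

/-- The homomorphism of the limits induced by `φ : A → B`. -/
def limMap (φ : A →⋆ₐ[E] B) : K.Lim A →⋆ₙ+* K.Lim B where
  toFun := DirectLimit.map (K.rho A) (K.rho B) (fun n => K.mapN φ n)
    fun _ _ h x => K.mapN_rho φ h x
  map_zero' := by
    rw [← toLim_zero K 0, toLim, DirectLimit.map_def]
    change K.toLim B 0 _ = _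
    rw [map_zero, toLim_zero]
  map_add' := DirectLimit.induction₂ _ fun n x y => by
    change DirectLimit.map _ _ _ _ (K.toLim A n x + K.toLim A n y) = _
    rw [← toLim_add]
    change K.toLim B n _ = K.toLim B n _ + K.toLim B n _
    rw [← toLim_add]
    exact congrArg _ (map_add (K.mapN φ n) x y)
  map_mul' := DirectLimit.induction₂ _ fun n x y => by
    change DirectLimit.map _ _ _ _ (K.toLim A n x * K.toLim A n y) = _
    rw [← toLim_mul]
    change K.toLim B n _ = K.toLim B n _ * K.toLim B n _
    rw [← toLim_mul]
    exact congrArg _ (map_mul (K.mapN φ n) x y)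
  map_star' := DirectLimit.induction _ fun n x => by
    change K.toLim B n _ = star (K.toLim B n _)
    rw [← toLim_star]
    exact congrArg _ (map_star (K.mapN φ n) x)

theorem limMap_toLim (φ : A →⋆ₐ[E] B) (n : ℕ) (x : K.Alg A n) :
    K.limMap φ (K.toLim A n x) = K.toLim B n (K.mapN φ n x) := rfl

end KSystem

end Limit

/-! ### Murray-von Neumann classes of projections -/

section Projections

/-- The projections of a *-ring. -/
def Proj (R : Type*) [Mul R] [Star R] : Type _ := {p : R // IsStarProjection p}

variable {R R' : Type*} [NonUnitalRing R] [StarRing R] [NonUnitalRing R'] [StarRing R']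

/-- `p ∼ q` if `p = x^* x` and `q = x x^*` for some `x`. -/
def MvN (p q : Proj R) : Prop := ∃ x : R, star x * x = p.1 ∧ x * star x = q.1

theorem Proj.mul_self (p : Proj R) : p.1 * p.1 = p.1 := p.2.isIdempotentElem
theorem Proj.star_val (p : Proj R) : star p.1 = p.1 := p.2.isSelfAdjoint

theorem MvN.refl (p : Proj R) : MvN p p :=
  ⟨p.1, by rw [p.star_val, p.mul_self], by rw [p.star_val, p.mul_self]⟩

theorem MvN.symm {p q : Proj R} : MvN p q → MvN q p := fun ⟨x, h1, h2⟩ =>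
  ⟨star x, by rwa [star_star], by rwa [star_star]⟩

theorem MvN.trans {p q r : Proj R} : MvN p q → MvN q r → MvN p r := by
  rintro ⟨x, hx1, hx2⟩ ⟨y, hy1, hy2⟩
  refine ⟨y * x, ?_, ?_⟩
  · calc star (y * x) * (y * x) = star x * (star y * y) * x := by
          simp only [star_mul, mul_assoc]
      _ = (star x * x) * (star x * x) := by rw [hy1, ← hx2]; simp only [mul_assoc]
      _ = p.1 := by rw [hx1, p.mul_self]
  · calc y * x * star (y * x) = y * (x * star x) * star y := by
          simp only [star_mul, mul_assoc]
      _ = (y * star y) * (y * star y) := by rw [hx2, ← hy1]; simp only [mul_assoc]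
      _ = r.1 := by rw [hy2, r.mul_self]

/-- The set of projections with Murray-von Neumann equivalence. -/
instance projSetoid : Setoid (Proj R) := ⟨MvN, MvN.refl, MvN.symm, MvN.trans⟩

variable (R) in
/-- The equivalence classes of projections. -/
def ProjClass : Type _ := Quotient (projSetoid (R := R))

namespace Proj

theorem mul_comm_zero {p q : Proj R} (h : p.1 * q.1 = 0) : q.1 * p.1 = 0 := by
  have h1 := congrArg star h
  rwa [star_mul, p.star_val, q.star_val, star_zero] at h1

/-- The sum of two orthogonal projections. -/
def add (p q : Proj R) (h : p.1 * q.1 = 0) : Proj R :=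
  ⟨p.1 + q.1, by
    change (p.1 + q.1) * (p.1 + q.1) = p.1 + q.1
    rw [add_mul, mul_add, mul_add, h, mul_comm_zero h, p.mul_self, q.mul_self, zero_add,
      add_zero], by
    change star (p.1 + q.1) = p.1 + q.1
    rw [star_add, p.star_val, q.star_val]⟩

theorem exists_partialIsometry {p q : Proj R} (h : MvN p q) :
    ∃ x : R, star x * x = p.1 ∧ x * star x = q.1 ∧ x = q.1 * x ∧ x = x * p.1 := by
  obtain ⟨x, h1, h2⟩ := h
  have h3 : star (q.1 * x) * (q.1 * x) = p.1 := by
    calc star (q.1 * x) * (q.1 * x) = star x * (q.1 * q.1) * x := by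
          rw [star_mul, q.star_val]
          simp only [mul_assoc]
      _ = (star x * x) * (star x * x) := by rw [q.mul_self, ← h2]; simp only [mul_assoc]
      _ = p.1 := by rw [h1, p.mul_self]
  refine ⟨q.1 * x, h3, ?_, ?_, ?_⟩
  · calc q.1 * x * star (q.1 * x) = q.1 * (x * star x) * q.1 := by
          rw [star_mul, q.star_val]
          simp only [mul_assoc]
      _ = q.1 := by rw [h2, q.mul_self, q.mul_self]
  · rw [← mul_assoc, q.mul_self]
  · calc q.1 * x = q.1 * q.1 * x := by rw [q.mul_self]
      _ = q.1 * x * (star x * x) := by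
          nth_rewrite 2 [← h2]
          simp only [mul_assoc]
      _ = q.1 * x * p.1 := by rw [h1]

theorem add_congr {p q p' q' : Proj R} (h : p.1 * q.1 = 0) (h' : p'.1 * q'.1 = 0)
    (hp : MvN p p') (hq : MvN q q') : MvN (p.add q h) (p'.add q' h') := by
  obtain ⟨x, hx1, hx2, hx3, hx4⟩ := exists_partialIsometry hp
  obtain ⟨y, hy1, hy2, hy3, hy4⟩ := exists_partialIsometry hq
  have e1 : star x * y = 0 := by
    rw [hx3, hy3, star_mul, p'.star_val, mul_assoc, ← mul_assoc p'.1, h', zero_mul, mul_zero]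
  have e2 : star y * x = 0 := by simpa using congrArg star e1
  have e3 : x * star y = 0 := by
    rw [hx4, hy4, star_mul, q.star_val, mul_assoc, ← mul_assoc p.1, h, zero_mul, mul_zero]
  have e4 : y * star x = 0 := by simpa using congrArg star e3
  refine ⟨x + y, ?_, ?_⟩
  · rw [star_add, add_mul, mul_add, mul_add, e1, e2, hx1, hy1, zero_add, add_zero]
    rfl
  · rw [star_add, add_mul, mul_add, mul_add, e3, e4, hx2, hy2, zero_add, add_zero]
    rfl

/-- The image of a projection. -/
def map (φ : R →⋆ₙ+* R') (p : Proj R) : Proj R' :=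
  ⟨φ p.1, by
    change φ p.1 * φ p.1 = φ p.1
    rw [← map_mul, p.mul_self], by
    change star (φ p.1) = φ p.1
    rw [← map_star, p.star_val]⟩

end Proj

/-- Every projection is equivalent to one orthogonal to a given one. -/
class HasOrthogonalCopies (R : Type*) [NonUnitalRing R] [StarRing R] : Prop where
  exists_copy : ∀ p q : Proj R, ∃ q' : Proj R, MvN q q' ∧ p.1 * q'.1 = 0

variable [HasOrthogonalCopies R] [HasOrthogonalCopies R']

namespace ProjClass

/-- The class of a projection. -/
def mk (p : Proj R) : ProjClass R := Quotient.mk _ p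

theorem sound {p q : Proj R} (h : MvN p q) : mk p = mk q := Quotient.sound h

/-- The sum of the class of `p` and of the class of `q` is the class of `p + q'`, where `q'` is
equivalent to `q` and orthogonal to `p`. -/
instance : Add (ProjClass R) where
  add := Quotient.lift₂
    (fun p q => mk (p.add _ (HasOrthogonalCopies.exists_copy p q).choose_spec.2))
    (fun p q p' q' hp hq => sound (Proj.add_congr _ _ hp
      (((HasOrthogonalCopies.exists_copy p q).choose_spec.1.symm.trans hq).trans
        (HasOrthogonalCopies.exists_copy p' q').choose_spec.1)))

/-- The sum of the classes of two orthogonal projections is the class of their sum. -/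
theorem mk_add (p q : Proj R) (h : p.1 * q.1 = 0) : mk p + mk q = mk (p.add q h) :=
  sound (Proj.add_congr _ _ (MvN.refl p)
    (HasOrthogonalCopies.exists_copy p q).choose_spec.1.symm)

theorem exists_orthogonal (a b : ProjClass R) :
    ∃ p q : Proj R, a = mk p ∧ b = mk q ∧ p.1 * q.1 = 0 := by
  induction a using Quotient.inductionOn with | _ p
  induction b using Quotient.inductionOn with | _ q
  obtain ⟨q', h1, h2⟩ := HasOrthogonalCopies.exists_copy p q
  exact ⟨p, q', rfl, sound h1, h2⟩

instance : Zero (ProjClass R) := ⟨mk ⟨0, IsStarProjection.zero R⟩⟩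

theorem add_comm' (a b : ProjClass R) : a + b = b + a := by
  obtain ⟨p, q, rfl, rfl, h⟩ := exists_orthogonal a b
  rw [mk_add p q h, mk_add q p (Proj.mul_comm_zero h)]
  exact congrArg mk (Subtype.ext (add_comm _ _))

theorem add_zero' (a : ProjClass R) : a + 0 = a := by
  induction a using Quotient.inductionOn with | _ p
  refine (mk_add p ⟨0, IsStarProjection.zero R⟩ (mul_zero _)).trans ?_
  exact congrArg mk (Subtype.ext (add_zero _))

theorem add_assoc' (a b c : ProjClass R) : a + b + c = a + (b + c) := by
  obtain ⟨p, q, rfl, rfl, h⟩ := exists_orthogonal a b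
  rw [mk_add p q h]
  induction c using Quotient.inductionOn with | _ r
  obtain ⟨r', h1, h2⟩ := HasOrthogonalCopies.exists_copy (p.add q h) r
  have hr : (Quotient.mk _ r : ProjClass R) = mk r' := sound h1
  have h3 : (p.1 + q.1) * r'.1 = 0 := h2
  have hp : p.1 * r'.1 = 0 := by
    have h4 := congrArg (p.1 * ·) h3
    simpa only [← mul_assoc, mul_add, p.mul_self, h, add_zero, mul_zero] using h4
  have hq : q.1 * r'.1 = 0 := by
    rwa [add_mul, hp, zero_add] at h3
  have hpq : p.1 * (q.add r' hq).1 = 0 := by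
    change p.1 * (q.1 + r'.1) = 0
    rw [mul_add, h, hp, add_zero]
  rw [hr, mk_add _ _ h2, mk_add q r' hq, mk_add p _ hpq]
  exact congrArg mk (Subtype.ext (add_assoc _ _ _))

instance : AddCommMonoid (ProjClass R) where
  add_assoc := add_assoc'
  zero_add a := (add_comm' 0 a).trans (add_zero' a)
  add_zero := add_zero'
  add_comm := add_comm'
  nsmul := nsmulRec

/-- The map of classes induced by a *-homomorphism. -/
def map (φ : R →⋆ₙ+* R') : ProjClass R →+ ProjClass R' where
  toFun := Quotient.lift (fun p => mk (p.map φ)) fun p q ⟨x, h1, h2⟩ => sound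
    ⟨φ x, (by rw [← map_star, ← map_mul, h1]; rfl), (by rw [← map_star, ← map_mul, h2]; rfl)⟩
  map_zero' := congrArg mk (Subtype.ext (map_zero φ))
  map_add' a b := by
    obtain ⟨p, q, rfl, rfl, h⟩ := exists_orthogonal a b
    have h' : (p.map φ).1 * (q.map φ).1 = 0 := by
      change φ p.1 * φ q.1 = 0
      rw [← map_mul, h, map_zero]
    rw [mk_add p q h]
    refine Eq.trans ?_ (mk_add (p.map φ) (q.map φ) h').symm
    exact congrArg mk (Subtype.ext (map_add φ _ _))

theorem map_mk (φ : R →⋆ₙ+* R') (p : Proj R) : map φ (mk p) = mk (p.map φ) := rfl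

end ProjClass

end Projections

/-! ### `K_0` -/

section KZero

variable {E T : Type*} [CommCStarAlgebra E] [Group T] (K : KSystem E T)
variable {A : Type*} [CStarAlgebra A] [Algebra E A] [FullECStarAlgebra E A]
variable {B : Type*} [CStarAlgebra B] [Algebra E B] [FullECStarAlgebra E B]

namespace KSystem

/-- A projection of `A_n`, seen in the inductive limit. -/
def toLimProj (n : ℕ) (p : Proj (K.Alg A n)) : Proj (K.Lim A) :=
  ⟨K.toLim A n p.1, by
    change K.toLim A n p.1 * K.toLim A n p.1 = K.toLim A n p.1
    rw [← toLim_mul, p.mul_self], by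
    change star (K.toLim A n p.1) = K.toLim A n p.1
    rw [← toLim_star, p.star_val]⟩

theorem toLim_rho {m n : ℕ} (h : m ≤ n) (x : K.Alg A m) :
    K.toLim A n (K.rho A m n h x) = K.toLim A m x :=
  DirectLimit.mk_apply (F := fun n => K.Alg A n) (f := K.rho A) m n x h

theorem exists_rho_eq {n : ℕ} {x y : K.Alg A n} (h : K.toLim A n x = K.toLim A n y) :
    ∃ (m : ℕ) (hm : n ≤ m), K.rho A n m hm x = K.rho A n m hm y := by
  obtain ⟨m, h1, _, h3⟩ := Quotient.exact h
  exact ⟨m, h1, h3⟩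

theorem exists_toLimProj (P : Proj (K.Lim A)) :
    ∃ n, ∀ m, n ≤ m → ∃ p : Proj (K.Alg A m), K.toLimProj m p = P := by
  obtain ⟨P, hP1, hP2⟩ := P
  obtain ⟨n, x, rfl⟩ := DirectLimit.exists_eq_mk _ P
  have h1 : K.toLim A n (x * x) = K.toLim A n x := (toLim_mul K n x x).trans hP1
  have h2 : K.toLim A n (star x) = K.toLim A n x := hP2
  obtain ⟨k, hk, hk'⟩ := K.exists_rho_eq h1
  obtain ⟨l, hl, hl'⟩ := K.exists_rho_eq h2
  refine ⟨max k l, fun m hm => ?_⟩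
  have hkm : k ≤ m := (le_max_left _ _).trans hm
  have hlm : l ≤ m := (le_max_right _ _).trans hm
  have e (i : ℕ) (hi : n ≤ i) (him : i ≤ m) (z : K.Alg A n) :
      K.rho A i m him (K.rho A n i hi z) = K.rho A n m (hi.trans him) z :=
    DirectedSystem.map_map' (F := fun n => K.Alg A n) (K.rho A) hi him z
  refine ⟨⟨K.rho A n m (hk.trans hkm) x, ?_, ?_⟩, Subtype.ext (K.toLim_rho _ x)⟩
  · change K.rho A n m _ x * K.rho A n m _ x = K.rho A n m _ x
    rw [← map_mul, ← e k hk hkm, hk', e]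
  · change star (K.rho A n m _ x) = K.rho A n m _ x
    rw [← map_star, ← e l hl hlm, hl', e]

instance : HasOrthogonalCopies (K.Lim A) where
  exists_copy P Q := by
    obtain ⟨k, hk⟩ := K.exists_toLimProj P
    obtain ⟨l, hl⟩ := K.exists_toLimProj Q
    obtain ⟨n, hkn, hln⟩ : ∃ n, k ≤ n ∧ l ≤ n := ⟨_, le_max_left k l, le_max_right k l⟩
    obtain ⟨p, rfl⟩ := hk n hkn
    obtain ⟨q, rfl⟩ := hl n hln
    clear hk hl
    set c := K.elC A n * K.up n q.1 with hc
    have e1 : star c * c = K.rhoBar A n q.1 := by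
      rw [hc, star_mul, mul_assoc, ← mul_assoc (star (K.elC A n)), ← map_star, q.star_val]
      change K.up n q.1 * (K.elA A n * K.up n q.1) = _
      rw [elA_mul_up, ← mul_assoc, ← map_mul, ← elA_mul_up, rhoBar_apply, q.mul_self]
    have e2 : c * (star c * c) = c := by
      rw [e1, rhoBar_apply, elA_mul_up, hc, mul_assoc, ← mul_assoc (K.up n q.1), ← map_mul,
        q.mul_self, ← elA_mul_up, ← mul_assoc, elC_mul_elA]
    have e3 : IsStarProjection (c * star c) := by
      refine ⟨?_, by simp [IsSelfAdjoint]⟩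
      change c * star c * (c * star c) = c * star c
      calc c * star c * (c * star c) = c * (star c * c) * star c := by simp only [mul_assoc]
        _ = c * star c := by rw [e2]
    refine ⟨K.toLimProj (n + 1) ⟨c * star c, e3⟩, ⟨K.toLim A (n + 1) c, ?_, ?_⟩, ?_⟩
    · rw [← toLim_star, ← toLim_mul, e1, toLim_rhoBar]
      rfl
    · rw [← toLim_star, ← toLim_mul]
      rfl
    · change K.toLim A n p.1 * K.toLim A (n + 1) (c * star c) = 0
      rw [← toLim_rhoBar, rhoBar_apply, ← toLim_mul, hc, elA_mul_up, mul_assoc,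
        ← mul_assoc (K.elA A n), ← mul_assoc (K.elA A n), elA_mul_elC, zero_mul, zero_mul,
        mul_zero, toLim_zero]

variable (A) in
/-- `K_0` of a full `E`-C*-algebra: the Grothendieck group of the monoid of classes of
projections of the inductive limit. -/
def K0Full : Type _ := Algebra.GrothendieckAddGroup (ProjClass (K.Lim A))

instance : AddCommGroup (K.K0Full A) :=
  inferInstanceAs (AddCommGroup (Algebra.GrothendieckAddGroup (ProjClass (K.Lim A))))

variable (A) in
/-- The canonical homomorphism of the monoid of classes of projections into `K_0`. -/
def toK0 : ProjClass (K.Lim A) →+ K.K0Full A := Algebra.GrothendieckAddGroup.of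

/-- The class in `K_0` of a projection of `A_n`. -/
def cls (n : ℕ) (p : Proj (K.Alg A n)) : K.K0Full A :=
  K.toK0 A (ProjClass.mk (K.toLimProj n p))

/-- The homomorphism `K_0(φ)` for unital `φ`. -/
def K0Map (φ : A →⋆ₐ[E] B) : K.K0Full A →+ K.K0Full B :=
  Algebra.GrothendieckAddGroup.lift ((K.toK0 B).comp (ProjClass.map (K.limMap φ)))

/-- The projection `φ_n(p)`. -/
def mapProj (φ : A →⋆ₐ[E] B) (n : ℕ) (p : Proj (K.Alg A n)) : Proj (K.Alg B n) :=
  p.map (K.mapN φ n : K.Alg A n →⋆ₙ+* K.Alg B n)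

theorem K0Map_cls (φ : A →⋆ₐ[E] B) (n : ℕ) (p : Proj (K.Alg A n)) :
    K.K0Map φ (K.cls n p) = K.cls n (K.mapProj φ n p) := by
  exact DFunLike.congr_fun (Algebra.GrothendieckAddGroup.lift.symm_apply_apply
    ((K.toK0 B).comp (ProjClass.map (K.limMap φ)))) _

variable (F : Type*) [NonUnitalCStarAlgebra F] [ECStarAlgebra E F]

/-- `K_0` of an `E`-C*-algebra `F`: the kernel of the map `K_0(E × F) → K_0(E)` induced by
`(a, x) ↦ a`. -/
def K0 : AddSubgroup (K.K0Full (EUnit E F)) := (K.K0Map (EUnit.proj E F)).ker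

end KSystem

end KZero

/-! ### `K_1` -/

section KOne

variable {E T : Type*} [CommCStarAlgebra E] [Group T] (K : KSystem E T)
variable {A : Type*} [CStarAlgebra A] [Algebra E A] [FullECStarAlgebra E A]
variable {B : Type*} [CStarAlgebra B] [Algebra E B] [FullECStarAlgebra E B]

theorem continuous_entry {m : Type*} (s r : m) :
    Continuous fun x : CStarMatrix m m A => x s r :=
  continuous_apply_apply (ρ := fun _ _ => A) s r

instance {m : Type*} [Fintype m] : ContinuousMul (CStarMatrix m m A) where
  continuous_mul := by
    refine continuous_pi fun s => continuous_pi fun r => ?_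
    change Continuous fun x : CStarMatrix m m A × CStarMatrix m m A => (x.1 * x.2) s r
    simp only [CStarMatrix.mul_apply]
    refine continuous_finsetSum _ fun u _ => Continuous.mul ?_ ?_
    · exact (continuous_entry s u).comp continuous_fst
    · exact (continuous_entry u r).comp continuous_snd

instance {m : Type*} : ContinuousAdd (CStarMatrix m m A) where
  continuous_add := by
    refine continuous_pi fun s => continuous_pi fun r => Continuous.add ?_ ?_
    · exact (continuous_entry s r).comp continuous_fst
    · exact (continuous_entry s r).comp continuous_snd

instance {m : Type*} [Fintype m] : ContinuousStar (CStarMatrix m m A) where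
  continuous_star := by
    refine continuous_pi fun s => continuous_pi fun r => ?_
    exact (continuous_entry r s).star

namespace KSystem

open scoped commutatorElement

theorem continuous_val (n : ℕ) : Continuous fun x : K.Alg A n => x.1 :=
  continuous_subtype_val

instance (n : ℕ) : ContinuousMul (K.Alg A n) where
  continuous_mul := Continuous.subtype_mk (((K.continuous_val n).comp continuous_fst).mul
    ((K.continuous_val n).comp continuous_snd)) _

instance (n : ℕ) : ContinuousAdd (K.Alg A n) where
  continuous_add := Continuous.subtype_mk (((K.continuous_val n).comp continuous_fst).add
    ((K.continuous_val n).comp continuous_snd)) _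

instance (n : ℕ) : ContinuousStar (K.Alg A n) where
  continuous_star := Continuous.subtype_mk (K.continuous_val n).star _

instance (n : ℕ) : ContinuousSMul ℂ (K.Alg A n) where
  continuous_smul := Continuous.subtype_mk
    (continuous_fst.smul ((K.continuous_val n).comp continuous_snd)) _

theorem continuous_up (n : ℕ) : Continuous (K.up n : K.Alg A n → K.Alg A (n + 1)) := by
  refine Continuous.subtype_mk (continuous_pi fun s => continuous_pi fun r => ?_) _
  refine Continuous.const_smul ?_ _
  change Continuous fun x : K.Alg A n =>
    coeff K.toSchurSystem n x ((s : T) * (r : T)⁻¹)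
  unfold coeff
  split_ifs
  · exact (continuous_entry _ _).comp (K.continuous_val n)
  · exact continuous_const

variable (A) in
/-- The unitary group of `A_n`. -/
def Un (n : ℕ) : Type _ := unitary (K.Alg A n)

instance (n : ℕ) : Group (K.Un A n) := inferInstanceAs (Group (unitary (K.Alg A n)))
instance (n : ℕ) : TopologicalSpace (K.Un A n) :=
  inferInstanceAs (TopologicalSpace (unitary (K.Alg A n)))
instance (n : ℕ) : IsTopologicalGroup (K.Un A n) :=
  inferInstanceAs (IsTopologicalGroup (unitary (K.Alg A n)))

theorem continuous_unVal (n : ℕ) : Continuous fun U : K.Un A n => U.1 :=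
  continuous_subtype_val

/-- The homomorphism of unitary groups induced by `φ : A → B`. -/
def mapUn (φ : A →⋆ₐ[E] B) (n : ℕ) : K.Un A n →* K.Un B n where
  toFun U := ⟨K.mapN φ n U.1, Unitary.map_mem (K.mapN φ n) U.2⟩
  map_one' := Subtype.ext (map_one (K.mapN φ n))
  map_mul' U V := Subtype.ext (map_mul (K.mapN φ n) U.1 V.1)

theorem tauBar_mul (n : ℕ) (x y : K.Alg A n) :
    (K.elA A n * K.up n x + K.elB A n) * (K.elA A n * K.up n y + K.elB A n)
      = K.elA A n * K.up n (x * y) + K.elB A n := by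
  have h1 : K.elA A n * K.up n x * (K.elA A n * K.up n y) = K.elA A n * K.up n (x * y) :=
    (map_mul (K.rhoBar A n) x y).symm
  have h2 : K.elA A n * K.up n x * K.elB A n = 0 := by
    rw [mul_assoc, ← elB_mul_up, ← mul_assoc, elA_mul_elB, zero_mul]
  have h3 : K.elB A n * (K.elA A n * K.up n y) = 0 := by
    rw [← mul_assoc, elB_mul_elA, zero_mul]
  rw [add_mul, mul_add, mul_add, h1, h2, h3, elB_mul_self, add_zero, zero_add]

theorem tauBar_star (n : ℕ) (x : K.Alg A n) :
    star (K.elA A n * K.up n x + K.elB A n) = K.elA A n * K.up n (star x) + K.elB A n := by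
  rw [star_add, star_elB]
  exact congrArg (· + K.elB A n) (map_star (K.rhoBar A n) x).symm

theorem tauBar_one (n : ℕ) : K.elA A n * K.up n 1 + K.elB A n = 1 := by
  rw [map_one, mul_one, elA_add_elB]

variable (A) in
/-- The homomorphism `Un A_n → Un A_{n+1}`, `U ↦ A_{n+1} U + B_{n+1}`. -/
def tauBar (n : ℕ) : K.Un A n →* K.Un A (n + 1) where
  toFun U := ⟨K.elA A n * K.up n U.1 + K.elB A n, Unitary.mem_iff.2
    ⟨by rw [tauBar_star, tauBar_mul, Unitary.star_mul_self_of_mem U.2, tauBar_one],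
      by rw [tauBar_star, tauBar_mul, Unitary.mul_star_self_of_mem U.2, tauBar_one]⟩⟩
  map_one' := Subtype.ext (K.tauBar_one n)
  map_mul' U V := Subtype.ext (K.tauBar_mul n U.1 V.1).symm

theorem tauBar_val (n : ℕ) (U : K.Un A n) :
    (K.tauBar A n U).1 = K.elA A n * K.up n U.1 + K.elB A n := rfl

theorem continuous_tauBar (n : ℕ) : Continuous (K.tauBar A n) :=
  Continuous.subtype_mk ((continuous_const.mul
    ((K.continuous_up n).comp (K.continuous_unVal n))).add continuous_const) _

theorem mapUn_tauBar (φ : A →⋆ₐ[E] B) (n : ℕ) (U : K.Un A n) :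
    K.mapUn φ (n + 1) (K.tauBar A n U) = K.tauBar B n (K.mapUn φ n U) := by
  refine Subtype.ext ?_
  change K.mapN φ (n + 1) (K.elA A n * K.up n U.1 + K.elB A n)
    = K.elA B n * K.up n (K.mapN φ n U.1) + K.elB B n
  rw [map_add, map_mul, mapN_elA, mapN_elB, mapN_up]

variable (A) in
/-- The composition `Un A_m → Un A_{m+1} → ⋯ → Un A_n` of the maps `tauBar`. -/
def tau (m n : ℕ) (h : m ≤ n) : K.Un A m →* K.Un A n :=
  Nat.leRecOn h (fun {k} g => (K.tauBar A k).comp g) (MonoidHom.id (K.Un A m))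

theorem tau_self (n : ℕ) (U : K.Un A n) : K.tau A n n le_rfl U = U := by
  rw [tau, Nat.leRecOn_self]
  rfl

theorem tau_succ {m n : ℕ} (h : m ≤ n) (h' : m ≤ n + 1) (U : K.Un A m) :
    K.tau A m (n + 1) h' U = K.tauBar A n (K.tau A m n h U) := by
  rw [tau, Nat.leRecOn_succ h]
  rfl

instance : DirectedSystem (fun n => K.Un A n) (K.tau A · · ·) where
  map_self n U := K.tau_self n U
  map_map k j i hij hjk U := by
    induction hjk with
    | refl => exact K.tau_self j (K.tau A i j hij U)
    | step hjk ih => exact (K.tau_succ hjk _ _).trans (ih ▸ (K.tau_succ (hij.trans hjk) _ _).symm)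

variable (A) in
/-- The group `un A`: the algebraic inductive limit of the groups `Un A_n`. -/
abbrev UnLim : Type _ := DirectLimit (fun n => K.Un A n) (K.tau A)

instance : Group (K.UnLim A) := inferInstance
instance : Inv (K.UnLim A) := (inferInstance : Group (K.UnLim A)).toInv
instance : Mul (K.UnLim A) := (inferInstance : Group (K.UnLim A)).toMul
instance : MulOneClass (K.UnLim A) := (inferInstance : Group (K.UnLim A)).toMulOneClass
instance : DivisionMonoid (K.UnLim A) := (inferInstance : Group (K.UnLim A)).toDivisionMonoid

variable (A) in
/-- The canonical homomorphism `Un A_n → un A`. -/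
def toUn (n : ℕ) : K.Un A n →* K.UnLim A where
  toFun U := ⟦⟨n, U⟩⟧
  map_one' := (DirectLimit.one_def (G := fun n => K.Un A n) (f := K.tau A) n).symm
  map_mul' U V := (DirectLimit.mul_def (G := fun n => K.Un A n) (f := K.tau A) n U V).symm

theorem toUn_tau {m n : ℕ} (h : m ≤ n) (U : K.Un A m) :
    K.toUn A n (K.tau A m n h U) = K.toUn A m U :=
  DirectLimit.mk_apply (F := fun n => K.Un A n) (f := K.tau A) m n U h

variable (A) in
/-- The unitaries of `A_n` that are homotopic in `Un A_n` to a unitary of `E_n`. -/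
def unhN (n : ℕ) : Subgroup (K.Un A n) where
  carrier := {U | ∃ W : K.Un E n, Joined U (K.mapUn (baseHom E A) n W)}
  mul_mem' := by
    rintro U V ⟨W, hW⟩ ⟨W', hW'⟩
    exact ⟨W * W', by rw [map_mul]; exact hW.mul hW'⟩
  one_mem' := ⟨1, by rw [map_one]⟩
  inv_mem' := by
    rintro U ⟨W, hW⟩
    exact ⟨W⁻¹, by rw [map_inv]; exact hW.inv⟩

theorem tau_mem_unhN {m n : ℕ} (h : m ≤ n) {U : K.Un A m} (hU : U ∈ K.unhN A m) :
    K.tau A m n h U ∈ K.unhN A n := by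
  induction h with
  | refl => rw [tau_self]; exact hU
  | @step n h ih =>
    change K.tau A m (n + 1) _ U ∈ K.unhN A (n + 1)
    rw [tau_succ K h]
    obtain ⟨W, hW⟩ := ih
    exact ⟨K.tauBar E n W, by rw [mapUn_tauBar]; exact hW.map (K.continuous_tauBar n)⟩

variable (A) in
/-- The subgroup `un_h A` of `un A`: the union of the images of the groups `unhN`. -/
def unh : Subgroup (K.UnLim A) where
  carrier := {u | ∃ n, ∃ U ∈ K.unhN A n, K.toUn A n U = u}
  mul_mem' := by
    rintro _ _ ⟨m, U, hU, rfl⟩ ⟨n, V, hV, rfl⟩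
    refine ⟨max m n, _, mul_mem (K.tau_mem_unhN (le_max_left m n) hU)
      (K.tau_mem_unhN (le_max_right m n) hV), ?_⟩
    rw [map_mul, toUn_tau, toUn_tau]
  one_mem' := ⟨0, 1, one_mem _, map_one _⟩
  inv_mem' := by
    rintro _ ⟨n, U, hU, rfl⟩
    exact ⟨n, U⁻¹, inv_mem hU, map_inv _ _⟩

variable (A) in
/-- The self-adjoint unitary `C + C^*`. -/
def elS (n : ℕ) : K.Alg A (n + 1) := K.elC A n + star (K.elC A n)

theorem elS_mul_self (n : ℕ) : K.elS A n * K.elS A n = 1 := by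
  have h1 : star (K.elC A n) * star (K.elC A n) = 0 := by
    simpa using congrArg star (K.elC_mul_elC A n)
  rw [elS, add_mul, mul_add, mul_add, elC_mul_elC, h1, zero_add, add_zero]
  exact (add_comm _ _).trans (K.elA_add_elB A n)

theorem star_elS (n : ℕ) : star (K.elS A n) = K.elS A n := by
  simp [elS, add_comm]

theorem elS_conj (n : ℕ) (y : K.Alg A n) :
    K.elS A n * (K.elA A n * K.up n y + K.elB A n)
      = (K.elA A n + K.elB A n * K.up n y) * K.elS A n := by
  have h1 : star (K.elC A n) * K.elA A n = 0 := by
    simpa [star_elA] using congrArg star (K.elA_mul_elC A n)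
  have h2 : star (K.elC A n) * K.elB A n = star (K.elC A n) := by
    simpa [star_elB] using congrArg star (K.elB_mul_elC A n)
  have h3 : K.elA A n * star (K.elC A n) = star (K.elC A n) := by
    simpa [star_elA] using congrArg star (K.elC_mul_elA A n)
  have h4 : K.elB A n * star (K.elC A n) = 0 := by
    simpa [star_elB] using congrArg star (K.elC_mul_elB A n)
  have e1 : K.elC A n * (K.elA A n * K.up n y) = K.elC A n * K.up n y := by
    rw [← mul_assoc, elC_mul_elA]
  have e2 : star (K.elC A n) * (K.elA A n * K.up n y) = 0 := by
    rw [← mul_assoc, h1, zero_mul]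
  have e3 : K.elB A n * K.up n y * K.elC A n = K.elC A n * K.up n y := by
    rw [mul_assoc, ← elC_mul_up, ← mul_assoc, elB_mul_elC]
  have e4 : K.elB A n * K.up n y * star (K.elC A n) = 0 := by
    rw [mul_assoc, ← star_elC_mul_up, ← mul_assoc, h4, zero_mul]
  rw [elS, add_mul, mul_add, mul_add, e1, e2, elC_mul_elB, h2, add_mul, mul_add, mul_add,
    elA_mul_elC, h3, e3, e4]
  abel

variable (A) in
/-- The path `cos (π t / 2) + i sin (π t / 2) (C + C^*)` of unitaries. -/
def rot (n : ℕ) (t : I) : K.Un A (n + 1) :=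
  ⟨((Real.cos (Real.pi / 2 * t) : ℝ) : ℂ) • (1 : K.Alg A (n + 1))
      + (Complex.I * ((Real.sin (Real.pi / 2 * t) : ℝ) : ℂ)) • K.elS A n, by
    have h : ((Real.cos (Real.pi / 2 * t) : ℝ) : ℂ) * ((Real.cos (Real.pi / 2 * t) : ℝ) : ℂ)
        + ((Real.sin (Real.pi / 2 * t) : ℝ) : ℂ) * ((Real.sin (Real.pi / 2 * t) : ℝ) : ℂ)
        = 1 := by
      have := Real.cos_sq_add_sin_sq (Real.pi / 2 * t)
      rw [sq, sq] at this
      exact_mod_cast this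
    generalize ((Real.cos (Real.pi / 2 * t) : ℝ)) = c at h ⊢
    generalize ((Real.sin (Real.pi / 2 * t) : ℝ)) = s at h ⊢
    have h1 : star ((c : ℂ) • (1 : K.Alg A (n + 1)) + (Complex.I * (s : ℂ)) • K.elS A n)
        = (c : ℂ) • (1 : K.Alg A (n + 1)) + (-(Complex.I * (s : ℂ))) • K.elS A n := by
      rw [star_add, star_smul, star_smul, star_one, star_elS]
      simp
    have h2 : (c : ℂ) * c + (-(Complex.I * s)) * (Complex.I * s) = 1 := by
      rw [← h]
      linear_combination (-(s : ℂ) * s) * Complex.I_mul_I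
    have h3 : (c : ℂ) * (Complex.I * s) + (-(Complex.I * s)) * c = 0 := by ring
    refine Unitary.mem_iff.2 ⟨?_, ?_⟩
    · rw [h1, add_mul, mul_add, mul_add, smul_mul_smul_comm, smul_mul_smul_comm,
        smul_mul_smul_comm, smul_mul_smul_comm, elS_mul_self, one_mul, mul_one, one_mul]
      calc _ = ((c : ℂ) * c + (-(Complex.I * s)) * (Complex.I * s)) • (1 : K.Alg A (n + 1))
            + ((c : ℂ) * (Complex.I * s) + (-(Complex.I * s)) * c) • K.elS A n := by
            rw [add_smul, add_smul]
            abel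
        _ = 1 := by rw [h2, h3, one_smul, zero_smul, add_zero]
    · rw [h1, add_mul, mul_add, mul_add, smul_mul_smul_comm, smul_mul_smul_comm,
        smul_mul_smul_comm, smul_mul_smul_comm, elS_mul_self, one_mul, mul_one, one_mul]
      calc _ = ((c : ℂ) * c + (-(Complex.I * s)) * (Complex.I * s)) • (1 : K.Alg A (n + 1))
            + ((c : ℂ) * (Complex.I * s) + (-(Complex.I * s)) * c) • K.elS A n := by
            rw [add_smul, add_smul]
            simp only [mul_neg, neg_smul, mul_comm]
            abel
        _ = 1 := by rw [h2, h3, one_smul, zero_smul, add_zero]⟩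

theorem continuous_rot (n : ℕ) : Continuous (K.rot A n) := by
  have h1 : Continuous fun t : I => ((Real.cos (Real.pi / 2 * t) : ℝ) : ℂ) := by fun_prop
  have h2 : Continuous fun t : I =>
      Complex.I * ((Real.sin (Real.pi / 2 * t) : ℝ) : ℂ) := by fun_prop
  exact Continuous.subtype_mk ((h1.smul continuous_const).add (h2.smul continuous_const)) _

theorem rot_zero (n : ℕ) : K.rot A n 0 = 1 := by
  refine Subtype.ext ?_
  change _ = (1 : K.Alg A (n + 1))
  simp [rot]

theorem rot_one_val (n : ℕ) : (K.rot A n 1).1 = Complex.I • K.elS A n := by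
  simp [rot]

/-- After passing to the next level, commutators of unitaries are homotopic to `1`. -/
theorem commutator_mem_unhN (n : ℕ) (U V : K.Un A n) :
    ⁅K.tauBar A n U, K.tauBar A n V⁆ ∈ K.unhN A (n + 1) := by
  refine ⟨1, ?_⟩
  rw [map_one]
  let γ : I → K.Un A (n + 1) := fun t =>
    ⁅K.tauBar A n U, K.rot A n t * K.tauBar A n V * (K.rot A n t)⁻¹⁆
  have hγ : Continuous γ := by
    have h1 : Continuous fun t => K.rot A n t * K.tauBar A n V * (K.rot A n t)⁻¹ :=
      ((K.continuous_rot n).mul continuous_const).mul (K.continuous_rot n).inv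
    exact ((continuous_const.mul h1).mul continuous_const).mul h1.inv
  have h0 : γ 0 = ⁅K.tauBar A n U, K.tauBar A n V⁆ := by
    simp only [γ, rot_zero, one_mul, inv_one, mul_one]
  have h1 : γ 1 = 1 := by
    have e1 : (K.rot A n 1).1 * (K.tauBar A n V).1
        = (K.elA A n + K.elB A n * K.up n V.1) * (K.rot A n 1).1 := by
      rw [rot_one_val, tauBar_val, smul_mul_assoc, elS_conj, mul_smul_comm]
    have e2 : (K.rot A n 1 * K.tauBar A n V * (K.rot A n 1)⁻¹).1 = K.elA A n + K.elB A n * K.up n V.1 := by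
      change (K.rot A n 1).1 * (K.tauBar A n V).1
        * star (K.rot A n 1).1 = _
      rw [e1, mul_assoc, Unitary.mul_star_self_of_mem (K.rot A n 1).2, mul_one]
    rw [commutatorElement_eq_one_iff_commute]
    refine Subtype.ext ?_
    change (K.tauBar A n U).1
        * (K.rot A n 1 * K.tauBar A n V * (K.rot A n 1)⁻¹).1
      = (K.rot A n 1 * K.tauBar A n V * (K.rot A n 1)⁻¹).1
        * (K.tauBar A n U).1
    rw [e2, tauBar_val]
    have f1 : K.elA A n * K.up n U.1 * K.elA A n = K.elA A n * K.up n U.1 := by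
      rw [mul_assoc, ← elA_mul_up, ← mul_assoc, elA_mul_self]
    have f2 : K.elA A n * K.up n U.1 * (K.elB A n * K.up n V.1) = 0 := by
      rw [elA_mul_up, mul_assoc, ← mul_assoc (K.elA A n), elA_mul_elB, zero_mul, mul_zero]
    have f3 : K.elB A n * K.up n V.1 * (K.elA A n * K.up n U.1) = 0 := by
      rw [elB_mul_up, mul_assoc, ← mul_assoc (K.elB A n), elB_mul_elA, zero_mul, mul_zero]
    have f4 : K.elB A n * K.up n V.1 * K.elB A n = K.elB A n * K.up n V.1 := by
      rw [mul_assoc, ← elB_mul_up, ← mul_assoc, elB_mul_self]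
    have f5 : K.elA A n * (K.elA A n * K.up n U.1) = K.elA A n * K.up n U.1 := by
      rw [← mul_assoc, elA_mul_self]
    have f6 : K.elB A n * (K.elB A n * K.up n V.1) = K.elB A n * K.up n V.1 := by
      rw [← mul_assoc, elB_mul_self]
    simp only [add_mul, mul_add, f1, f2, f3, f4, f5, f6, elA_mul_elB, elB_mul_elA, add_zero,
      zero_add]
  exact ⟨⟨⟨γ, hγ⟩, h0, h1⟩⟩

theorem commutator_mem_unh (u v : K.UnLim A) : ⁅u, v⁆ ∈ K.unh A := by
  obtain ⟨n, U, V, rfl, rfl⟩ := DirectLimit.exists_eq_mk₂ _ u v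
  change ⁅K.toUn A n U, K.toUn A n V⁆ ∈ _
  have h (W : K.Un A n) : K.toUn A n W = K.toUn A (n + 1) (K.tauBar A n W) := by
    rw [← K.toUn_tau n.le_succ W, tau_succ K le_rfl, tau_self]
  rw [h U, h V, ← map_commutatorElement]
  exact ⟨n + 1, _, K.commutator_mem_unhN n U V, rfl⟩

instance : (K.unh A).Normal := ⟨fun u hu v => by
  have h := mul_mem (K.commutator_mem_unh v u) hu
  rwa [commutatorElement_def, inv_mul_cancel_right] at h⟩

instance : CommGroup (K.UnLim A ⧸ K.unh A) where
  mul_comm a b := by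
    induction a using QuotientGroup.induction_on with | _ u
    induction b using QuotientGroup.induction_on with | _ v
    rw [← QuotientGroup.mk_mul, ← QuotientGroup.mk_mul]
    refine QuotientGroup.eq.2 ?_
    have h := K.commutator_mem_unh v⁻¹ u⁻¹
    rw [commutatorElement_def, inv_inv, inv_inv] at h
    rw [mul_inv_rev, ← mul_assoc]
    exact h

variable (F : Type*) [NonUnitalCStarAlgebra F] [ECStarAlgebra E F]

/-- `K_1` of an `E`-C*-algebra `F`: the quotient of `un` of the full `E`-C*-algebra `E × F` by its
subgroup `un_h`, written additively. -/
def K1 : Type _ := Additive (K.UnLim (EUnit E F) ⧸ K.unh (EUnit E F))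

instance : AddCommGroup (K.K1 F) :=
  inferInstanceAs (AddCommGroup (Additive (K.UnLim (EUnit E F) ⧸ K.unh (EUnit E F))))

/-- The class in `K_1` of a unitary of `(E × F)_n`. -/
def cls1 (n : ℕ) (U : K.Un (EUnit E F) n) : K.K1 F :=
  Additive.ofMul (QuotientGroup.mk (K.toUn (EUnit E F) n U))

end KSystem

end KOne

/-! ### The index map -/

section Index

variable {E T : Type*} [CommCStarAlgebra E] [Group T] (K : KSystem E T)
variable {F G H : Type*} [NonUnitalCStarAlgebra F] [ECStarAlgebra E F]
  [NonUnitalCStarAlgebra G] [ECStarAlgebra E G] [NonUnitalCStarAlgebra H] [ECStarAlgebra E H]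

/-- `δ : K_1(H) → K_0(F)` is the index map of the exact sequence `0 → F → G → H → 0` given by
`φ : F → G` and `ψ : G → H`: one has `δ [U] = [P] - [σ P]`, with `σ (a, x) = (a, 0)`, for all
unitaries `U` of `(E × H)_n`, unitaries `V` of `(E × G)_{n+1}` and projections `P` of
`(E × F)_{n+1}` such that the image of `V` is `A_{n+1} U + B_{n+1} U^*` and the image of `P` is
`V A_{n+1} V^*`. -/
def KSystem.IsIndexMap (φ : F →⋆ₙₐ[E] G) (ψ : G →⋆ₙₐ[E] H) (δ : K.K1 H →+ K.K0 F) : Prop :=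
  ∀ (n : ℕ) (U : K.Un (EUnit E H) n) (V : K.Un (EUnit E G) (n + 1))
    (P : Proj (K.Alg (EUnit E F) (n + 1))),
    K.mapN (EUnit.map ψ) (n + 1) V.1
      = K.elA (EUnit E H) n * K.up n U.1 + K.elB (EUnit E H) n * K.up n (star U.1) →
    K.mapN (EUnit.map φ) (n + 1) P.1 = V.1 * K.elA (EUnit E G) n * star V.1 →
    (δ (K.cls1 H n U) : K.K0Full (EUnit E F))
      = K.cls (n + 1) P - K.cls (n + 1) (K.mapProj (EUnit.scalarPart E F) (n + 1) P)

end Index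

/-! ### Cone and suspension -/

section ConeSusp

variable {E F : Type*} [CommCStarAlgebra E] [NonUnitalCStarAlgebra F] [ECStarAlgebra E F]

instance : ContinuousConstSMul E F := ⟨continuous_const_smul_of_E⟩

variable (F) in
/-- The cone as a *-subalgebra of the continuous functions on `[0, 1]`. -/
def coneSubalg : NonUnitalStarSubalgebra ℂ C(I, F) where
  carrier := {x | x 0 = 0}
  add_mem' := fun {x y} (hx : x 0 = 0) (hy : y 0 = 0) => by
    change x 0 + y 0 = 0
    rw [hx, hy, add_zero]
  zero_mem' := rfl
  mul_mem' := fun {x y} (hx : x 0 = 0) _ => by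
    change x 0 * y 0 = 0
    rw [hx, zero_mul]
  smul_mem' := fun c x (hx : x 0 = 0) => by
    change c • x 0 = 0
    rw [hx, smul_zero]
  star_mem' := fun {x} (hx : x 0 = 0) => by
    change star (x 0) = 0
    rw [hx, star_zero]

variable (F) in
/-- The suspension as a *-subalgebra of the continuous functions on `[0, 1]`. -/
def suspSubalg : NonUnitalStarSubalgebra ℂ C(I, F) where
  carrier := {x | x 0 = 0 ∧ x 1 = 0}
  add_mem' := fun hx hy =>
    ⟨(congrArg₂ (· + ·) hx.1 hy.1).trans (add_zero 0),
      (congrArg₂ (· + ·) hx.2 hy.2).trans (add_zero 0)⟩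
  zero_mem' := ⟨rfl, rfl⟩
  mul_mem' := fun hx hy =>
    ⟨(congrArg₂ (· * ·) hx.1 hy.1).trans (mul_zero 0),
      (congrArg₂ (· * ·) hx.2 hy.2).trans (mul_zero 0)⟩
  smul_mem' := fun c _ hx =>
    ⟨(congrArg (c • ·) hx.1).trans (smul_zero c), (congrArg (c • ·) hx.2).trans (smul_zero c)⟩
  star_mem' := fun hx =>
    ⟨(congrArg star hx.1).trans (star_zero F), (congrArg star hx.2).trans (star_zero F)⟩

instance : IsClosed (coneSubalg F : Set C(I, F)) :=
  isClosed_eq (continuous_eval_const 0) continuous_const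

instance : IsClosed (suspSubalg F : Set C(I, F)) :=
  (isClosed_eq (continuous_eval_const 0) continuous_const).inter
    (isClosed_eq (continuous_eval_const 1) continuous_const)

theorem norm_smul_continuousMap (a : E) (x : C(I, F)) : ‖a • x‖ ≤ ‖a‖ * ‖x‖ :=
  (ContinuousMap.norm_le _ (by positivity)).2 fun t =>
    (ECStarAlgebra.norm_smul_le_mul a (x t)).trans
      (mul_le_mul_of_nonneg_left (x.norm_coe_le_norm t) (norm_nonneg a))

variable (F) in
/-- The cone `CF`: the continuous functions `x : [0, 1] → F` with `x(0) = 0`. -/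
def Cone : Type _ := coneSubalg F

variable (F) in
/-- The suspension `SF`: the continuous functions `x : [0, 1] → F` with `x(0) = x(1) = 0`. -/
def Susp : Type _ := suspSubalg F

instance : NonUnitalCStarAlgebra (Cone F) := inferInstanceAs (NonUnitalCStarAlgebra (coneSubalg F))
instance : NonUnitalCStarAlgebra (Susp F) := inferInstanceAs (NonUnitalCStarAlgebra (suspSubalg F))

/-- The exterior multiplication of the cone is pointwise. -/
instance : ECStarAlgebra E (Cone F) where
  smul a x := ⟨a • x.1, (congrArg (a • ·) x.2).trans (smul_zero a)⟩
  one_smul x := Subtype.ext (one_smul E x.1)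
  mul_smul a b x := Subtype.ext (mul_smul a b x.1)
  smul_zero a := Subtype.ext (smul_zero a)
  smul_add a x y := Subtype.ext (smul_add a x.1 y.1)
  add_smul a b x := Subtype.ext (add_smul a b x.1)
  zero_smul x := Subtype.ext (zero_smul E x.1)
  complex_smul_smul c a x := Subtype.ext (ContinuousMap.ext fun t =>
    ECStarAlgebra.complex_smul_smul c a (x.1 t))
  smul_complex_smul c a x := Subtype.ext (ContinuousMap.ext fun t =>
    ECStarAlgebra.smul_complex_smul c a (x.1 t))
  star_smul_eq a x := Subtype.ext (ContinuousMap.ext fun t =>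
    ECStarAlgebra.star_smul_eq a (x.1 t))
  norm_smul_le_mul a x := norm_smul_continuousMap a x.1
  smul_mul_left a x y := Subtype.ext (ContinuousMap.ext fun t =>
    ECStarAlgebra.smul_mul_left a (x.1 t) (y.1 t))
  smul_mul_right a x y := Subtype.ext (ContinuousMap.ext fun t =>
    ECStarAlgebra.smul_mul_right a (x.1 t) (y.1 t))

/-- The exterior multiplication of the suspension is pointwise. -/
instance : ECStarAlgebra E (Susp F) where
  smul a x := ⟨a • x.1, (congrArg (a • ·) x.2.1).trans (smul_zero a),
    (congrArg (a • ·) x.2.2).trans (smul_zero a)⟩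
  one_smul x := Subtype.ext (one_smul E x.1)
  mul_smul a b x := Subtype.ext (mul_smul a b x.1)
  smul_zero a := Subtype.ext (smul_zero a)
  smul_add a x y := Subtype.ext (smul_add a x.1 y.1)
  add_smul a b x := Subtype.ext (add_smul a b x.1)
  zero_smul x := Subtype.ext (zero_smul E x.1)
  complex_smul_smul c a x := Subtype.ext (ContinuousMap.ext fun t =>
    ECStarAlgebra.complex_smul_smul c a (x.1 t))
  smul_complex_smul c a x := Subtype.ext (ContinuousMap.ext fun t =>
    ECStarAlgebra.smul_complex_smul c a (x.1 t))
  star_smul_eq a x := Subtype.ext (ContinuousMap.ext fun t =>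
    ECStarAlgebra.star_smul_eq a (x.1 t))
  norm_smul_le_mul a x := norm_smul_continuousMap a x.1
  smul_mul_left a x y := Subtype.ext (ContinuousMap.ext fun t =>
    ECStarAlgebra.smul_mul_left a (x.1 t) (y.1 t))
  smul_mul_right a x y := Subtype.ext (ContinuousMap.ext fun t =>
    ECStarAlgebra.smul_mul_right a (x.1 t) (y.1 t))

variable (E F) in
/-- The inclusion `SF → CF`. -/
def suspIncl : Susp F →⋆ₙₐ[E] Cone F where
  toFun x := ⟨x.1, x.2.1⟩
  map_smul' _ _ := rfl
  map_zero' := rfl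
  map_add' _ _ := rfl
  map_mul' _ _ := rfl
  map_star' _ := rfl

variable (E F) in
/-- The evaluation `CF → F`, `x ↦ x(1)`. -/
def coneEval : Cone F →⋆ₙₐ[E] F where
  toFun x := x.1 1
  map_smul' _ _ := rfl
  map_zero' := rfl
  map_add' _ _ := rfl
  map_mul' _ _ := rfl
  map_star' _ := rfl

end ConeSusp

end ProjectiveKTheory

end

/-!
The index map is computed through the algebras `(E × CF)_n` of the cone, whose elements are the
continuous paths in `(E × F)_n` that start in `E_n` and have constant scalar part. Four facts about
them are all the analysis that is needed.

* An element of the cone whose value at `1` is scalar comes from the suspension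
  (`exists_mapN_suspIncl_eq`).
* A unitary of `(E × F)_n` is homotopic to a scalar unitary if and only if it is the value at `1`
  of a unitary of the cone (`mem_unhN_iff_exists_cone`).
* `diag (U, U⁻¹)` is homotopic to `1` (`diag_inv_mem_unhN`), so that every `U` has a lift, a
  unitary `V` of the cone with value `diag (U, U⁻¹)` at `1`.
* A projection of the cone is conjugate to its scalar part by a unitary of the cone
  (`exists_unitary_conj_scalarPart`), since `s ↦ (t ↦ p(s t))` is a norm-continuous path of
  projections and close projections in a C*-algebra are unitarily equivalent.

The rest is algebra. The first fact shows that two projections of the suspension have the same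
class in `K_0` as soon as they are equivalent in the cone through a partial isometry whose value at
`1` is scalar (`cls_eq_of_cone`). Applied to suitable partial isometries `V c W^*`, this gives that
the index `[V A_{n+1} V^*] - [A_{n+1}]` does not depend on the lift `V` of `U`, that it does not
change if `U` is multiplied by a unitary homotopic to a scalar one, and that it is determined by a
decomposition of `1` by scalar partial isometries that intertwine `U` with values of unitaries of
the cone (`index_eq_of_intertwine`). The last statement makes the index additive on block diagonal
unitaries, hence multiplicative on unitaries, because `diag (U₁ U₂, 1) = diag (U₁, U₂) diag (U₂,
U₂⁻¹)`; it also gives surjectivity. Indeed every class is of the form `[P] - [e]` with `e` the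
scalar part of `P`, and if `P = V e V^*` in the cone, then the compression to `e` of the value of
`V` at `1` has this class as its index. For injectivity, `[P] = [A_{n+1}]` yields, after
stabilization, a unitary `W` of the suspension with `W P = A_{n+1} W`; then `W V` commutes with
`A_{n+1}`, and its compression to `A_{n+1}` is, up to a scalar factor, a path from a scalar unitary
to `diag (U, 1)`. Both arguments rest on the fact that projections with the same class in `K_0`
become unitarily equivalent after a scalar projection has been added to both
(`exists_unitary_of_cls_eq`).
-/

noncomputable section

namespace ProjectiveKTheory

/-! ### Paths of projections in C*-algebras -/

/-- Close projections are unitarily equivalent: `z = q p + (1 - q) (1 - p)` intertwines `p` and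
`q`, and so does the unitary part `z (z^* z)^{-1/2}` of its polar decomposition. -/
theorem exists_unitary_conj_of_isUnit {B : Type*} [CStarAlgebra B] {p q : B}
    (hp : IsStarProjection p) (hq : IsStarProjection q)
    (hz : IsUnit (q * p + (1 - q) * (1 - p))) :
    ∃ u ∈ unitary B, u * p = q * u := by
  let := CStarAlgebra.spectralOrder B
  have := CStarAlgebra.spectralOrderedRing B
  set z := q * p + (1 - q) * (1 - p) with hzd
  have hpp : p * p = p := hp.isIdempotentElem
  have hqq : q * q = q := hq.isIdempotentElem
  have h1 : z * p = q * z := by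
    simp only [hzd, add_mul, mul_add, sub_mul, mul_sub, one_mul, mul_one, mul_assoc, hpp,
      ← mul_assoc q q, hqq]
    abel
  have h2 : p * star z = star z * q := by
    simpa [hp.isSelfAdjoint.star_eq, hq.isSelfAdjoint.star_eq] using congrArg star h1
  have h3 : Commute (star z * z) p := by
    change star z * z * p = p * (star z * z)
    rw [mul_assoc, h1, ← mul_assoc, ← h2, mul_assoc]
  have hu : IsUnit (star z * z) := hz.star.mul hz
  have h0 : 0 ≤ star z * z := star_mul_self_nonneg z
  have hsp : IsStrictlyPositive (star z * z) := hu.isStrictlyPositive h0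
  set r := (star z * z) ^ (-(1 / 2) : ℝ) with hr
  have hrs : star r = r := (CFC.rpow_nonneg (a := star z * z)).isSelfAdjoint.star_eq
  have hrp : Commute r p := by
    rw [hr, CFC.rpow_def]
    exact h3.cfc_nnreal _
  have hru : IsUnit r := hu.cfcRpow _
  have hrr : r * (star z * z) * r = 1 := by
    have e1 : star z * z = (star z * z) ^ (1 : ℝ) := (CFC.rpow_one _).symm
    calc r * (star z * z) * r = r * (star z * z) ^ (1 : ℝ) * r := by rw [← e1]
      _ = 1 := by
        rw [hr, ← CFC.rpow_add hu, ← CFC.rpow_add hu]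
        norm_num
        exact CFC.rpow_zero _
  have hs : star (z * r) * (z * r) = 1 := by
    rw [star_mul, hrs]
    simpa only [mul_assoc] using hrr
  refine ⟨z * r, Unitary.mem_iff.2 ⟨hs, ?_⟩, ?_⟩
  · obtain ⟨y, hy⟩ := hz.mul hru
    rw [← hy] at hs ⊢
    rw [eq_comm, ← Units.mul_inv y, Units.inv_eq_of_mul_eq_one_left hs]
  · rw [mul_assoc, hrp.eq, ← mul_assoc, h1, mul_assoc]


/-- The projections on a continuous path are unitarily equivalent, because those with parameters
near `a` are equivalent to the one at `a`: there the element `z` of `exists_unitary_conj_of_isUnit`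
is close to `1`. -/
theorem exists_unitary_conj_of_continuous {B X : Type*} [CStarAlgebra B]
    [TopologicalSpace X] [PreconnectedSpace X] (p : X → B) (hc : Continuous p)
    (hp : ∀ s, IsStarProjection (p s)) (s t : X) :
    ∃ u ∈ unitary (B), u * p s = p t * u := by
  let P : X → X → Prop := fun s t => ∃ u ∈ unitary (B), u * p s = p t * u
  have htr : IsTrans X P := ⟨by
    rintro a b c ⟨u, hu, h1⟩ ⟨v, hv, h2⟩
    exact ⟨v * u, mul_mem hv hu, by rw [mul_assoc, h1, ← mul_assoc, h2, mul_assoc]⟩⟩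
  have hsy : Std.Symm P := ⟨by
    rintro a b ⟨u, hu, h1⟩
    refine ⟨star u, Unitary.star_mem hu, ?_⟩
    calc star u * p b = star u * (p b * u) * star u := by
          rw [mul_assoc, mul_assoc, Unitary.mul_star_self_of_mem hu, mul_one]
      _ = p a * star u := by
          rw [← h1, ← mul_assoc (star u), Unitary.star_mul_self_of_mem hu, one_mul]⟩
  refine PreconnectedSpace.induction₂ P (fun a => ?_) htr s t
  have h1 : Continuous fun b => p b * p a + (1 - p b) * (1 - p a) := by fun_prop
  have h2 : IsUnit (p a * p a + (1 - p a) * (1 - p a)) := by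
    have h := (hp a).isIdempotentElem.eq
    have : p a * p a + (1 - p a) * (1 - p a) = 1 := by
      simp only [sub_mul, mul_sub, one_mul, mul_one, h]
      abel
    rw [this]
    exact isUnit_one
  filter_upwards [(h1.continuousAt).eventually (Units.isOpen.eventually_mem h2)] with b hb
  exact exists_unitary_conj_of_isUnit (hp a) (hp b) hb
section

variable {E T : Type*} [CommCStarAlgebra E] [Group T] (S : SchurSystem E T)
variable {A : Type*} [CStarAlgebra A] [Algebra E A] [FullECStarAlgebra E A]

/-- An operator lies in `A_n` if and only if its entries satisfy linear relations with scalar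
coefficients; in particular `A_n` is closed. -/
theorem mem_projSubalg_iff (n : ℕ) (x : CStarMatrix (S.sub n) (S.sub n) A) :
    x ∈ projSubalg S A n ↔ ∀ s r : S.sub n,
      x s r = (S.f ((s : T) * (r : T)⁻¹) r : E) • x (s * r⁻¹) 1 := by
  constructor
  · rintro ⟨X, rfl⟩ s r
    simp [projOp_apply, S.f_one_right]
  · intro h
    refine ⟨fun t => open Classical in if ht : t ∈ S.sub n then x ⟨t, ht⟩ 1 else 0, ?_⟩
    ext s r
    rw [projOp_apply, h s r, dif_pos (mul_mem s.2 (inv_mem r.2))]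
    rfl

instance (n : ℕ) : IsClosed (projSubalg S A n : Set (CStarMatrix (S.sub n) (S.sub n) A)) := by
  have h : (projSubalg S A n : Set (CStarMatrix (S.sub n) (S.sub n) A))
      = ⋂ s : S.sub n, ⋂ r : S.sub n,
        {x | x s r = (S.f ((s : T) * (r : T)⁻¹) r : E) • x (s * r⁻¹) 1} := by
    ext x
    simpa using mem_projSubalg_iff S n x
  rw [h]
  refine isClosed_iInter fun s => isClosed_iInter fun r =>
    isClosed_eq (continuous_entry s r) ?_
  simp only [Algebra.smul_def]
  exact continuous_const.mul (continuous_entry (s * r⁻¹) 1)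

/-- The C*-algebra structure of the matrices over `A` is only available for the spectral order of
`A`; its topology is the one of `A_n`. -/
theorem exists_unitary_conj_of_path (n : ℕ) (p : I → projAlg S A n) (hc : Continuous p)
    (hp : ∀ s, IsStarProjection (p s)) (s t : I) :
    ∃ u ∈ unitary (projAlg S A n), u * p s = p t * u := by
  let := CStarAlgebra.spectralOrder A
  have := CStarAlgebra.spectralOrderedRing A
  exact exists_unitary_conj_of_continuous (B := projSubalg S A n) p hc hp s t

end

/-! ### The cone as an algebra of paths -/

section
variable {E F G : Type*} [CommCStarAlgebra E] [NonUnitalCStarAlgebra F] [ECStarAlgebra E F]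
  [NonUnitalCStarAlgebra G] [ECStarAlgebra E G]

namespace EUnit

theorem continuous_vec : Continuous (vec : EUnit E F → F) :=
  AddMonoidHomClass.continuous_of_bound
    ((AddMonoidHom.snd E F).comp (toProdHom : EUnit E F →+ E × F)) 2 norm_vec_le

theorem continuous_mk (a : E) : Continuous (mk a : F → EUnit E F) := by
  refine LipschitzWith.continuous (K := 1) (LipschitzWith.of_dist_le_mul fun x y => ?_)
  rw [dist_eq_norm, dist_eq_norm, NNReal.coe_one, one_mul]
  have h : mk a x - mk a y = mk 0 (x - y) := ext (sub_self a) rfl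
  rw [h, norm_def]
  refine (norm_le_add _).trans ?_
  rw [scalar_mk, vec_mk, norm_zero, zero_add]

theorem map_apply (φ : F →⋆ₙₐ[E] G) (z : EUnit E F) : map φ z = mk z.scalar (φ z.vec) :=
  map_mk φ z.scalar z.vec

theorem continuous_scalarPart : Continuous (scalarPart E F) := by
  refine AddMonoidHomClass.continuous_of_bound (scalarPart E F) 1 fun z => ?_
  rw [one_mul, norm_def]
  refine (norm_le_add _).trans ?_
  change ‖z.scalar‖ + ‖(0 : F)‖ ≤ _
  rw [norm_zero, add_zero]
  exact norm_fst_le (toProdMultiplier z)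

theorem proj_comp_map (φ : F →⋆ₙₐ[E] G) : (proj E G).comp (map φ) = proj E F := by
  ext z
  change (map φ z).scalar = z.scalar
  rw [map_apply, scalar_mk]

theorem baseHom_comp_proj : (baseHom E (EUnit E F)).comp (proj E F) = scalarPart E F := rfl

end EUnit

variable (E F) in
/-- The evaluation `CF → F`, `x ↦ x(s)`. -/
def coneAt (s : I) : Cone F →⋆ₙₐ[E] F where
  toFun x := x.1 s
  map_smul' _ _ := rfl
  map_zero' := rfl
  map_add' _ _ := rfl
  map_mul' _ _ := rfl
  map_star' _ := rfl

variable (E F) in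
/-- The homomorphism `CF → CF` that sends `x` to `t ↦ x(s t)`. -/
def coneShrink (s : I) : Cone F →⋆ₙₐ[E] Cone F where
  toFun x := ⟨x.1.comp ⟨fun t => s * t, by fun_prop⟩, by
    change x.1 (s * 0) = 0
    rw [mul_zero]
    exact x.2⟩
  map_smul' _ _ := rfl
  map_zero' := rfl
  map_add' _ _ := rfl
  map_mul' _ _ := rfl
  map_star' _ := rfl

theorem continuous_coneAt (x : Cone F) : Continuous fun s => coneAt E F s x :=
  x.1.continuous

theorem continuous_coneShrink (x : Cone F) : Continuous fun s => coneShrink E F s x := by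
  refine Continuous.subtype_mk ?_ _
  let g : C(I × I, F) := x.1.comp ⟨fun p => p.1 * p.2, by fun_prop⟩
  exact g.curry.continuous

theorem map_coneAt_zero :
    EUnit.map (coneAt E F 0) = (baseHom E (EUnit E F)).comp (EUnit.proj E (Cone F)) := by
  ext z
  rw [EUnit.map_apply]
  exact congrArg (EUnit.mk z.scalar) z.vec.2

theorem map_coneShrink_zero : EUnit.map (coneShrink E F 0)
    = (baseHom E (EUnit E (Cone F))).comp (EUnit.proj E (Cone F)) := by
  ext z
  rw [EUnit.map_apply]
  refine congrArg (EUnit.mk z.scalar) (Subtype.ext (ContinuousMap.ext fun t => ?_))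
  change z.vec.1 (0 * t) = 0
  rw [zero_mul]
  exact z.vec.2

theorem map_coneShrink_one (z : EUnit E (Cone F)) : EUnit.map (coneShrink E F 1) z = z := by
  rw [EUnit.map_apply]
  refine congrArg (EUnit.mk z.scalar) (Subtype.ext (ContinuousMap.ext fun t => ?_))
  change z.vec.1 (1 * t) = z.vec.1 t
  rw [one_mul]

theorem map_coneEval_comp_map_suspIncl : (EUnit.map (coneEval E F)).comp
    (EUnit.map (suspIncl E F)) = (baseHom E (EUnit E F)).comp (EUnit.proj E (Susp F)) := by
  ext z
  change EUnit.map _ (EUnit.map _ z) = _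
  rw [EUnit.map_apply (suspIncl E F), EUnit.map_mk]
  exact congrArg (EUnit.mk z.scalar) z.vec.2.2

end

section
variable {E T : Type*} [CommCStarAlgebra E] [Group T] (S : SchurSystem E T)
variable {A : Type*} [CStarAlgebra A] [Algebra E A] [FullECStarAlgebra E A]

theorem continuous_coeff (n : ℕ) (t : T) :
    Continuous fun x : projAlg S A n => coeff S n x t := by
  unfold coeff
  split_ifs
  · exact (continuous_entry _ _).comp continuous_subtype_val
  · exact continuous_const

theorem continuous_projAlg_of_coeff {X : Type*} [TopologicalSpace X] (n : ℕ)
    {γ : X → projAlg S A n} (h : ∀ t, Continuous fun x => coeff S n (γ x) t) :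
    Continuous γ := by
  have h1 : γ = fun x => projElt S n (coeff S n (γ x)) :=
    funext fun x => (projElt_coeff S n (γ x)).symm
  rw [h1]
  refine Continuous.subtype_mk (continuous_pi fun s => continuous_pi fun r => ?_) _
  change Continuous fun x => (S.f ((s : T) * (r : T)⁻¹) r : E)
    • coeff S n (γ x) ((s : T) * (r : T)⁻¹)
  simp only [Algebra.smul_def]
  exact continuous_const.mul (h _)

theorem mapAlg_eq_self (n : ℕ) {φ : A →⋆ₐ[E] A} (h : ∀ x, φ x = x) (x : projAlg S A n) :
    mapAlg S φ n x = x := by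
  apply coeff_injective
  rw [coeff_mapAlg]
  exact funext fun t => h _

end

namespace KSystem

section
variable {E T : Type*} [CommCStarAlgebra E] [Group T] (K : KSystem E T)
variable {F : Type*} [NonUnitalCStarAlgebra F] [ECStarAlgebra E F]
variable {A : Type*} [CStarAlgebra A] [Algebra E A] [FullECStarAlgebra E A]
variable {B : Type*} [CStarAlgebra B] [Algebra E B] [FullECStarAlgebra E B]

theorem mapN_baseHom (φ : A →⋆ₐ[E] B) (n : ℕ) (e : K.Alg E n) :
    K.mapN φ n (K.mapN (baseHom E A) n e) = K.mapN (baseHom E B) n e := by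
  rw [mapAlg_comp, comp_baseHom]

theorem mapN_proj_baseHom (n : ℕ) (e : K.Alg E n) :
    K.mapN (EUnit.proj E F) n (K.mapN (baseHom E (EUnit E F)) n e) = e := by
  rw [mapN_baseHom]
  exact mapAlg_eq_self _ n (fun _ => rfl) e

theorem mapN_coneEval_suspIncl (n : ℕ) (x : K.Alg (EUnit E (Susp F)) n) :
    K.mapN (EUnit.map (coneEval E F)) n (K.mapN (EUnit.map (suspIncl E F)) n x)
      = K.mapN (baseHom E (EUnit E F)) n (K.mapN (EUnit.proj E (Susp F)) n x) := by
  rw [mapAlg_comp, mapAlg_comp, map_coneEval_comp_map_suspIncl]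

theorem mapN_suspIncl_injective (n : ℕ) :
    Function.Injective (K.mapN (EUnit.map (suspIncl E F)) n) := by
  intro x y h
  apply coeff_injective
  have h1 := congrArg (coeff K.toSchurSystem n) h
  rw [coeff_mapAlg, coeff_mapAlg] at h1
  funext t
  have h2 := congrFun h1 t
  simp only [Function.comp_apply, EUnit.map_apply] at h2
  refine EUnit.ext (congrArg EUnit.scalar h2 :) ?_
  have h3 : suspIncl E F _ = suspIncl E F _ := congrArg EUnit.vec h2
  exact Subtype.ext (congrArg Subtype.val h3 :)

/-- Exactness at the cone: an element whose value at `1` lies in `E_n` comes from the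
suspension. -/
theorem exists_mapN_suspIncl_eq {n : ℕ} {x : K.Alg (EUnit E (Cone F)) n} {e : K.Alg E n}
    (h : K.mapN (EUnit.map (coneEval E F)) n x = K.mapN (baseHom E (EUnit E F)) n e) :
    ∃ y, K.mapN (EUnit.map (suspIncl E F)) n y = x := by
  have h1 (t : T) : (coeff K.toSchurSystem n x t).vec.1 1 = 0 := by
    have h2 := congrFun (congrArg (coeff K.toSchurSystem n) h) t
    rw [coeff_mapAlg, coeff_mapAlg] at h2
    simp only [Function.comp_apply, EUnit.map_apply] at h2
    exact congrArg EUnit.vec h2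
  let Y : T → EUnit E (Susp F) := fun t =>
    EUnit.mk (coeff K.toSchurSystem n x t).scalar
      ⟨(coeff K.toSchurSystem n x t).vec.1, (coeff K.toSchurSystem n x t).vec.2, h1 t⟩
  have hY (t : T) : EUnit.map (suspIncl E F) (Y t) = coeff K.toSchurSystem n x t := by
    rw [EUnit.map_apply]
    rfl
  refine ⟨projElt K.toSchurSystem n Y, ?_⟩
  apply coeff_injective
  rw [coeff_mapAlg]
  funext t
  by_cases ht : t ∈ K.toSchurSystem.sub n
  · rw [Function.comp_apply, coeff_projElt _ _ _ ht, hY]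
  · rw [Function.comp_apply, coeff_of_notMem _ _ _ ht, coeff_of_notMem _ _ _ ht, map_zero]

theorem eq_of_mapN_coneAt {n : ℕ} {x y : K.Alg (EUnit E (Cone F)) n}
    (h : ∀ s, K.mapN (EUnit.map (coneAt E F s)) n x = K.mapN (EUnit.map (coneAt E F s)) n y) :
    x = y := by
  apply coeff_injective
  funext t
  have h1 (s : I) := congrFun (congrArg (coeff K.toSchurSystem n) (h s)) t
  simp only [coeff_mapAlg, Function.comp_apply, EUnit.map_apply] at h1
  refine EUnit.ext (congrArg EUnit.scalar (h1 0) :) ?_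
  exact Subtype.ext (ContinuousMap.ext fun s => (congrArg EUnit.vec (h1 s) :))

/-- The elements of the `n`-th algebra of the cone are the paths in the `n`-th algebra of `F` that
start in `E_n` and have constant image in `E_n`. -/
theorem exists_mapN_coneAt_eq {n : ℕ} {γ : I → K.Alg (EUnit E F) n} (hc : Continuous γ)
    (hγ : ∀ s, K.mapN (EUnit.scalarPart E F) n (γ s) = γ 0) :
    ∃ x, ∀ s, K.mapN (EUnit.map (coneAt E F s)) n x = γ s := by
  have h1 (s : I) (t : T) : EUnit.mk (coeff K.toSchurSystem n (γ s) t).scalar 0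
      = coeff K.toSchurSystem n (γ 0) t := by
    rw [← hγ s, coeff_mapAlg]
    rfl
  let X : T → EUnit E (Cone F) := fun t =>
    EUnit.mk (coeff K.toSchurSystem n (γ 0) t).scalar
      ⟨⟨fun s => (coeff K.toSchurSystem n (γ s) t).vec, EUnit.continuous_vec.comp
        ((continuous_coeff _ n t).comp hc)⟩, (congrArg EUnit.vec (h1 0 t)).symm⟩
  refine ⟨projElt K.toSchurSystem n X, fun s => ?_⟩
  apply coeff_injective
  rw [coeff_mapAlg]
  funext t
  by_cases ht : t ∈ K.toSchurSystem.sub n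
  · rw [Function.comp_apply, coeff_projElt _ _ _ ht, EUnit.map_apply]
    exact EUnit.ext (congrArg EUnit.scalar (h1 s t)).symm rfl
  · rw [Function.comp_apply, coeff_of_notMem _ _ _ ht, coeff_of_notMem _ _ _ ht, map_zero]

theorem continuous_mapN_map {G : Type*} [NonUnitalCStarAlgebra G] [ECStarAlgebra E G]
    {φ : I → F →⋆ₙₐ[E] G} (h : ∀ x, Continuous fun s => φ s x) (n : ℕ)
    (x : K.Alg (EUnit E F) n) : Continuous fun s => K.mapN (EUnit.map (φ s)) n x := by
  refine continuous_projAlg_of_coeff _ n fun t => ?_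
  simp only [coeff_mapAlg, Function.comp_apply, EUnit.map_apply]
  exact (EUnit.continuous_mk _).comp (h _)

/-- The unitaries homotopic to unitaries of `E_n` are those that lift to unitaries of the cone. -/
theorem mem_unhN_iff_exists_cone {n : ℕ} {U : K.Un (EUnit E F) n} :
    U ∈ K.unhN (EUnit E F) n ↔
      ∃ V : K.Un (EUnit E (Cone F)) n, K.mapN (EUnit.map (coneEval E F)) n V.1 = U.1 := by
  constructor
  · rintro ⟨W, ⟨γ⟩⟩
    let sc := K.mapUn (EUnit.scalarPart E F) n
    have hsc_sc (X : K.Un (EUnit E F) n) : sc (sc X) = sc X :=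
      Subtype.ext (mapAlg_comp K.toSchurSystem _ _ n X.1)
    have hscW : sc (K.mapUn (baseHom E (EUnit E F)) n W) = K.mapUn (baseHom E (EUnit E F)) n W :=
      Subtype.ext (K.mapN_baseHom _ n W.1)
    have hscc : Continuous sc := by
      refine Continuous.subtype_mk (continuous_projAlg_of_coeff _ n fun t => ?_) _
      simp only [coeff_mapAlg]
      have h : Continuous (EUnit.scalarPart E F) :=
        EUnit.continuous_scalarPart
      exact h.comp ((continuous_coeff _ n t).comp (K.continuous_unVal n))
    -- dividing by the scalar part makes the scalar part of the path constant
    let δ : I → K.Un (EUnit E F) n := fun s => γ.symm s * (sc (γ.symm s))⁻¹ * sc U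
    have hδc : Continuous δ :=
      ((γ.symm.continuous.mul (hscc.comp γ.symm.continuous).inv).mul continuous_const)
    have hδ0 : δ 0 = sc U := by
      simp only [δ, Path.source, hscW, mul_inv_cancel, one_mul]
    have hδ1 : δ 1 = U := by
      simp only [δ, Path.target, inv_mul_cancel_right]
    have hδsc (s : I) : sc (δ s) = δ 0 := by
      rw [hδ0]
      simp only [δ, map_mul, map_inv, hsc_sc, mul_inv_cancel, one_mul]
    obtain ⟨x, hx⟩ := K.exists_mapN_coneAt_eq ((K.continuous_unVal n).comp hδc)
      (fun s => congrArg Subtype.val (hδsc s))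
    refine ⟨⟨x, Unitary.mem_iff.2 ⟨?_, ?_⟩⟩, ?_⟩
    · refine K.eq_of_mapN_coneAt fun s => ?_
      rw [map_mul, map_star, hx, map_one]
      exact Unitary.star_mul_self_of_mem (δ s).2
    · refine K.eq_of_mapN_coneAt fun s => ?_
      rw [map_mul, map_star, hx, map_one]
      exact Unitary.mul_star_self_of_mem (δ s).2
    · exact (hx 1).trans (congrArg Subtype.val hδ1)
  · rintro ⟨V, hV⟩
    refine ⟨K.mapUn (EUnit.proj E (Cone F)) n V, Joined.symm ⟨⟨⟨fun s =>
      K.mapUn (EUnit.map (coneAt E F s)) n V, ?_⟩, ?_, ?_⟩⟩⟩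
    · exact Continuous.subtype_mk (K.continuous_mapN_map continuous_coneAt n V.1) _
    · refine Subtype.ext ?_
      change K.mapN _ n V.1 = K.mapN _ n (K.mapN _ n V.1)
      rw [map_coneAt_zero, mapAlg_comp]
    · exact Subtype.ext hV

/-- A projection of the cone is unitarily equivalent to its scalar part, because it is homotopic to
it along `s ↦ (t ↦ p(s t))`. -/
theorem exists_unitary_conj_scalarPart {n : ℕ} {p : K.Alg (EUnit E (Cone F)) n}
    (hp : IsStarProjection p) :
    ∃ V : K.Un (EUnit E (Cone F)) n,
      V.1 * K.mapN (baseHom E (EUnit E (Cone F))) n (K.mapN (EUnit.proj E (Cone F)) n p)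
        = p * V.1 := by
  obtain ⟨u, hu, h⟩ := exists_unitary_conj_of_path K.toSchurSystem n
    (fun s => K.mapN (EUnit.map (coneShrink E F s)) n p)
    (K.continuous_mapN_map continuous_coneShrink n p) (fun s => hp.map _) 0 1
  refine ⟨⟨u, hu⟩, ?_⟩
  rw [map_coneShrink_zero,
    mapAlg_eq_self _ n (φ := EUnit.map (coneShrink E F 1)) map_coneShrink_one] at h
  rw [mapAlg_comp]
  exact h

theorem blockDiag_mul (n : ℕ) (x y x' y' : K.Alg A n) :
    (K.elA A n * K.up n x + K.elB A n * K.up n y)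
        * (K.elA A n * K.up n x' + K.elB A n * K.up n y')
      = K.elA A n * K.up n (x * x') + K.elB A n * K.up n (y * y') := by
  have h1 : K.elA A n * K.up n x * (K.elA A n * K.up n x') = K.elA A n * K.up n (x * x') :=
    (map_mul (K.rhoBar A n) x x').symm
  have h2 : K.elA A n * K.up n x * (K.elB A n * K.up n y') = 0 := by
    rw [elA_mul_up, mul_assoc, ← mul_assoc (K.elA A n), elA_mul_elB, zero_mul, mul_zero]
  have h3 : K.elB A n * K.up n y * (K.elA A n * K.up n x') = 0 := by
    rw [elB_mul_up, mul_assoc, ← mul_assoc (K.elB A n), elB_mul_elA, zero_mul, mul_zero]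
  have h4 : K.elB A n * K.up n y * (K.elB A n * K.up n y') = K.elB A n * K.up n (y * y') := by
    rw [elB_mul_up, mul_assoc, ← mul_assoc (K.elB A n), elB_mul_self, elB_mul_up, ← mul_assoc,
      ← map_mul, ← elB_mul_up]
  rw [add_mul, mul_add, mul_add, h1, h2, h3, h4, add_zero, zero_add]

theorem star_blockDiag (n : ℕ) (x y : K.Alg A n) :
    star (K.elA A n * K.up n x + K.elB A n * K.up n y)
      = K.elA A n * K.up n (star x) + K.elB A n * K.up n (star y) := by
  rw [star_add, star_mul, star_mul, star_elA, star_elB, elA_mul_up, elB_mul_up, map_star, map_star]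

variable (A) in
/-- The block diagonal unitary `A_{n+1} U + B_{n+1} V`. -/
def diag (n : ℕ) : K.Un A n × K.Un A n →* K.Un A (n + 1) where
  toFun U := ⟨K.elA A n * K.up n U.1.1 + K.elB A n * K.up n U.2.1, Unitary.mem_iff.2
    ⟨by rw [star_blockDiag, blockDiag_mul, Unitary.star_mul_self_of_mem U.1.2,
          Unitary.star_mul_self_of_mem U.2.2, map_one, mul_one, mul_one, elA_add_elB],
      by rw [star_blockDiag, blockDiag_mul, Unitary.mul_star_self_of_mem U.1.2,
          Unitary.mul_star_self_of_mem U.2.2, map_one, mul_one, mul_one, elA_add_elB]⟩⟩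
  map_one' := Subtype.ext (by
    change K.elA A n * K.up n 1 + K.elB A n * K.up n 1 = 1
    rw [map_one, mul_one, mul_one, elA_add_elB])
  map_mul' U V := Subtype.ext (K.blockDiag_mul n U.1.1 U.2.1 V.1.1 V.2.1).symm

theorem diag_val (n : ℕ) (U V : K.Un A n) :
    (K.diag A n (U, V)).1 = K.elA A n * K.up n U.1 + K.elB A n * K.up n V.1 := rfl

theorem diag_one_right (n : ℕ) (U : K.Un A n) : K.diag A n (U, 1) = K.tauBar A n U := by
  refine Subtype.ext ?_
  change K.elA A n * K.up n U.1 + K.elB A n * K.up n 1 = _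
  rw [map_one, mul_one]
  rfl

/-- `diag (U, U⁻¹)` is the end of the path of the commutators of `diag (U, 1)` and the rotations. -/
theorem diag_inv_mem_unhN (n : ℕ) (U : K.Un A n) : K.diag A n (U, U⁻¹) ∈ K.unhN A (n + 1) := by
  refine ⟨1, ?_⟩
  rw [map_one]
  have hγ : Continuous fun t => K.tauBar A n U * (K.rot A n t * K.tauBar A n U⁻¹
      * (K.rot A n t)⁻¹) :=
    continuous_const.mul (((K.continuous_rot n).mul continuous_const).mul (K.continuous_rot n).inv)
  refine Joined.symm ⟨⟨⟨_, hγ⟩, ?_, ?_⟩⟩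
  · simp only [rot_zero, one_mul, inv_one, mul_one, map_inv, mul_inv_cancel]
  · have e1 : K.rot A n 1 * K.tauBar A n U⁻¹ = K.diag A n (1, U⁻¹) * K.rot A n 1 := by
      refine Subtype.ext ?_
      change (K.rot A n 1).1 * (K.tauBar A n U⁻¹).1
        = (K.elA A n * K.up n 1 + K.elB A n * K.up n (U⁻¹).1) * (K.rot A n 1).1
      rw [rot_one_val, tauBar_val, smul_mul_assoc, elS_conj, mul_smul_comm, map_one, mul_one]
    change K.tauBar A n U * (K.rot A n 1 * K.tauBar A n U⁻¹ * (K.rot A n 1)⁻¹) = _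
    rw [e1, mul_inv_cancel_right, ← diag_one_right, ← map_mul, Prod.mk_mul_mk, mul_one, one_mul]

end
end KSystem

/-! ### Equality of classes in `K_0` -/

namespace KSystem

section
variable {E T : Type*} [CommCStarAlgebra E] [Group T] (K : KSystem E T)
variable {A : Type*} [CStarAlgebra A] [Algebra E A] [FullECStarAlgebra E A]
variable {B : Type*} [CStarAlgebra B] [Algebra E B] [FullECStarAlgebra E B]

theorem cls_add {n : ℕ} (p q : Proj (K.Alg A n)) (h : p.1 * q.1 = 0) :
    K.cls n (p.add q h) = K.cls n p + K.cls n q := by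
  have h1 : (K.toLimProj n p).1 * (K.toLimProj n q).1 = 0 := by
    change K.toLim A n p.1 * K.toLim A n q.1 = 0
    rw [← toLim_mul, h, toLim_zero]
  rw [cls, cls, cls, ← map_add, ProjClass.mk_add _ _ h1]
  exact congrArg (fun P => K.toK0 A (ProjClass.mk P)) (Subtype.ext (K.toLim_add n p.1 q.1))

theorem cls_eq_add {n : ℕ} {p q r : Proj (K.Alg A n)} (h : p.1 * q.1 = 0)
    (hr : r.1 = p.1 + q.1) : K.cls n r = K.cls n p + K.cls n q := by
  rw [← K.cls_add p q h]
  exact congrArg _ (Subtype.ext hr)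

theorem toLimProj_mvN {n : ℕ} {p q : Proj (K.Alg A n)} (h : MvN p q) :
    MvN (K.toLimProj n p) (K.toLimProj n q) := by
  obtain ⟨x, h1, h2⟩ := h
  refine ⟨K.toLim A n x, ?_, ?_⟩
  · rw [← toLim_star, ← toLim_mul, h1]
    rfl
  · rw [← toLim_star, ← toLim_mul, h2]
    rfl

theorem cls_eq_of_mvN {n : ℕ} {p q : Proj (K.Alg A n)} (h : MvN p q) : K.cls n p = K.cls n q :=
  congrArg (K.toK0 A) (ProjClass.sound (K.toLimProj_mvN h))

/-- The image of a projection under `A_m → A_n`. -/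
def rhoProj {m n : ℕ} (h : m ≤ n) (p : Proj (K.Alg A m)) : Proj (K.Alg A n) :=
  ⟨K.rho A m n h p.1, p.2.map _⟩

theorem toLimProj_rhoProj {m n : ℕ} (h : m ≤ n) (p : Proj (K.Alg A m)) :
    K.toLimProj n (K.rhoProj h p) = K.toLimProj m p :=
  Subtype.ext (K.toLim_rho h p.1)

theorem cls_rhoProj {m n : ℕ} (h : m ≤ n) (p : Proj (K.Alg A m)) :
    K.cls n (K.rhoProj h p) = K.cls m p := by
  rw [cls, toLimProj_rhoProj, cls]

theorem rho_self_succ {n : ℕ} (x : K.Alg A n) :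
    K.rho A n (n + 1) n.le_succ x = K.elA A n * K.up n x := by
  rw [K.rho_succ le_rfl, rho_self, rhoBar_apply]

theorem rho_rho {k m n : ℕ} (h : k ≤ m) (h' : m ≤ n) (x : K.Alg A k) :
    K.rho A m n h' (K.rho A k m h x) = K.rho A k n (h.trans h') x :=
  DirectedSystem.map_map' (F := fun n => K.Alg A n) (K.rho A) h h' x

theorem isStarProjection_one (n : ℕ) : IsStarProjection (1 : K.Alg A n) :=
  ⟨mul_one 1, star_one _⟩

variable (A) in
/-- The unit of `A_n`. -/
def oneProj (n : ℕ) : Proj (K.Alg A n) := ⟨1, K.isStarProjection_one n⟩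

variable (A) in
/-- The projection `A_{n+1} = C_{n+1}^* C_{n+1}`. -/
def projA (n : ℕ) : Proj (K.Alg A (n + 1)) := ⟨K.elA A n, K.elA_mul_self A n, K.star_elA A n⟩

variable (A) in
/-- The projection `B_{n+1} = C_{n+1} C_{n+1}^*`. -/
def projB (n : ℕ) : Proj (K.Alg A (n + 1)) := ⟨K.elB A n, K.elB_mul_self A n, K.star_elB A n⟩

theorem mapProj_projA (φ : A →⋆ₐ[E] B) (n : ℕ) :
    K.mapProj φ (n + 1) (K.projA A n) = K.projA B n := Subtype.ext (K.mapN_elA φ n)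

/-- The projection `B_{n+1} p`, which is equivalent to `A_{n+1} p`. -/
def lower {n : ℕ} (p : Proj (K.Alg A n)) : Proj (K.Alg A (n + 1)) :=
  ⟨K.elB A n * K.up n p.1, by
    have h := K.blockDiag_mul n 0 p.1 0 p.1
    simp only [map_zero, mul_zero, zero_add, p.mul_self] at h
    exact h, by
    have h := K.star_blockDiag n 0 p.1
    simp only [map_zero, mul_zero, zero_add, p.star_val, star_zero] at h
    exact h⟩

theorem mvN_lower {n : ℕ} (p : Proj (K.Alg A n)) :
    MvN (K.rhoProj n.le_succ p) (K.lower p) := by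
  have h : K.up n p.1 * K.up n p.1 = K.up n p.1 := by rw [← map_mul, p.mul_self]
  have h' : star (K.up n p.1) = K.up n p.1 := by rw [← map_star, p.star_val]
  refine ⟨K.elC A n * K.up n p.1, ?_, ?_⟩
  · change _ = K.rho A n (n + 1) _ p.1
    rw [rho_self_succ, star_mul, h', mul_assoc, ← mul_assoc (star _), ← elA, elA_mul_up,
      ← mul_assoc, h]
  · change _ = K.elB A n * K.up n p.1
    rw [star_mul, h', mul_assoc, ← mul_assoc (K.up n p.1), h, ← star_elC_mul_up, ← mul_assoc]
    rfl

theorem cls_lower {n : ℕ} (p : Proj (K.Alg A n)) : K.cls (n + 1) (K.lower p) = K.cls n p := by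
  rw [← K.cls_eq_of_mvN (K.mvN_lower p), cls_rhoProj]

theorem rho_mul_lower {n : ℕ} (p q : Proj (K.Alg A n)) :
    (K.rhoProj n.le_succ p).1 * (K.lower q).1 = 0 := by
  change K.rho A n (n + 1) _ p.1 * (K.elB A n * K.up n q.1) = 0
  rw [rho_self_succ, elA_mul_up, mul_assoc, ← mul_assoc (K.elA A n), elA_mul_elB, zero_mul,
    mul_zero]

/-- The block diagonal projection `A_{n+1} p + B_{n+1} q`. -/
def diagProj {n : ℕ} (p q : Proj (K.Alg A n)) : Proj (K.Alg A (n + 1)) :=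
  (K.rhoProj n.le_succ p).add (K.lower q) (K.rho_mul_lower p q)

theorem cls_diagProj {n : ℕ} (p q : Proj (K.Alg A n)) :
    K.cls (n + 1) (K.diagProj p q) = K.cls n p + K.cls n q := by
  rw [diagProj, cls_add, cls_rhoProj, cls_lower]

theorem diagProj_val {n : ℕ} (p q : Proj (K.Alg A n)) :
    (K.diagProj p q).1 = K.elA A n * K.up n p.1 + K.elB A n * K.up n q.1 := by
  rw [← rho_self_succ]
  rfl

/-- The projection `1 - p`. -/
def compl {n : ℕ} (p : Proj (K.Alg A n)) : Proj (K.Alg A n) := ⟨1 - p.1, p.2.one_sub⟩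

variable (A) in
/-- The `2 × 2` matrix with entries `a`, `b`, `c`, `d`; the matrix units are `A_{n+1}`,
`C_{n+1}^*`, `C_{n+1}`, `B_{n+1}`. -/
def block (n : ℕ) (a b c d : K.Alg A n) : K.Alg A (n + 1) :=
  K.elA A n * K.up n a + star (K.elC A n) * K.up n b + K.elC A n * K.up n c
    + K.elB A n * K.up n d

theorem block_mul (n : ℕ) (a b c d a' b' c' d' : K.Alg A n) :
    K.block A n a b c d * K.block A n a' b' c' d'
      = K.block A n (a * a' + b * c') (a * b' + b * d') (c * a' + d * c') (c * b' + d * d') := by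
  have key {e f : K.Alg A (n + 1)} (x y : K.Alg A n) (hf : f * K.up n x = K.up n x * f) :
      e * K.up n x * (f * K.up n y) = e * f * K.up n (x * y) := by
    rw [mul_assoc, ← mul_assoc (K.up n x), ← hf, map_mul, mul_assoc, mul_assoc]
  have h1 : star (K.elC A n) * K.elA A n = 0 := by
    simpa [star_elA] using congrArg star (K.elA_mul_elC A n)
  have h2 : star (K.elC A n) * K.elB A n = star (K.elC A n) := by
    simpa [star_elB] using congrArg star (K.elB_mul_elC A n)
  have h3 : K.elA A n * star (K.elC A n) = star (K.elC A n) := by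
    simpa [star_elA] using congrArg star (K.elC_mul_elA A n)
  have h4 : K.elB A n * star (K.elC A n) = 0 := by
    simpa [star_elB] using congrArg star (K.elC_mul_elB A n)
  have h5 : star (K.elC A n) * star (K.elC A n) = 0 := by
    simpa using congrArg star (K.elC_mul_elC A n)
  have h6 : star (K.elC A n) * K.elC A n = K.elA A n := rfl
  have h7 : K.elC A n * star (K.elC A n) = K.elB A n := rfl
  simp only [block, add_mul, mul_add, key _ _ (K.elA_mul_up n _), key _ _ (K.elB_mul_up n _),
    key _ _ (K.elC_mul_up n _), key _ _ (K.star_elC_mul_up n _), h1, h2, h3, h4, h5, h6, h7,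
    elA_mul_self, elA_mul_elB, elB_mul_elA, elB_mul_self, elC_mul_elA, elC_mul_elB, elB_mul_elC,
    elA_mul_elC, elC_mul_elC, zero_mul, add_zero, zero_add, map_add]
  abel

theorem star_block (n : ℕ) (a b c d : K.Alg A n) :
    star (K.block A n a b c d) = K.block A n (star a) (star c) (star b) (star d) := by
  simp only [block, star_add, star_mul, star_star, star_elA, star_elB, ← map_star,
    ← elA_mul_up, ← elB_mul_up, ← elC_mul_up, ← star_elC_mul_up]
  abel

theorem block_one (n : ℕ) : K.block A n 1 0 0 1 = 1 := by
  simp only [block, map_one, map_zero, mul_one, mul_zero, add_zero, elA_add_elB]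

/-- Murray-von Neumann equivalent projections are unitarily equivalent at the next level. -/
theorem exists_unitary_of_mvN {n : ℕ} {p q : Proj (K.Alg A n)} (h : MvN p q) :
    ∃ W : K.Un A (n + 1), W.1 * (K.rhoProj n.le_succ p).1 = (K.rhoProj n.le_succ q).1 * W.1 := by
  obtain ⟨x, h1, h2, h3, h4⟩ := Proj.exists_partialIsometry h
  have hp := p.mul_self
  have hq := q.mul_self
  have h5 : p.1 * star x = star x := by
    simpa only [star_mul, p.star_val] using (congrArg star h4).symm
  have h6 : star x * q.1 = star x := by
    simpa only [star_mul, q.star_val] using (congrArg star h3).symm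
  have hb (r : Proj (K.Alg A n)) :
      (K.rhoProj n.le_succ r).1 = K.block A n r.1 0 0 0 := by
    change K.rho A n (n + 1) _ r.1 = _
    rw [rho_self_succ, block, map_zero, mul_zero, mul_zero, mul_zero, add_zero, add_zero, add_zero]
  refine ⟨⟨K.block A n x (1 - q.1) (1 - p.1) (star x), Unitary.mem_iff.2 ⟨?_, ?_⟩⟩, ?_⟩
  · rw [star_block, block_mul, ← block_one]
    congr 1 <;> simp [p.star_val, q.star_val, mul_sub, sub_mul, h1, h2, ← h3, ← h4, h5, h6, hp, hq]
  · rw [star_block, block_mul, ← block_one]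
    congr 1 <;> simp [p.star_val, q.star_val, mul_sub, sub_mul, h1, h2, ← h3, ← h4, h5, h6, hp, hq]
  · rw [hb, hb]
    change K.block A n x (1 - q.1) (1 - p.1) (star x) * _
      = _ * K.block A n x (1 - q.1) (1 - p.1) (star x)
    rw [block_mul, block_mul]
    congr 1 <;> simp [mul_sub, sub_mul, ← h3, ← h4, hp, hq]

/-- Projections that are equivalent in the limit are equivalent at some finite level. -/
theorem exists_mvN_of_toLimProj {n : ℕ} {p q : Proj (K.Alg A n)}
    (h : MvN (K.toLimProj n p) (K.toLimProj n q)) :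
    ∃ (m : ℕ) (hm : n ≤ m), MvN (K.rhoProj hm p) (K.rhoProj hm q) := by
  obtain ⟨x, h1, h2⟩ := h
  obtain ⟨l, y, rfl⟩ := DirectLimit.exists_eq_mk _ x
  have hln : n ≤ max l n := le_max_right _ _
  set N := max l n
  set z := K.rho A l N (le_max_left _ _) y
  have hz : K.toLim A N z = K.toLim A l y := K.toLim_rho _ y
  have h1' : K.toLim A N (star z * z) = K.toLim A N (K.rhoProj hln p).1 := by
    rw [toLim_mul, toLim_star, hz]
    exact h1.trans (K.toLim_rho hln p.1).symm
  have h2' : K.toLim A N (z * star z) = K.toLim A N (K.rhoProj hln q).1 := by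
    rw [toLim_mul, toLim_star, hz]
    exact h2.trans (K.toLim_rho hln q.1).symm
  obtain ⟨a, ha, ha'⟩ := K.exists_rho_eq h1'
  obtain ⟨b, hb, hb'⟩ := K.exists_rho_eq h2'
  refine ⟨max a b, hln.trans (ha.trans (le_max_left _ _)),
    K.rho A N (max a b) (ha.trans (le_max_left _ _)) z, ?_, ?_⟩
  · rw [← map_star, ← map_mul, ← K.rho_rho ha (le_max_left a b), ha', rho_rho]
    exact K.rho_rho _ _ _
  · rw [← map_star, ← map_mul, ← K.rho_rho hb (le_max_right a b), hb', rho_rho]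
    exact K.rho_rho _ _ _

/-- The projection `A_{k+1} p + B_{k+1}`. -/
def stabProj {n k : ℕ} (h : n ≤ k) (p : Proj (K.Alg A n)) : Proj (K.Alg A (k + 1)) :=
  K.diagProj (K.rhoProj h p) (K.oneProj A k)

theorem cls_add_compl {n : ℕ} (p : Proj (K.Alg A n)) :
    K.cls n p + K.cls n (K.compl p) = K.cls n (K.oneProj A n) := by
  refine (K.cls_eq_add ?_ ?_).symm
  · change p.1 * (1 - p.1) = 0
    rw [mul_sub, mul_one, p.mul_self, sub_self]
  · change 1 = p.1 + (1 - p.1)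
    abel

theorem mk_toLimProj_add {n : ℕ} (p q : Proj (K.Alg A n)) :
    ProjClass.mk (K.toLimProj n p) + ProjClass.mk (K.toLimProj n q)
      = ProjClass.mk (K.toLimProj (n + 1) (K.diagProj p q)) := by
  have h : (K.toLimProj (n + 1) (K.rhoProj n.le_succ p)).1
      * (K.toLimProj (n + 1) (K.lower q)).1 = 0 := by
    change K.toLim A (n + 1) (K.rhoProj n.le_succ p).1 * K.toLim A (n + 1) (K.lower q).1 = 0
    rw [← toLim_mul, rho_mul_lower, toLim_zero]
  rw [← K.toLimProj_rhoProj n.le_succ p, ← K.toLimProj_rhoProj n.le_succ q,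
    ProjClass.sound (K.toLimProj_mvN (K.mvN_lower q)), ProjClass.mk_add _ _ h]
  exact congrArg ProjClass.mk (Subtype.ext (K.toLim_add (n + 1) _ _).symm)

/-- Projections with the same class in `K_0` become unitarily equivalent at a finite level, after
the same scalar projection has been added to both. -/
theorem exists_unitary_of_cls_eq {n : ℕ} {p q : Proj (K.Alg A n)} (h : K.cls n p = K.cls n q) :
    ∃ (k : ℕ) (hk : n ≤ k) (m : ℕ) (hm : k + 1 ≤ m) (W : K.Un A m),
      W.1 * (K.rhoProj hm (K.stabProj hk p)).1 = (K.rhoProj hm (K.stabProj hk q)).1 * W.1 := by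
  obtain ⟨⟨c, _⟩, hc⟩ := (AddLocalization.r_iff_exists
    (S := (⊤ : AddSubmonoid (ProjClass (K.Lim A))))).1 (AddLocalization.mk_eq_mk_iff.1 h)
  simp only [AddSubmonoid.coe_zero, zero_add] at hc
  induction c using Quotient.inductionOn with | _ R
  change ProjClass.mk R + _ = ProjClass.mk R + _ at hc
  obtain ⟨l, hl⟩ := K.exists_toLimProj R
  obtain ⟨k, hkl, hk⟩ : ∃ k, l ≤ k ∧ n ≤ k := ⟨_, le_max_left l n, le_max_right l n⟩
  obtain ⟨r, rfl⟩ := hl k hkl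
  have h1 : ProjClass.mk (K.toLimProj k r) + ProjClass.mk (K.toLimProj k (K.compl r))
      = ProjClass.mk (K.toLimProj k (K.oneProj A k)) := by
    refine (ProjClass.mk_add _ _ ?_).trans (congrArg ProjClass.mk (Subtype.ext ?_))
    · change K.toLim A k r.1 * K.toLim A k (1 - r.1) = 0
      rw [← toLim_mul, mul_sub, mul_one, r.mul_self, sub_self, toLim_zero]
    · change K.toLim A k r.1 + K.toLim A k (1 - r.1) = K.toLim A k 1
      rw [← toLim_add, add_sub_cancel]
  -- adding the complement of `r` replaces `r` by the unit of `A_k`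
  have h2 (s : Proj (K.Alg A n)) : ProjClass.mk (K.toLimProj (k + 1) (K.stabProj hk s))
      = ProjClass.mk (K.toLimProj k (K.compl r))
        + (ProjClass.mk (K.toLimProj k r) + ProjClass.mk (K.toLimProj n s)) := by
    rw [stabProj, ← mk_toLimProj_add, ← h1, toLimProj_rhoProj]
    abel
  have h3 : ProjClass.mk (K.toLimProj (k + 1) (K.stabProj hk p))
      = ProjClass.mk (K.toLimProj (k + 1) (K.stabProj hk q)) := by
    rw [h2, h2, hc]
  obtain ⟨m, hm, h4⟩ := K.exists_mvN_of_toLimProj (Quotient.exact h3)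
  obtain ⟨W, hW⟩ := K.exists_unitary_of_mvN h4
  have h5 (s : Proj (K.Alg A n)) : K.rhoProj m.le_succ (K.rhoProj hm (K.stabProj hk s))
      = K.rhoProj (hm.trans m.le_succ) (K.stabProj hk s) := Subtype.ext (K.rho_rho _ _ _)
  rw [h5, h5] at hW
  exact ⟨k, hk, m + 1, hm.trans m.le_succ, W, hW⟩

theorem cls_projA (n : ℕ) : K.cls (n + 1) (K.projA A n) = K.cls n (K.oneProj A n) := by
  rw [← K.cls_rhoProj n.le_succ (K.oneProj A n)]
  refine congrArg (K.cls (n + 1)) (Subtype.ext ?_)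
  change _ = K.rho A n (n + 1) _ 1
  rw [rho_self_succ, map_one, mul_one]
  rfl

theorem cls_oneProj_succ (n : ℕ) : K.cls (n + 1) (K.oneProj A (n + 1))
    = K.cls (n + 1) (K.projA A n) + K.cls (n + 1) (K.projA A n) := by
  rw [cls_projA, ← cls_diagProj]
  refine congrArg (K.cls (n + 1)) (Subtype.ext ?_)
  rw [diagProj_val]
  change 1 = K.elA A n * K.up n 1 + K.elB A n * K.up n 1
  rw [map_one, mul_one, mul_one, elA_add_elB]

theorem cls_stabProj {n k : ℕ} (h : n ≤ k) (p : Proj (K.Alg A n)) :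
    K.cls (k + 1) (K.stabProj h p) = K.cls n p + K.cls k (K.oneProj A k) := by
  rw [stabProj, cls_diagProj, cls_rhoProj]

theorem mapProj_rhoProj (φ : A →⋆ₐ[E] B) {m n : ℕ} (h : m ≤ n) (p : Proj (K.Alg A m)) :
    K.mapProj φ n (K.rhoProj h p) = K.rhoProj h (K.mapProj φ m p) :=
  Subtype.ext (K.mapN_rho φ h p.1).symm

theorem mapProj_stabProj (φ : A →⋆ₐ[E] B) {n k : ℕ} (h : n ≤ k) (p : Proj (K.Alg A n)) :
    K.mapProj φ (k + 1) (K.stabProj h p) = K.stabProj h (K.mapProj φ n p) := by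
  refine Subtype.ext ?_
  change K.mapN φ (k + 1) _ = _
  rw [stabProj, stabProj, diagProj_val, diagProj_val, ← mapProj_rhoProj, map_add, map_mul, map_mul,
    mapN_elA, mapN_elB, mapN_up, mapN_up]
  change _ + K.elB B k * K.up k (K.mapN φ k 1) = _ + K.elB B k * K.up k 1
  rw [map_one]
  rfl

theorem exists_cls_sub (x : K.K0Full A) :
    ∃ (n : ℕ) (p q : Proj (K.Alg A n)), x = K.cls n p - K.cls n q := by
  obtain ⟨⟨a, b, _⟩, h⟩ := (AddLocalization.addMonoidOf
    (⊤ : AddSubmonoid (ProjClass (K.Lim A)))).surj x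
  change x + K.toK0 A b = K.toK0 A a at h
  induction a using Quotient.inductionOn with | _ P
  induction b using Quotient.inductionOn with | _ Q
  obtain ⟨k, hk⟩ := K.exists_toLimProj P
  obtain ⟨l, hl⟩ := K.exists_toLimProj Q
  obtain ⟨p, rfl⟩ := hk (max k l) (le_max_left k l)
  obtain ⟨q, rfl⟩ := hl (max k l) (le_max_right k l)
  exact ⟨max k l, p, q, eq_sub_of_add_eq h⟩

end
end KSystem

/-! ### The index of a unitary -/

namespace KSystem

section
variable {E T : Type*} [CommCStarAlgebra E] [Group T] (K : KSystem E T)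
variable {F : Type*} [NonUnitalCStarAlgebra F] [ECStarAlgebra E F]
variable {A : Type*} [CStarAlgebra A] [Algebra E A] [FullECStarAlgebra E A]

variable (F) in
/-- The inclusion of the `n`-th algebra of the suspension in that of the cone. -/
abbrev iN (n : ℕ) : K.Alg (EUnit E (Susp F)) n →⋆ₐ[ℂ] K.Alg (EUnit E (Cone F)) n :=
  K.mapN (EUnit.map (suspIncl E F)) n

variable (F) in
/-- The evaluation at `1` from the `n`-th algebra of the cone to that of `F`. -/
abbrev jN (n : ℕ) : K.Alg (EUnit E (Cone F)) n →⋆ₐ[ℂ] K.Alg (EUnit E F) n :=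
  K.mapN (EUnit.map (coneEval E F)) n

variable (A) in
/-- The inclusion `E_n → A_n`. -/
abbrev bN (n : ℕ) : K.Alg E n →⋆ₐ[ℂ] K.Alg A n := K.mapN (baseHom E A) n

variable (F) in
/-- The retraction of the `n`-th algebra of `E × F` to `E_n`. -/
abbrev prN (n : ℕ) : K.Alg (EUnit E F) n →⋆ₐ[ℂ] K.Alg E n := K.mapN (EUnit.proj E F) n

theorem jN_bN (n : ℕ) (e : K.Alg E n) : K.jN F n (K.bN _ n e) = K.bN _ n e :=
  K.mapN_baseHom _ n e

theorem jN_iN (n : ℕ) (x : K.Alg (EUnit E (Susp F)) n) :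
    K.jN F n (K.iN F n x) = K.bN _ n (K.prN (Susp F) n x) :=
  K.mapN_coneEval_suspIncl n x

theorem prN_iN (n : ℕ) (x : K.Alg (EUnit E (Susp F)) n) :
    K.prN (Cone F) n (K.iN F n x) = K.prN (Susp F) n x := by
  rw [mapAlg_comp, EUnit.proj_comp_map]

theorem prN_jN (n : ℕ) (x : K.Alg (EUnit E (Cone F)) n) :
    K.prN F n (K.jN F n x) = K.prN (Cone F) n x := by
  rw [mapAlg_comp, EUnit.proj_comp_map]

theorem iN_injective (n : ℕ) : Function.Injective (K.iN F n) := K.mapN_suspIncl_injective n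

/-- Projections of the suspension are equivalent if a partial isometry of the cone that is scalar at
`1` implements the equivalence. -/
theorem cls_eq_of_cone {n : ℕ} {V W : K.Un (EUnit E (Cone F)) n}
    {c : K.Alg (EUnit E (Cone F)) n} {e : K.Alg E n} {P Q : Proj (K.Alg (EUnit E (Susp F)) n)}
    (hP : K.iN F n P.1 = W.1 * (star c * c) * star W.1)
    (hQ : K.iN F n Q.1 = V.1 * (c * star c) * star V.1)
    (h : K.jN F n V.1 * K.jN F n c = K.bN _ n e * K.jN F n W.1) : K.cls n P = K.cls n Q := by
  have hW : star W.1 * W.1 = 1 := Unitary.star_mul_self_of_mem W.2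
  have hV : star V.1 * V.1 = 1 := Unitary.star_mul_self_of_mem V.2
  have hW' : W.1 * star W.1 = 1 := Unitary.mul_star_self_of_mem W.2
  obtain ⟨y, hy⟩ := K.exists_mapN_suspIncl_eq (x := V.1 * c * star W.1) (e := e) (by
    rw [map_mul, map_mul, h, mul_assoc, ← map_mul, hW', map_one, mul_one])
  refine K.cls_eq_of_mvN ⟨y, K.iN_injective n ?_, K.iN_injective n ?_⟩
  · rw [map_mul, map_star, hy, hP, star_mul, star_mul, star_star]
    calc W.1 * (star c * star V.1) * (V.1 * c * star W.1)
        = W.1 * (star c * (star V.1 * V.1) * c) * star W.1 := by simp only [mul_assoc]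
      _ = _ := by rw [hV, mul_one]
  · rw [map_mul, map_star, hy, hQ, star_mul, star_mul, star_star]
    calc V.1 * c * star W.1 * (W.1 * (star c * star V.1))
        = V.1 * (c * (star W.1 * W.1) * star c) * star V.1 := by simp only [mul_assoc]
      _ = _ := by rw [hW, mul_one]

/-- A conjugate of a scalar projection by a unitary of the cone that commutes with it at `1` lies in
the suspension. -/
theorem exists_proj_susp {n : ℕ} (V : K.Un (EUnit E (Cone F)) n) {e : K.Alg E n}
    (he : IsStarProjection e) (h : K.jN F n V.1 * K.bN _ n e = K.bN _ n e * K.jN F n V.1) :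
    ∃ P : Proj (K.Alg (EUnit E (Susp F)) n), K.iN F n P.1 = V.1 * K.bN _ n e * star V.1 := by
  have hV : star V.1 * V.1 = 1 := Unitary.star_mul_self_of_mem V.2
  have hV' : V.1 * star V.1 = 1 := Unitary.mul_star_self_of_mem V.2
  obtain ⟨y, hy⟩ := K.exists_mapN_suspIncl_eq (x := V.1 * K.bN _ n e * star V.1) (e := e) (by
    rw [map_mul, map_mul, jN_bN, h, mul_assoc, ← map_mul, hV', map_one, mul_one])
  refine ⟨⟨y, K.iN_injective n ?_, K.iN_injective n ?_⟩, hy⟩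
  · rw [map_mul, hy]
    calc V.1 * K.bN _ n e * star V.1 * (V.1 * K.bN _ n e * star V.1)
        = V.1 * (K.bN _ n e * (star V.1 * V.1) * K.bN _ n e) * star V.1 := by simp only [mul_assoc]
      _ = _ := by rw [hV, mul_one, ← map_mul, he.isIdempotentElem.eq]
  · rw [map_star, hy, star_mul, star_mul, star_star, ← map_star, he.isSelfAdjoint.star_eq,
      mul_assoc]

/-- `V` is a unitary of the cone whose value at `1` is `diag (U, U⁻¹)`. -/
def IsLift (n : ℕ) (U : K.Un (EUnit E F) n) (V : K.Un (EUnit E (Cone F)) (n + 1)) : Prop :=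
  K.jN F (n + 1) V.1 = (K.diag _ n (U, U⁻¹)).1

theorem exists_isLift (n : ℕ) (U : K.Un (EUnit E F) n) : ∃ V, K.IsLift n U V :=
  K.mem_unhN_iff_exists_cone.1 (K.diag_inv_mem_unhN n U)

theorem diag_mul_elA_mul (n : ℕ) (U V : K.Un A n) (x : K.Alg A n) :
    (K.diag A n (U, V)).1 * (K.elA A n * K.up n x) = K.elA A n * K.up n (U.1 * x) := by
  have h := K.blockDiag_mul n U.1 V.1 x 0
  simp only [map_zero, mul_zero, add_zero] at h
  exact h

theorem elA_mul_diag (n : ℕ) (U V : K.Un A n) (x : K.Alg A n) :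
    K.elA A n * K.up n x * (K.diag A n (U, V)).1 = K.elA A n * K.up n (x * U.1) := by
  have h := K.blockDiag_mul n x 0 U.1 V.1
  simp only [map_zero, mul_zero, zero_mul, add_zero] at h
  exact h

theorem diag_mul_elA (n : ℕ) (U V : K.Un A n) :
    (K.diag A n (U, V)).1 * K.elA A n = K.elA A n * K.up n U.1 := by
  simpa only [map_one, mul_one] using K.diag_mul_elA_mul n U V 1

theorem elA_mul_diag_one (n : ℕ) (U V : K.Un A n) :
    K.elA A n * (K.diag A n (U, V)).1 = K.elA A n * K.up n U.1 := by
  simpa only [map_one, mul_one, one_mul] using K.elA_mul_diag n U V 1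

/-- `P` is the projection `V A_{n+1} V^*`, seen in the suspension. -/
def IsLiftProj (n : ℕ) (V : K.Un (EUnit E (Cone F)) (n + 1))
    (P : Proj (K.Alg (EUnit E (Susp F)) (n + 1))) : Prop :=
  K.iN F (n + 1) P.1 = V.1 * K.elA _ n * star V.1

variable {K}

theorem IsLift.jN_mul_elA {n : ℕ} {U : K.Un (EUnit E F) n} {V : K.Un (EUnit E (Cone F)) (n + 1)}
    (h : K.IsLift n U V) : K.jN F (n + 1) V.1 * K.elA _ n = K.elA _ n * K.jN F (n + 1) V.1 := by
  rw [h, diag_mul_elA, elA_mul_diag_one]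

theorem IsLift.exists_proj {n : ℕ} {U : K.Un (EUnit E F) n}
    {V : K.Un (EUnit E (Cone F)) (n + 1)} (h : K.IsLift n U V) : ∃ P, K.IsLiftProj n V P := by
  obtain ⟨P, hP⟩ := K.exists_proj_susp V (K.projA E n).2 (by
    change _ * K.bN _ _ (K.elA E n) = K.bN _ _ (K.elA E n) * _
    rw [mapN_elA]
    exact h.jN_mul_elA)
  refine ⟨P, hP.trans ?_⟩
  change _ * K.bN _ _ (K.elA E n) * _ = _
  rw [mapN_elA]

theorem IsLift.prN_proj {n : ℕ} {U : K.Un (EUnit E F) n}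
    {V : K.Un (EUnit E (Cone F)) (n + 1)} (h : K.IsLift n U V)
    {P : Proj (K.Alg (EUnit E (Susp F)) (n + 1))} (hP : K.IsLiftProj n V P) :
    K.prN (Susp F) (n + 1) P.1 = K.elA E n := by
  have h1 := congrArg (K.prN F (n + 1)) h.jN_mul_elA
  have hV : V.1 * star V.1 = 1 := Unitary.mul_star_self_of_mem V.2
  rw [map_mul, map_mul, prN_jN, mapN_elA] at h1
  rw [← prN_iN, hP, map_mul, map_mul, mapN_elA, h1, mul_assoc, ← map_mul, hV, map_one, mul_one]

variable (K)

theorem exists_lift_data (n : ℕ) (U : K.Un (EUnit E F) n) :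
    ∃ P, ∃ V, K.IsLift n U V ∧ K.IsLiftProj n V P := by
  obtain ⟨V, hV⟩ := K.exists_isLift n U
  obtain ⟨P, hP⟩ := hV.exists_proj
  exact ⟨P, V, hV, hP⟩

/-- The index `[P] - [A_{n+1}]` of a unitary. -/
def index (n : ℕ) (U : K.Un (EUnit E F) n) : K.K0Full (EUnit E (Susp F)) :=
  K.cls (n + 1) (K.exists_lift_data n U).choose - K.cls (n + 1) (K.projA _ n)

variable {K}

theorem IsLift.cls_eq {n : ℕ} {U : K.Un (EUnit E F) n} {V W : K.Un (EUnit E (Cone F)) (n + 1)}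
    (hV : K.IsLift n U V) (hW : K.IsLift n U W) {P Q : Proj (K.Alg (EUnit E (Susp F)) (n + 1))}
    (hP : K.IsLiftProj n V P) (hQ : K.IsLiftProj n W Q) : K.cls (n + 1) P = K.cls (n + 1) Q := by
  refine K.cls_eq_of_cone (V := W) (W := V) (c := K.elA _ n) (e := K.elA E n) ?_ ?_ ?_
  · rw [star_elA, elA_mul_self]
    exact hP
  · rw [star_elA, elA_mul_self]
    exact hQ
  · rw [mapN_elA, mapN_elA, hV, hW, diag_mul_elA, elA_mul_diag_one]

/-- The index does not depend on the choices in its definition. -/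
theorem IsLift.index_eq {n : ℕ} {U : K.Un (EUnit E F) n} {V : K.Un (EUnit E (Cone F)) (n + 1)}
    (hV : K.IsLift n U V) {P : Proj (K.Alg (EUnit E (Susp F)) (n + 1))}
    (hP : K.IsLiftProj n V P) :
    K.index n U = K.cls (n + 1) P - K.cls (n + 1) (K.projA _ n) := by
  obtain ⟨W, hW, hQ⟩ := (K.exists_lift_data n U).choose_spec
  rw [index, hV.cls_eq hW hP hQ]

variable (K)

theorem index_one (n : ℕ) : K.index n (1 : K.Un (EUnit E F) n) = 0 := by
  have h : K.IsLift n (1 : K.Un (EUnit E F) n) 1 := by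
    have h1 : K.diag (EUnit E F) n (1, 1⁻¹) = 1 := by rw [inv_one]; exact map_one _
    rw [IsLift, h1]
    exact map_one _
  rw [h.index_eq (P := K.projA _ n), sub_self]
  change K.iN F (n + 1) (K.elA _ n) = 1 * K.elA _ n * star 1
  rw [mapN_elA, one_mul, star_one, mul_one]

/-- Multiplication by a unitary that lifts to the cone does not change the index. -/
theorem index_mul_of_mem_unhN {n : ℕ} (U : K.Un (EUnit E F) n) {D : K.Un (EUnit E F) n}
    (hD : D ∈ K.unhN _ n) : K.index n (U * D) = K.index n U := by
  obtain ⟨X, hX⟩ := K.mem_unhN_iff_exists_cone.1 hD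
  obtain ⟨P, V, hV, hP⟩ := K.exists_lift_data n (U * D)
  obtain ⟨Q, W, hW, hQ⟩ := K.exists_lift_data n U
  have hX' : X.1 * star X.1 = 1 := Unitary.mul_star_self_of_mem X.2
  let Y : K.Un (EUnit E (Cone F)) (n + 1) := ⟨K.up n X.1, Unitary.map_mem (K.up n) X.2⟩
  rw [hV.index_eq hP, hW.index_eq hQ]
  refine congrArg (· - _) (K.cls_eq_of_cone (V := V) (W := W * Y) (c := K.elA _ n)
    (e := K.elA E n) ?_ ?_ ?_).symm
  · rw [star_elA, elA_mul_self, hQ]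
    change _ = W.1 * K.up n X.1 * K.elA _ n * star (W.1 * K.up n X.1)
    have h1 : K.up n X.1 * K.elA _ n * star (K.up n X.1) = K.elA _ n := by
      rw [← elA_mul_up, mul_assoc, ← map_star, ← map_mul, hX', map_one, mul_one]
    rw [star_mul]
    conv_lhs => rw [← h1]
    simp only [mul_assoc]
  · rw [star_elA, elA_mul_self]
    exact hP
  · change _ = _ * K.jN F (n + 1) (W.1 * K.up n X.1)
    rw [map_mul, mapN_elA, mapN_elA, hV, hW, diag_mul_elA, ← mul_assoc, elA_mul_diag_one, mapN_up,
      hX, mul_assoc, ← map_mul]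
    rfl

/-- If `U c = c j(W)`, then the conjugate of `c^* c` by `W` is equivalent to the conjugate of
`A_{n+1} c c^*` by a lift of `U`. -/
theorem cls_eq_of_intertwine {n : ℕ} {U : K.Un (EUnit E F) n}
    {V : K.Un (EUnit E (Cone F)) (n + 1)} (hV : K.IsLift n U V)
    {W : K.Un (EUnit E (Cone F)) n} {c : K.Alg E n}
    (h : U.1 * K.bN _ n c = K.bN _ n c * K.jN F n W.1)
    {P : Proj (K.Alg (EUnit E (Susp F)) n)}
    (hP : K.iN F n P.1 = W.1 * K.bN _ n (star c * c) * star W.1)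
    {Q : Proj (K.Alg (EUnit E (Susp F)) (n + 1))}
    (hQ : K.iN F (n + 1) Q.1
      = V.1 * (K.elA _ n * K.up n (K.bN _ n (c * star c))) * star V.1) :
    K.cls n P = K.cls (n + 1) Q := by
  have hs : star (K.elA (EUnit E (Cone F)) n * K.up n (K.bN _ n c))
      = K.elA _ n * K.up n (K.bN _ n (star c)) := by
    rw [star_mul, star_elA, elA_mul_up, map_star, map_star]
  have hm (x y : K.Alg E n) : K.elA (EUnit E (Cone F)) n * K.up n (K.bN _ n x)
      * (K.elA _ n * K.up n (K.bN _ n y)) = K.elA _ n * K.up n (K.bN _ n (x * y)) := by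
    rw [map_mul, map_mul]
    exact (map_mul (K.rhoBar (EUnit E (Cone F)) n) _ _).symm.trans (by rw [rhoBar_apply, map_mul])
  rw [← K.cls_rhoProj n.le_succ P]
  refine K.cls_eq_of_cone (V := V)
    (W := ⟨K.up n W.1, Unitary.map_mem (K.up n) W.2⟩)
    (c := K.elA _ n * K.up n (K.bN _ n c)) (e := K.elA E n * K.up n c) ?_ ?_ ?_
  · change K.iN F (n + 1) (K.rho _ n (n + 1) _ P.1) = _
    rw [← mapN_rho, hP, rho_self_succ, hs, hm, map_mul, map_mul, map_star, ← mul_assoc, ← mul_assoc,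
      elA_mul_up]
    change _ = K.up n W.1 * _ * star (K.up n W.1)
    rw [← mul_assoc]
  · rw [hQ, hs, hm]
  · change _ = _ * K.jN F (n + 1) (K.up n W.1)
    rw [hV, map_mul, map_mul, mapN_elA, mapN_elA, mapN_up, mapN_up, mapN_up, jN_bN,
      diag_mul_elA_mul, h, map_mul, mul_assoc]

/-- If `1 = c_1 c_1^* + c_2 c_2^*` with scalar partial isometries `c_1`, `c_2` that intertwine `U`
with the values at `1` of unitaries `W_1`, `W_2` of the cone, then the index of `U` is determined by
the conjugates of `c_1^* c_1` by `W_1` and of `c_2^* c_2` by `W_2`. -/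
theorem index_eq_of_intertwine {n : ℕ} {U : K.Un (EUnit E F) n}
    {W₁ W₂ : K.Un (EUnit E (Cone F)) n} {c₁ c₂ : K.Alg E n}
    (h₁ : IsStarProjection (c₁ * star c₁)) (h₂ : IsStarProjection (c₂ * star c₂))
    (hc : c₁ * star c₁ + c₂ * star c₂ = 1)
    (hW₁ : U.1 * K.bN _ n c₁ = K.bN _ n c₁ * K.jN F n W₁.1)
    (hW₂ : U.1 * K.bN _ n c₂ = K.bN _ n c₂ * K.jN F n W₂.1)
    {P₁ P₂ : Proj (K.Alg (EUnit E (Susp F)) n)}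
    (hP₁ : K.iN F n P₁.1 = W₁.1 * K.bN _ n (star c₁ * c₁) * star W₁.1)
    (hP₂ : K.iN F n P₂.1 = W₂.1 * K.bN _ n (star c₂ * c₂) * star W₂.1) :
    K.index n U = K.cls n P₁ + K.cls n P₂ - K.cls n (K.oneProj _ n) := by
  obtain ⟨P, V, hV, hP⟩ := K.exists_lift_data n U
  have hUU : U.1 * star U.1 = 1 := Unitary.mul_star_self_of_mem U.2
  have hUU' : star U.1 * U.1 = 1 := Unitary.star_mul_self_of_mem U.2
  have key (c : K.Alg E n) (W : K.Un (EUnit E (Cone F)) n) (h : IsStarProjection (c * star c))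
      (hW : U.1 * K.bN _ n c = K.bN _ n c * K.jN F n W.1) :
      ∃ Q : Proj (K.Alg (EUnit E (Susp F)) (n + 1)), K.iN F (n + 1) Q.1
        = V.1 * (K.elA _ n * K.up n (K.bN _ n (c * star c))) * star V.1 := by
    have hWW : W.1 * star W.1 = 1 := Unitary.mul_star_self_of_mem W.2
    have h1 : U.1 * K.bN _ n (c * star c) = K.bN _ n (c * star c) * U.1 := by
      have h2 : K.bN _ n (star c) * star U.1
          = star (K.jN F n W.1) * K.bN _ n (star c) := by
        simpa only [star_mul, map_star] using congrArg star hW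
      calc U.1 * K.bN _ n (c * star c)
          = U.1 * K.bN _ n c * K.bN _ n (star c) * (star U.1 * U.1) := by
            rw [hUU', mul_one, map_mul, mul_assoc]
        _ = K.bN _ n c * (K.jN F n W.1 * star (K.jN F n W.1)) * K.bN _ n (star c) * U.1 := by
            rw [hW, ← mul_assoc, mul_assoc _ (K.bN _ n (star c)), h2]
            simp only [mul_assoc]
        _ = K.bN _ n (c * star c) * U.1 := by
            rw [← map_star, ← map_mul (K.jN F n), hWW, map_one, mul_one, map_mul]
    obtain ⟨Q, hQ⟩ := K.exists_proj_susp V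
      (e := K.elA E n * K.up n (c * star c)) (by
        have h3 := (K.rhoProj n.le_succ ⟨c * star c, h⟩).2
        change IsStarProjection (K.rho E n (n + 1) _ (c * star c)) at h3
        rwa [rho_self_succ] at h3) (by
        rw [hV, map_mul, mapN_elA, mapN_up, diag_mul_elA_mul, h1, elA_mul_diag])
    refine ⟨Q, hQ.trans ?_⟩
    rw [map_mul, mapN_elA, mapN_up]
  obtain ⟨Q₁, hQ₁⟩ := key c₁ W₁ h₁ hW₁
  obtain ⟨Q₂, hQ₂⟩ := key c₂ W₂ h₂ hW₂
  have hVV : star V.1 * V.1 = 1 := Unitary.star_mul_self_of_mem V.2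
  have h12 : c₁ * star c₁ * (c₂ * star c₂) = 0 := by
    rw [eq_sub_of_add_eq' hc, mul_sub, mul_one, h₁.isIdempotentElem.eq, sub_self]
  have horth : Q₁.1 * Q₂.1 = 0 := by
    refine K.iN_injective (n + 1) ?_
    rw [map_mul, hQ₁, hQ₂, map_zero]
    have h3 := map_mul (K.rhoBar (EUnit E (Cone F)) n) (K.bN _ n (c₁ * star c₁))
      (K.bN _ n (c₂ * star c₂))
    rw [← map_mul, h12, map_zero, map_zero, rhoBar_apply, rhoBar_apply] at h3
    set x := K.elA (EUnit E (Cone F)) n * K.up n (K.bN _ n (c₁ * star c₁))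
    set y := K.elA (EUnit E (Cone F)) n * K.up n (K.bN _ n (c₂ * star c₂))
    calc V.1 * x * star V.1 * (V.1 * y * star V.1)
        = V.1 * (x * (star V.1 * V.1) * y) * star V.1 := by simp only [mul_assoc]
      _ = 0 := by rw [hVV, mul_one, ← h3, mul_zero, zero_mul]
  have hsum : P.1 = Q₁.1 + Q₂.1 := by
    refine K.iN_injective (n + 1) ?_
    rw [map_add, hQ₁, hQ₂, hP, ← add_mul, ← mul_add, ← mul_add, ← map_add, ← map_add, hc, map_one,
      map_one, mul_one]
  rw [hV.index_eq hP, K.cls_eq_add horth hsum, K.cls_eq_of_intertwine hV hW₁ hP₁ hQ₁,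
    K.cls_eq_of_intertwine hV hW₂ hP₂ hQ₂, cls_projA]

/-- The index is additive on block diagonal unitaries: `A_{n+1}` intertwines `diag (U₁, U₂)` with
`diag (U₁, U₁⁻¹)`, and `C_{n+1}` intertwines it with `diag (U₂, U₂⁻¹)`. -/
theorem index_diag (n : ℕ) (U₁ U₂ : K.Un (EUnit E F) n) :
    K.index (n + 1) (K.diag _ n (U₁, U₂)) = K.index n U₁ + K.index n U₂ := by
  obtain ⟨P₁, V₁, hV₁, hP₁⟩ := K.exists_lift_data n U₁
  obtain ⟨P₂, V₂, hV₂, hP₂⟩ := K.exists_lift_data n U₂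
  have hA : K.elA E n * star (K.elA E n) = K.elA E n := by rw [star_elA, elA_mul_self]
  have hA' : star (K.elA E n) * K.elA E n = K.elA E n := by rw [star_elA, elA_mul_self]
  rw [hV₁.index_eq hP₁, hV₂.index_eq hP₂, K.index_eq_of_intertwine (W₁ := V₁) (W₂ := V₂)
    (c₁ := K.elA E n) (c₂ := K.elC E n) (P₁ := P₁) (P₂ := P₂), cls_oneProj_succ]
  · abel
  · rw [hA]
    exact (K.projA E n).2
  · exact (K.projB E n).2
  · rw [hA]
    exact K.elA_add_elB E n
  · rw [mapN_elA, hV₁, diag_mul_elA, elA_mul_diag_one]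
  · have h1 : (K.diag (EUnit E F) n (U₁, U₂)).1 * K.elC _ n = K.up n U₂.1 * K.elC _ n := by
      rw [diag_val, elA_mul_up, elB_mul_up, add_mul, mul_assoc, mul_assoc, elA_mul_elC, elB_mul_elC,
        mul_zero, zero_add]
    have h2 : K.elC (EUnit E F) n * (K.diag _ n (U₂, U₂⁻¹)).1 = K.elC _ n * K.up n U₂.1 := by
      rw [diag_val, mul_add, ← mul_assoc, ← mul_assoc, elC_mul_elA, elC_mul_elB, zero_mul, add_zero]
    rw [mapN_elC, hV₂, h1, h2, elC_mul_up]
  · rw [hA', mapN_elA]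
    exact hP₁
  · change _ = _ * K.bN _ _ (K.elA E n) * _
    rw [mapN_elA]
    exact hP₂

theorem index_tauBar (n : ℕ) (U : K.Un (EUnit E F) n) :
    K.index (n + 1) (K.tauBar _ n U) = K.index n U := by
  rw [← diag_one_right, index_diag, index_one, add_zero]

/-- The index is multiplicative, since `diag (U₁ U₂, 1)` is the product of `diag (U₁, U₂)` and of
the null-homotopic unitary `diag (U₂, U₂⁻¹)`. -/
theorem index_mul (n : ℕ) (U₁ U₂ : K.Un (EUnit E F) n) :
    K.index n (U₁ * U₂) = K.index n U₁ + K.index n U₂ := by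
  have h : K.tauBar _ n (U₁ * U₂) = K.diag _ n (U₁, U₂) * K.diag _ n (U₂, U₂⁻¹) := by
    rw [← diag_one_right, ← map_mul, Prod.mk_mul_mk, mul_inv_cancel]
  rw [← index_tauBar, h, K.index_mul_of_mem_unhN _ (K.diag_inv_mem_unhN n U₂), index_diag]

theorem index_tau {m n : ℕ} (h : m ≤ n) (U : K.Un (EUnit E F) m) :
    K.index n (K.tau _ m n h U) = K.index m U := by
  induction h with
  | refl => rw [tau_self]
  | @step n h ih =>
    change K.index (n + 1) _ = _
    rw [tau_succ K h, index_tauBar, ih]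

theorem index_mem_K0 (n : ℕ) (U : K.Un (EUnit E F) n) : K.index n U ∈ K.K0 (Susp F) := by
  obtain ⟨P, V, hV, hP⟩ := K.exists_lift_data n U
  have h : K.mapProj (EUnit.proj E (Susp F)) (n + 1) P = K.projA E n :=
    Subtype.ext (hV.prN_proj hP)
  rw [hV.index_eq hP, K0, AddMonoidHom.mem_ker, map_sub, K0Map_cls, K0Map_cls, h, mapProj_projA,
    sub_self]

end
end KSystem

/-! ### The index map is an isomorphism -/

namespace KSystem

section
variable {E T : Type*} [CommCStarAlgebra E] [Group T] (K : KSystem E T)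
variable {F : Type*} [NonUnitalCStarAlgebra F] [ECStarAlgebra E F]
variable {A : Type*} [CStarAlgebra A] [Algebra E A] [FullECStarAlgebra E A]
variable {B : Type*} [CStarAlgebra B] [Algebra E B] [FullECStarAlgebra E B]

variable (F) in
/-- The index as a homomorphism on the unitary group of the `n`-th algebra. -/
def indexHom (n : ℕ) : K.Un (EUnit E F) n →* Multiplicative (K.K0 (Susp F)) :=
  MonoidHom.mk' (fun U => Multiplicative.ofAdd ⟨K.index n U, K.index_mem_K0 n U⟩)
    fun U V => congrArg Multiplicative.ofAdd (Subtype.ext (K.index_mul n U V))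

variable (F) in
/-- The index as a homomorphism on the inductive limit of the unitary groups. -/
def indexLim : K.UnLim (EUnit E F) →* Multiplicative (K.K0 (Susp F)) :=
  MonoidHom.mk' (DirectLimit.lift (K.tau (EUnit E F)) (fun n U => K.indexHom F n U)
    fun _ _ h U => congrArg Multiplicative.ofAdd (Subtype.ext (K.index_tau h U).symm)) fun u v => by
      obtain ⟨n, U, V, rfl, rfl⟩ := DirectLimit.exists_eq_mk₂ _ u v
      rw [DirectLimit.mul_def]
      exact map_mul (K.indexHom F n) U V

theorem index_eq_zero_of_mem_unhN {n : ℕ} {U : K.Un (EUnit E F) n} (hU : U ∈ K.unhN _ n) :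
    K.index n U = 0 := by
  rw [← one_mul U, K.index_mul_of_mem_unhN 1 hU, index_one]

variable (F) in
/-- The index map `K_1(F) → K_0(SF)`. -/
def indexMap : K.K1 F →+ K.K0 (Susp F) :=
  MonoidHom.toAdditiveLeft (QuotientGroup.lift (K.unh (EUnit E F)) (K.indexLim F) (by
    rintro _ ⟨n, U, hU, rfl⟩
    exact congrArg Multiplicative.ofAdd (Subtype.ext (K.index_eq_zero_of_mem_unhN hU))))

theorem indexMap_cls1 (n : ℕ) (U : K.Un (EUnit E F) n) :
    (K.indexMap F (K.cls1 F n U) : K.K0Full (EUnit E (Susp F))) = K.index n U := rfl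

theorem exists_cls1_eq (x : K.K1 F) : ∃ n U, K.cls1 F n U = x := by
  obtain ⟨u, rfl⟩ := QuotientGroup.mk_surjective (Additive.toMul x)
  obtain ⟨n, U, rfl⟩ := DirectLimit.exists_eq_mk _ u
  exact ⟨n, U, rfl⟩

/-- The index map is the only homomorphism with the defining property. -/
theorem isIndexMap_iff (θ : K.K1 F →+ K.K0 (Susp F)) :
    K.IsIndexMap (suspIncl E F) (coneEval E F) θ ↔ θ = K.indexMap F := by
  have key {n : ℕ} {U : K.Un (EUnit E F) n} {V : K.Un (EUnit E (Cone F)) (n + 1)}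
      {P : Proj (K.Alg (EUnit E (Susp F)) (n + 1))} (hV : K.IsLift n U V)
      (hP : K.IsLiftProj n V P) :
      K.mapProj (EUnit.scalarPart E (Susp F)) (n + 1) P = K.projA _ n := by
    refine Subtype.ext ?_
    change K.mapN _ (n + 1) P.1 = K.elA _ n
    rw [← EUnit.baseHom_comp_proj, ← mapAlg_comp, hV.prN_proj hP, mapN_elA]
  constructor
  · intro h
    ext x
    obtain ⟨n, U, rfl⟩ := K.exists_cls1_eq x
    obtain ⟨P, V, hV, hP⟩ := K.exists_lift_data n U
    rw [indexMap_cls1, h n U V P hV hP, hV.index_eq hP, key hV hP]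
  · rintro rfl n U V P hV hP
    change K.IsLift n U V at hV
    change K.IsLiftProj n V P at hP
    rw [indexMap_cls1, hV.index_eq hP, key hV hP]

theorem isStarProjection_conj {R : Type*} [Ring R] [StarRing R] {p u : R}
    (hp : IsStarProjection p) (hu : u ∈ unitary R) : IsStarProjection (u * p * star u) := by
  refine ⟨?_, hp.isSelfAdjoint.conjugate u⟩
  change u * p * star u * (u * p * star u) = u * p * star u
  calc u * p * star u * (u * p * star u)
      = u * (p * (star u * u) * p) * star u := by simp only [mul_assoc]
    _ = _ := by rw [Unitary.star_mul_self_of_mem hu, mul_one, hp.isIdempotentElem.eq]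

/-- The compression of a unitary to a projection that commutes with it, completed by the identity,
is a unitary. -/
theorem corner_mem_unitary {R : Type*} [Ring R] [StarRing R] {e y : R} (he : IsStarProjection e)
    (hy : y ∈ unitary R) (h : e * y = y * e) : e * y + (1 - e) ∈ unitary R := by
  have h1 := he.isIdempotentElem.eq
  have h2 := he.isSelfAdjoint.star_eq
  have h3 : star y * e = e * star y := by simpa [h2] using congrArg star h
  have h4 := Unitary.star_mul_self_of_mem hy
  have h5 := Unitary.mul_star_self_of_mem hy
  have e1 : e * (1 - e) = 0 := by rw [mul_sub, mul_one, h1, sub_self]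
  have e2 : (1 - e) * e = 0 := by rw [sub_mul, one_mul, h1, sub_self]
  have e3 : (1 - e) * (1 - e) = 1 - e := by rw [mul_sub, e2, mul_one, sub_zero]
  have e4 : star (e * y + (1 - e)) = e * star y + (1 - e) := by
    rw [star_add, star_mul, star_sub, star_one, h2, h3]
  have key (a b : R) (hb : e * b = b * e) (ha : a * e = e * a) (hab : a * b = 1) :
      (e * a + (1 - e)) * (e * b + (1 - e)) = 1 := by
    have f1 : e * a * (e * b) = e := by
      rw [← ha, mul_assoc, ← mul_assoc e, h1, hb, ← mul_assoc, hab, one_mul]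
    have f2 : e * a * (1 - e) = 0 := by rw [← ha, mul_assoc, e1, mul_zero]
    have f3 : (1 - e) * (e * b) = 0 := by rw [← mul_assoc, e2, zero_mul]
    rw [add_mul, mul_add, mul_add, f1, f2, f3, e3]
    abel
  refine Unitary.mem_iff.2 ⟨?_, ?_⟩
  · rw [e4]
    exact key _ _ h h3 h4
  · rw [e4]
    exact key _ _ h3.symm h.symm h5

theorem tau_mul_rho {m n : ℕ} (h : m ≤ n) (U V : K.Un A m) (x : K.Alg A m) :
    (K.tau A m n h U).1 * K.rho A m n h x * (K.tau A m n h V).1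
      = K.rho A m n h (U.1 * x * V.1) := by
  induction h with
  | refl => simp only [tau_self, rho_self]
  | @step n h ih =>
    change (K.tau A m (n + 1) _ U).1 * K.rho A m (n + 1) _ x * (K.tau A m (n + 1) _ V).1
      = K.rho A m (n + 1) _ _
    rw [tau_succ K h, tau_succ K h, K.rho_succ h, K.rho_succ h, ← ih, rhoBar_apply, rhoBar_apply,
      ← diag_one_right, ← diag_one_right, diag_mul_elA_mul, elA_mul_diag]

/-- The maps `τ` are compatible with the compression `e V + (1 - e)` of a unitary `V`. -/
theorem tau_corner {m n : ℕ} (h : m ≤ n) {U V : K.Un A m} {e : K.Alg A m}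
    (hU : U.1 = e * V.1 + (1 - e)) : (K.tau A m n h U).1
      = K.rho A m n h e * (K.tau A m n h V).1 + (1 - K.rho A m n h e) := by
  induction h with
  | refl => simpa only [tau_self, rho_self] using hU
  | @step n h ih =>
    change (K.tau A m (n + 1) _ U).1
      = K.rho A m (n + 1) _ e * (K.tau A m (n + 1) _ V).1 + (1 - K.rho A m (n + 1) _ e)
    rw [tau_succ K h, tau_succ K h, K.rho_succ h, rhoBar_apply, tauBar_val, ih, ← diag_one_right,
      elA_mul_diag, elB_eq, map_add, map_sub, map_one, mul_add, mul_sub, mul_one]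
    abel

theorem mapUn_tau (φ : A →⋆ₐ[E] B) {m n : ℕ} (h : m ≤ n) (U : K.Un A m) :
    K.mapUn φ n (K.tau A m n h U) = K.tau B m n h (K.mapUn φ m U) := by
  induction h with
  | refl => rw [tau_self, tau_self]
  | @step n h ih =>
    change K.mapUn φ (n + 1) (K.tau A m (n + 1) _ U) = K.tau B m (n + 1) _ _
    rw [tau_succ K h, tau_succ K h, mapUn_tauBar, ih]

theorem tau_mul_stabProj {n k : ℕ} (h : n ≤ k) (U : K.Un A n) {p q : Proj (K.Alg A n)}
    (hq : q.1 = U.1 * p.1 * star U.1) :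
    (K.tau A n (k + 1) (h.trans k.le_succ) U).1 * (K.stabProj h p).1
      * star (K.tau A n (k + 1) (h.trans k.le_succ) U).1 = (K.stabProj h q).1 := by
  have h1 : K.rho A n k h q.1
      = (K.tau A n k h U).1 * K.rho A n k h p.1 * (K.tau A n k h U⁻¹).1 := by
    rw [tau_mul_rho, hq]
    rfl
  change _ * _ * ((K.tau A n (k + 1) _ U)⁻¹).1 = _
  rw [← map_inv, tau_succ K h, tau_succ K h, ← diag_one_right, ← diag_one_right, stabProj, stabProj,
    diagProj_val, diagProj_val, diag_val, diag_val, blockDiag_mul, blockDiag_mul]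
  change _ = K.elA A k * K.up k (K.rho A n k h q.1) + K.elB A k * K.up k 1
  rw [h1]
  change _ + K.elB A k * K.up k (1 * 1 * 1) = _
  rw [one_mul, one_mul]
  rfl

theorem tau_corner_stabProj {n k : ℕ} (h : n ≤ k) {U V : K.Un A n} {e : Proj (K.Alg A n)}
    (hU : U.1 = e.1 * V.1 + (1 - e.1)) : (K.tau A n (k + 1) (h.trans k.le_succ) U).1
      = (K.stabProj h e).1 * (K.tau A n (k + 1) (h.trans k.le_succ) V).1
        + (1 - (K.stabProj h e).1) := by
  rw [tau_succ K h, tau_succ K h, tauBar_val, K.tau_corner h hU, ← diag_one_right, stabProj,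
    diagProj_val, diag_val, blockDiag_mul]
  change _ = K.elA A k * K.up k (K.rho A n k h e.1 * (K.tau A n k h V).1)
    + K.elB A k * K.up k (1 * 1) + (1 - (K.elA A k * K.up k (K.rho A n k h e.1)
    + K.elB A k * K.up k 1))
  rw [one_mul, map_one, mul_one, elB_eq, map_add, map_sub, map_one, mul_add, mul_sub, mul_one]
  abel

theorem tau_tau {k m n : ℕ} (h : k ≤ m) (h' : m ≤ n) (U : K.Un A k) :
    K.tau A m n h' (K.tau A k m h U) = K.tau A k n (h.trans h') U :=
  DirectedSystem.map_map' (F := fun n => K.Un A n) (K.tau A) h h' U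

theorem mapProj_rhoProj_stabProj (φ : A →⋆ₐ[E] B) {n k m : ℕ} (hk : n ≤ k) (hm : k + 1 ≤ m)
    (p : Proj (K.Alg A n)) : K.mapProj φ m (K.rhoProj hm (K.stabProj hk p))
      = K.rhoProj hm (K.stabProj hk (K.mapProj φ n p)) := by
  rw [mapProj_rhoProj, mapProj_stabProj]

variable (A) in
theorem bN_stab_projA {n k m : ℕ} (hk : n + 1 ≤ k) (hm : k + 1 ≤ m) :
    K.bN A m (K.rhoProj hm (K.stabProj hk (K.projA E n))).1
      = (K.rhoProj hm (K.stabProj hk (K.projA A n))).1 := by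
  rw [← K.mapProj_projA (baseHom E A) n, ← mapProj_rhoProj_stabProj]
  rfl

/-- A unitary of index `0` becomes homotopic to a scalar unitary: `[P] = [A_{n+1}]` yields, after
stabilization, a unitary `W` of the suspension with `W P = A_{n+1} W`, so that `W V` commutes with
`A_{n+1}`, and its compression to `A_{n+1}` yields a unitary of the cone whose value at `1` is the
image of `U`. -/
theorem exists_tau_mem_unhN {n : ℕ} {U : K.Un (EUnit E F) n} (h0 : K.index n U = 0) :
    ∃ (m : ℕ) (hm : n + 1 ≤ m), K.tau _ (n + 1) m hm (K.tauBar _ n U) ∈ K.unhN _ m := by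
  obtain ⟨P, V, hV, hP⟩ := K.exists_lift_data n U
  rw [hV.index_eq hP, sub_eq_zero] at h0
  obtain ⟨k, hk, m, hm, W, hW⟩ := K.exists_unitary_of_cls_eq h0
  have hnm : n + 1 ≤ m := (hk.trans k.le_succ).trans hm
  set e : Proj (K.Alg E m) := K.rhoProj hm (K.stabProj hk (K.projA E n)) with he
  rw [← K.bN_stab_projA (EUnit E (Susp F)), ← he] at hW
  let V' := K.tau _ (n + 1) m hnm V
  have hP' : K.iN F m (K.rhoProj hm (K.stabProj hk P)).1 = V'.1 * K.bN _ m e.1 * star V'.1 := by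
    have h1 : K.iN F m (K.rhoProj hm (K.stabProj hk P)).1
        = K.rho _ (k + 1) m hm (K.stabProj hk (K.mapProj (EUnit.map (suspIncl E F)) _ P)).1 :=
      congrArg Subtype.val (K.mapProj_rhoProj_stabProj _ hk hm P)
    have h2 := K.tau_mul_stabProj hk V (p := K.projA _ n)
      (q := K.mapProj (EUnit.map (suspIncl E F)) _ P) hP
    rw [h1, ← h2]
    change K.rho _ (k + 1) m hm (_ * _ * ((K.tau _ (n + 1) (k + 1) _ V)⁻¹).1) = _
    rw [← tau_mul_rho, tau_tau, map_inv, tau_tau, bN_stab_projA]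
    rfl
  have hpr : K.prN (Susp F) m (K.rhoProj hm (K.stabProj hk P)).1 = e.1 := by
    have h1 : K.mapProj (EUnit.proj E (Susp F)) (n + 1) P = K.projA E n :=
      Subtype.ext (hV.prN_proj hP)
    rw [he, ← h1, ← mapProj_rhoProj_stabProj]
    rfl
  have hU : (K.tau _ (n + 1) m hnm (K.tauBar _ n U)).1
      = K.bN _ m e.1 * K.jN F m V'.1 + (1 - K.bN _ m e.1) := by
    have hjV : K.mapUn (EUnit.map (coneEval E F)) (n + 1) V = K.diag _ n (U, U⁻¹) :=
      Subtype.ext hV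
    have h1 : (K.tauBar (EUnit E F) n U).1
        = (K.projA _ n).1 * (K.diag _ n (U, U⁻¹)).1 + (1 - (K.projA _ n).1) := by
      change _ = K.elA _ n * _ + (1 - K.elA _ n)
      rw [elA_mul_diag_one, tauBar_val, elB_eq]
    have h2 := K.tau_corner hm (K.tau_corner_stabProj hk h1)
    rw [tau_tau, tau_tau, ← hjV, ← mapUn_tau] at h2
    rw [h2, bN_stab_projA]
    rfl
  let w : K.Un E m := K.mapUn (EUnit.proj E (Susp F)) m W
  -- the factor `w⁻¹` makes the value of `Y` at `1` equal to that of `V'`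
  let Y : K.Un (EUnit E (Cone F)) m :=
    (K.mapUn (baseHom E _) m w)⁻¹ * (K.mapUn (EUnit.map (suspIncl E F)) m W * V')
  have hww : star w.1 * w.1 = 1 := Unitary.star_mul_self_of_mem w.2
  have hYv : Y.1 = K.bN _ m (star w.1) * (K.iN F m W.1 * V'.1) := by
    rw [map_star]
    rfl
  have hV' : star V'.1 * V'.1 = 1 := Unitary.star_mul_self_of_mem V'.2
  have hw : w.1 * e.1 = e.1 * w.1 := by
    have h1 := congrArg (K.prN (Susp F) m) hW
    rw [map_mul, map_mul, hpr, mapN_proj_baseHom] at h1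
    exact h1
  have hw' : e.1 * star w.1 = star w.1 * e.1 := by
    simpa only [star_mul, e.star_val] using congrArg star hw
  have hY : K.bN _ m e.1 * Y.1 = Y.1 * K.bN _ m e.1 := by
    have h1 := congrArg (K.iN F m) hW
    rw [map_mul, map_mul, hP', mapN_baseHom] at h1
    rw [hYv, ← mul_assoc, ← map_mul, hw', map_mul, mul_assoc, ← mul_assoc (K.bN _ m e.1), ← h1]
    simp only [mul_assoc, hV', mul_one]
  have hjY : K.jN F m Y.1 = K.jN F m V'.1 := by
    rw [hYv, map_mul, map_mul, jN_bN, jN_iN, ← mul_assoc, ← map_mul]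
    change K.bN _ m (star w.1 * w.1) * _ = _
    rw [hww, map_one, one_mul]
  refine ⟨m, hnm, K.mem_unhN_iff_exists_cone.2
    ⟨⟨_, corner_mem_unitary (e.2.map (K.bN _ m)) Y.2 hY⟩, ?_⟩⟩
  change K.jN F m (_ + _) = _
  rw [hU, map_add, map_mul, map_sub, map_one, hjY, jN_bN]

theorem indexMap_injective : Function.Injective (K.indexMap F) := by
  refine (injective_iff_map_eq_zero _).2 fun x hx => ?_
  obtain ⟨n, U, rfl⟩ := K.exists_cls1_eq x
  obtain ⟨m, hm, h⟩ := K.exists_tau_mem_unhN (congrArg Subtype.val hx : K.index n U = 0)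
  refine congrArg Additive.ofMul ((QuotientGroup.eq_one_iff _).2 ⟨m, _, h, ?_⟩)
  rw [toUn_tau, ← K.toUn_tau n.le_succ U, tau_succ K le_rfl, tau_self]

/-- The index is surjective: a class of the suspension is a difference `[P] - [e]` in which the
scalar projection `e` is the scalar part of `P`; over the cone `P` is conjugate to `e` by a
unitary `V`, and the compression of the value of `V` at `1` to `e` is the required unitary. -/
theorem indexMap_surjective : Function.Surjective (K.indexMap F) := by
  rintro ⟨x, hx⟩
  obtain ⟨n, p, q, rfl⟩ := K.exists_cls_sub x
  -- `[p] - [q] = ([p] + [1 - q]) - [1]`, and `A_{n+1}` represents `[1]`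
  have h1 : K.cls n p - K.cls n q = K.cls (n + 1) (K.diagProj p (K.compl q))
      - K.cls (n + 1) (K.projA _ n) := by
    rw [cls_diagProj, cls_projA, ← K.cls_add_compl q]
    abel
  rw [K0, AddMonoidHom.mem_ker, h1, map_sub, K0Map_cls, K0Map_cls, mapProj_projA, sub_eq_zero] at hx
  obtain ⟨k, hk, m, hm, W, hW⟩ := K.exists_unitary_of_cls_eq hx
  set e : Proj (K.Alg E m) := K.rhoProj hm (K.stabProj hk (K.projA E n))
  let R := K.rhoProj hm (K.stabProj hk (K.diagProj p (K.compl q)))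
  let W' : K.Un (EUnit E (Susp F)) m := K.mapUn (baseHom E _) m W
  have hW' : star W'.1 * W'.1 = 1 := Unitary.star_mul_self_of_mem W'.2
  have hWW : W.1 * star W.1 = 1 := Unitary.mul_star_self_of_mem W.2
  let P : Proj (K.Alg (EUnit E (Susp F)) m) :=
    ⟨W'.1 * R.1 * star W'.1, isStarProjection_conj R.2 W'.2⟩
  have hRP : MvN R P := ⟨W'.1 * R.1, by
    rw [star_mul, R.star_val, mul_assoc, ← mul_assoc (star W'.1), hW', one_mul, R.mul_self], by
    rw [star_mul, R.star_val, mul_assoc, ← mul_assoc R.1, R.mul_self, ← mul_assoc]⟩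
  have hP : K.prN (Susp F) m P.1 = e.1 := by
    change K.prN (Susp F) m (K.bN _ m W.1 * R.1 * star (K.bN _ m W.1)) = _
    rw [← mapProj_rhoProj_stabProj] at hW
    change W.1 * K.prN (Susp F) m R.1 = _ at hW
    rw [map_mul, map_mul, map_star, mapN_proj_baseHom, hW, mul_assoc, hWW, mul_one]
  obtain ⟨V, hV⟩ := K.exists_unitary_conj_scalarPart (P.2.map (K.iN F m))
  have hVV : V.1 * star V.1 = 1 := Unitary.mul_star_self_of_mem V.2
  rw [prN_iN, hP] at hV
  have hjV : K.bN _ m e.1 * K.jN F m V.1 = K.jN F m V.1 * K.bN _ m e.1 := by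
    have h2 := congrArg (K.jN F m) hV
    rw [map_mul, map_mul, jN_bN, jN_iN, hP] at h2
    exact h2.symm
  let U : K.Un (EUnit E F) m := ⟨_, corner_mem_unitary (e.2.map (K.bN _ m))
    (Unitary.map_mem (K.jN F m) V.2) hjV⟩
  have hee : K.bN (EUnit E F) m e.1 * K.bN _ m e.1 = K.bN _ m e.1 := by
    rw [← map_mul, e.mul_self]
  have hU₁ : U.1 * K.bN _ m e.1 = K.bN _ m e.1 * K.jN F m V.1 := by
    change (K.bN _ m e.1 * K.jN F m V.1 + (1 - K.bN _ m e.1)) * _ = _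
    rw [add_mul, sub_mul, one_mul, hee, sub_self, add_zero, mul_assoc, ← hjV, ← mul_assoc, hee]
  have hU₂ : U.1 * K.bN _ m (1 - e.1) = K.bN _ m (1 - e.1) * K.jN F m 1 := by
    change (K.bN _ m e.1 * K.jN F m V.1 + (1 - K.bN _ m e.1)) * _ = _
    rw [map_sub, map_one, map_one, mul_one, mul_sub, mul_one, add_mul, sub_mul, one_mul, hee,
      sub_self, add_zero, mul_assoc, ← hjV, ← mul_assoc, hee]
    abel
  have hs : star (1 - e.1) = 1 - e.1 := by rw [star_sub, star_one, e.star_val]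
  have h1e : (1 - e.1) * (1 - e.1) = 1 - e.1 := (K.compl e).mul_self
  refine ⟨K.cls1 F m U, Subtype.ext ?_⟩
  rw [indexMap_cls1, K.index_eq_of_intertwine (W₁ := V) (W₂ := 1) (c₁ := e.1) (c₂ := 1 - e.1)
    (P₁ := P) (P₂ := K.compl (K.mapProj (baseHom E _) m e)) ?_ ?_ ?_ hU₁ hU₂ ?_ ?_]
  · change _ = K.cls n p - K.cls n q
    rw [h1, ← K.cls_add_compl (K.mapProj (baseHom E _) m e), ← K.cls_eq_of_mvN hRP,
      mapProj_rhoProj_stabProj, mapProj_projA, cls_rhoProj, cls_rhoProj, cls_stabProj, cls_stabProj]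
    abel
  · rw [e.star_val, e.mul_self]
    exact e.2
  · rw [hs, h1e]
    exact (K.compl e).2
  · rw [hs, h1e, e.star_val, e.mul_self, add_sub_cancel]
  · rw [e.star_val, e.mul_self, hV, mul_assoc, hVV, mul_one]
  · rw [hs, h1e]
    change K.iN F m (1 - K.bN _ m e.1) = 1 * _ * star 1
    rw [map_sub, map_one, mapN_baseHom, map_sub, map_one, one_mul, star_one, mul_one]

end
end KSystem

end ProjectiveKTheory

end

theorem theorem976 {E : Type*} [CommCStarAlgebra E] {T : Type*} [Group T]
    (K : ProjectiveKTheory.KSystem E T) (F : Type*) [NonUnitalCStarAlgebra F]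
    [ProjectiveKTheory.ECStarAlgebra E F] :
    (∃! θ : K.K1 F →+ K.K0 (ProjectiveKTheory.Susp F),
      K.IsIndexMap (ProjectiveKTheory.suspIncl E F) (ProjectiveKTheory.coneEval E F) θ) ∧
    ∀ θ : K.K1 F →+ K.K0 (ProjectiveKTheory.Susp F),
      K.IsIndexMap (ProjectiveKTheory.suspIncl E F) (ProjectiveKTheory.coneEval E F) θ →
        Function.Bijective θ := by
  refine ⟨⟨K.indexMap F, (K.isIndexMap_iff _).2 rfl, fun θ h => (K.isIndexMap_iff θ).1 h⟩,
    fun θ h => ?_⟩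
  rw [(K.isIndexMap_iff θ).1 h]
  exact ⟨K.indexMap_injective, K.indexMap_surjective⟩
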